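/- Let $\Gamma$ be a finite subgroup of $\mathbb{C}^\times$ (the group of $N$-th roots of unity for some $N\ge 1$). Let $X=\{x_\sigma:\sigma\in\Gamma\cup\{0\}\}$ and $Y=\{y_{n,\nu}: n\in\mathbb{Z}_{\ge 1},\ \nu\in\Gamma\}$ be alphabets of noncommuting letters; put $y_{0,1}=1$ and $y_{0,\nu}=0$ for $\nu\ne 1$. Let $\Delta$ and $\Delta_*$ be the coproducts on $\mathbb{C}\langle\!\langle X\rangle\!\rangle$ and $\mathbb{C}\langle\!\langle Y\rangle\!\rangle$ that are multiplicative for concatenation, with $$\Delta(x_\sigma)=x_\sigma\otimes 1+1\otimes x_\sigma,\qquad \Delta_*(y_{n,\nu})=\sum_{\substack{k+l=n,\ k,l\ge 0\\ \kappa\lambda=\nu}}y_{k,\kappa}\otimes y_{l,\lambda}.$$ A series $\Phi$ is called diagonal if its constant term is $1$ and its coproduct is $\Phi\otimes\Phi$. Let $$\mathrm{Li}_{s_1,\dots,s_r}(z_1,\dots,z_r)=\lim_{M\to\infty}\sum_{M\ge k_1>\cdots>k_r>0}\frac{z_1^{k_1}\cdots z_r^{k_r}}{k_1^{s_1}\cdots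 k_r^{s_r}},\qquad I_{[0,1]}(\sigma_1,\dots,\sigma_r)=\int_{1\ge t_1\ge\cdots\ge t_r\ge 0}\ \prod_{i=1}^r\omega_{\sigma_i}(t_i),$$ with $\omega_0(t)=dt/t$ and $\omega_\sigma(t)=dt/(\sigma^{-1}-t)$ for $\sigma\in\Gamma$. (a) There is a unique series $\mathcal{L}\in\mathbb{C}\langle\!\langle Y\rangle\!\rangle$, diagonal for $\Delta_*$, in which the coefficient of $y_{1,1}$ is $0$ and the coefficient of every word $y_{s_1,\sigma_1}\cdots y_{s_r,\sigma_r}$ not beginning with $y_{1,1}$ is $\mathrm{Li}_{s_1,\dots,s_r}(\sigma_1,\dots,\sigma_r)$ (for these words the limit exists). (b) There is a unique series $\mathcal{I}\in\mathbb{C}\langle\!\langle X\rangle\!\rangle$, diagonal for $\Delta$, in which the coefficients of $x_0$ and $x_1$ are $0$ and the coefficient of every word $x_{\sigma_1}\cdots x_{\sigma_r}$ not beginning with $x_1$ and not ending with $x_0$ is $I_{[0,1]}(\sigma_1,\dots,\sigma_r)$ (for these words the integral converges absolutely). (c) Let $T$ be a commuting variable. Define $\mathrm{Li}^{*}_{s_1,\dots,s_r}(\sigma_1,\dots,\sigma_r)\in\mathbb{C}[T]$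 as the coefficient of $y_{s_1,\sigma_1}\cdots y_{s_r,\sigma_r}$ in $\exp(Ty_{1,1})\cdot\mathcal{L}$, and $I^{\mathrm{sh}}_{[0,1]}(\sigma_1,\dots,\sigma_n)\in\mathbb{C}[T]$ as the coefficient of $x_{\sigma_1}\cdots x_{\sigma_n}$ in $\exp(Tx_1)\cdot\mathcal{I}$. Let $A(u)=S(u)^{-1}$, where $S(u)=\exp\Big(\sum_{n\ge 2}\frac{(-1)^{n-1}\zeta(n)}{n}u^n\Big)$, and let $\rho:\mathbb{C}[T]\to\mathbb{C}[T]$ be the $\mathbb{C}$-linear map such that, coefficientwise in $u$, $\rho(e^{Tu})=A(u)e^{Tu}$. Then for all $r\ge 0$, all positive integers $s_1,\dots,s_r$ and all $\sigma_1,\dots,\sigma_r\in\Gamma$, $$\rho\big(\mathrm{Li}^{*}_{s_1,\dots,s_r}(\sigma_1,\sigma_2\sigma_1^{-1},\dots,\sigma_r\sigma_{r-1}^{-1})\big)=I^{\mathrm{sh}}_{[0,1]}(\{0\}^{s_1-1},\sigma_1,\dots,\{0\}^{s_r-1},\sigma_r),$$ where $\{0\}^{m}$ denotes $m$ consecutive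 entries $0$. -/

import Mathlib

open Filter Topology MeasureTheory

noncomputable section

/-! ### Noncommutative formal power series -/

/-- The set `R⟨⟨A⟩⟩` of formal power series in the noncommuting letters `A` with coefficients
in `R`; `Φ w` is the coefficient of the word `w`. -/
def NCSeries (A R : Type*) : Type _ := FreeMonoid A → R

namespace NCSeries

variable {A R S : Type*}

/-- The concatenation (Cauchy) product: the coefficient of `w` in `Φ * Ψ` is the sum of
`Φ u * Ψ v` over all factorizations `w = u v`. -/
instance [Semiring R] : Mul (NCSeries A R) where
  mul Φ Ψ := fun w => ∑ i ∈ Finset.range (w.toList.length + 1),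
    Φ (FreeMonoid.ofList (w.toList.take i)) * Ψ (FreeMonoid.ofList (w.toList.drop i))

/-- Apply a map to all coefficients. -/
def mapCoeff (f : R → S) (Φ : NCSeries A R) : NCSeries A S := fun w => f (Φ w)

open Classical in
/-- Substitution `f(a) = ∑ f_n a^n` of the letter `a` into a power series `f` in one variable. -/
def ofLetter [Semiring R] (a : A) (f : PowerSeries R) : NCSeries A R := fun w =>
  if w = FreeMonoid.of a ^ w.toList.length then PowerSeries.coeff w.toList.length f else 0

/-- A coproduct on `ℂ⟨A⟩`, multiplicative for concatenation, is given by its values on words.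
Here `MonoidAlgebra ℂ (FreeMonoid A × FreeMonoid A)` is `ℂ⟨A⟩ ⊗ ℂ⟨A⟩`, the basis element
indexed by `(u, v)` being `u ⊗ v`. For such a coproduct `Δ`, this is the coefficient
of `u ⊗ v` in `Δ Φ`. -/
def coproductCoeff (Δ : FreeMonoid A →* MonoidAlgebra ℂ (FreeMonoid A × FreeMonoid A))
    (Φ : NCSeries A ℂ) (u v : FreeMonoid A) : ℂ :=
  ∑ᶠ w : FreeMonoid A, Φ w * (Δ w).coeff (u, v)

/-- `Φ` is diagonal: `ε(Φ) = 1` and `Δ Φ = Φ ⊗ Φ`. -/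
def IsDiagonal (Δ : FreeMonoid A →* MonoidAlgebra ℂ (FreeMonoid A × FreeMonoid A))
    (Φ : NCSeries A ℂ) : Prop :=
  Φ 1 = 1 ∧ ∀ u v : FreeMonoid A, coproductCoeff Δ Φ u v = Φ u * Φ v

end NCSeries

/-! ### The two alphabets and their coproducts -/

section Alphabets

/-- The alphabet `X = {x_σ : σ ∈ Γ ∪ {0}}`. -/
abbrev XLetter (Γ : Subgroup ℂˣ) : Type := WithZero Γ

/-- The alphabet `Y = {y_{n,ν} : n ≥ 1, ν ∈ Γ}`. -/
abbrev YLetter (Γ : Subgroup ℂˣ) : Type := ℕ+ × Γ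

/-- The coproduct on `ℂ⟨X⟩`: all letters are primitive, `Δ x = x ⊗ 1 + 1 ⊗ x`. -/
def shuffleCoproduct (Γ : Subgroup ℂˣ) :
    FreeMonoid (XLetter Γ) →*
      MonoidAlgebra ℂ (FreeMonoid (XLetter Γ) × FreeMonoid (XLetter Γ)) :=
  FreeMonoid.lift fun x =>
    MonoidAlgebra.single (FreeMonoid.of x, 1) 1 + MonoidAlgebra.single (1, FreeMonoid.of x) 1

open Classical in
/-- `y_{n,ν}` as an element of `ℂ⟨Y⟩`, extended to `n = 0` by `y_{0,1} = 1` and `y_{0,ν} = 0`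
for `ν ≠ 1`. -/
def yElem (Γ : Subgroup ℂˣ) (n : ℕ) (ν : Γ) : MonoidAlgebra ℂ (FreeMonoid (YLetter Γ)) :=
  if h : 0 < n then MonoidAlgebra.single (FreeMonoid.of (⟨n, h⟩, ν)) 1
  else if ν = 1 then 1 else 0

/-- The pure tensor `p ⊗ q`, in the algebra with basis the `u ⊗ v`. -/
def pureTensor {M : Type*} [Monoid M] (p q : MonoidAlgebra ℂ M) : MonoidAlgebra ℂ (M × M) :=
  MonoidAlgebra.mapDomain (fun u : M => (u, (1 : M))) p *
    MonoidAlgebra.mapDomain (fun v : M => ((1 : M), v)) q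

/-- The coproduct on `ℂ⟨Y⟩`:
`Δ_* y_{n,ν} = ∑_{k + l = n, κ λ = ν} y_{k,κ} ⊗ y_{l,λ}` (with `k, l ≥ 0`). -/
def stuffleCoproduct (Γ : Subgroup ℂˣ) [Fintype Γ] :
    FreeMonoid (YLetter Γ) →*
      MonoidAlgebra ℂ (FreeMonoid (YLetter Γ) × FreeMonoid (YLetter Γ)) :=
  FreeMonoid.lift fun y =>
    ∑ kl ∈ Finset.HasAntidiagonal.antidiagonal (y.1 : ℕ), ∑ κ : Γ,
      pureTensor (yElem Γ kl.1 κ) (yElem Γ kl.2 (κ⁻¹ * y.2))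

end Alphabets

/-! ### The sums defining the coefficients of `Δ Φ` are finite -/

/-- All words occurring in `p` have degree `n`. -/
def IsHomogeneousOfDegree {P : Type*} [Monoid P] (d : P →* Multiplicative ℕ)
    (p : MonoidAlgebra ℂ P) (n : Multiplicative ℕ) : Prop :=
  ∀ m : P, p.coeff m ≠ 0 → d m = n

namespace IsHomogeneousOfDegree

variable {P : Type*} [Monoid P] {d : P →* Multiplicative ℕ}

theorem add {p q : MonoidAlgebra ℂ P} {n : Multiplicative ℕ}
    (hp : IsHomogeneousOfDegree d p n) (hq : IsHomogeneousOfDegree d q n) :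
    IsHomogeneousOfDegree d (p + q) n := by
  intro m hm
  by_cases h : p.coeff m = 0
  · exact hq m fun h' => hm (by simp [h, h'])
  · exact hp m h

theorem sum {ι : Type*} {s : Finset ι} {p : ι → MonoidAlgebra ℂ P} {n : Multiplicative ℕ}
    (hp : ∀ i ∈ s, IsHomogeneousOfDegree d (p i) n) :
    IsHomogeneousOfDegree d (∑ i ∈ s, p i) n := by
  classical
  induction s using Finset.induction_on with
  | empty => intro m hm; simp at hm
  | insert a s ha ih =>
    rw [Finset.sum_insert ha]
    exact (hp a (by simp)).add (ih fun i hi => hp i (by simp [hi]))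

theorem single (m : P) (c : ℂ) :
    IsHomogeneousOfDegree d (MonoidAlgebra.single m c) (d m) := by
  classical
  intro m' hm'
  rw [MonoidAlgebra.coeff_single, Finsupp.single_apply] at hm'
  by_cases h : m = m'
  · rw [h]
  · exact absurd (if_neg h) hm'

theorem mul {p q : MonoidAlgebra ℂ P} {n k : Multiplicative ℕ}
    (hp : IsHomogeneousOfDegree d p n) (hq : IsHomogeneousOfDegree d q k) :
    IsHomogeneousOfDegree d (p * q) (n * k) := by
  classical
  intro m hm
  have := MonoidAlgebra.support_coeff_mul_subset p q (Finsupp.mem_support_iff.2 hm)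
  obtain ⟨a, ha, b, hb, rfl⟩ := Finset.mem_mul.1 this
  rw [map_mul, hp a (Finsupp.mem_support_iff.1 ha), hq b (Finsupp.mem_support_iff.1 hb)]

theorem lift {A : Type*} {δ : A → MonoidAlgebra ℂ P} {wt : A → Multiplicative ℕ}
    (h : ∀ a, IsHomogeneousOfDegree d (δ a) (wt a)) (w : FreeMonoid A) :
    IsHomogeneousOfDegree d (FreeMonoid.lift δ w) (FreeMonoid.lift wt w) := by
  induction w using FreeMonoid.recOn with
  | one =>
    rw [map_one, map_one, MonoidAlgebra.one_def]
    simpa using single (d := d) (1 : P) (1 : ℂ)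
  | of_mul a w ih =>
    rw [map_mul, map_mul, FreeMonoid.lift_eval_of, FreeMonoid.lift_eval_of]
    exact (h a).mul ih

end IsHomogeneousOfDegree

/-- The total degree of a pair of words, for given degrees of the letters. -/
def pairDegree {A : Type*} (wt : A → ℕ) :
    FreeMonoid A × FreeMonoid A →* Multiplicative ℕ :=
  MonoidHom.coprod (FreeMonoid.lift fun a => Multiplicative.ofAdd (wt a))
    (FreeMonoid.lift fun a => Multiplicative.ofAdd (wt a))

theorem finite_words_of_degree {A : Type*} (wt : A → ℕ) (hpos : ∀ a, 0 < wt a)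
    (hfin : ∀ n, {a | wt a ≤ n}.Finite) (n : Multiplicative ℕ) :
    {w : FreeMonoid A | FreeMonoid.lift (fun a => Multiplicative.ofAdd (wt a)) w = n}.Finite := by
  have key : ∀ w : FreeMonoid A,
      w.toList.length ≤ (FreeMonoid.lift (fun a => Multiplicative.ofAdd (wt a)) w).toAdd ∧
      ∀ a ∈ w.toList, wt a ≤ (FreeMonoid.lift (fun a => Multiplicative.ofAdd (wt a)) w).toAdd := by
    intro w
    induction w using FreeMonoid.recOn with
    | one => simp
    | of_mul a w ih =>
      rw [map_mul (FreeMonoid.lift _), FreeMonoid.lift_eval_of, toAdd_mul, toAdd_ofAdd,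
        FreeMonoid.toList_of_mul]
      have := hpos a
      refine ⟨by simp only [List.length_cons]; omega, fun b hb => ?_⟩
      rcases List.mem_cons.1 hb with rfl | hb
      · omega
      · have := ih.2 b hb; omega
  have : Finite {a | wt a ≤ n.toAdd} := hfin n.toAdd
  refine ((List.finite_length_le {a | wt a ≤ n.toAdd} n.toAdd).image
    fun l => FreeMonoid.ofList (l.map Subtype.val)).subset fun w hw => ?_
  obtain ⟨h1, h2⟩ := key w
  have hw' : FreeMonoid.lift (fun a => Multiplicative.ofAdd (wt a)) w = n := hw
  rw [hw'] at h1 h2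
  refine ⟨w.toList.attach.map fun a => ⟨a.1, h2 a.1 a.2⟩, by simpa using h1, ?_⟩
  simp [List.map_map, Function.comp_def]

theorem shuffleCoproduct_finite (Γ : Subgroup ℂˣ) [Finite Γ] (u v : FreeMonoid (XLetter Γ)) :
    {w | (shuffleCoproduct Γ w).coeff (u, v) ≠ 0}.Finite := by
  have : Finite (XLetter Γ) := inferInstanceAs (Finite (Option Γ))
  refine (finite_words_of_degree (fun _ : XLetter Γ => 1) (fun _ => one_pos)
    (fun _ => Set.toFinite _) (pairDegree (fun _ : XLetter Γ => 1) (u, v))).subset fun w hw => ?_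
  refine (IsHomogeneousOfDegree.lift (d := pairDegree fun _ : XLetter Γ => 1)
    (fun a => ?_) w (u, v) hw).symm
  refine .add ?_ ?_
  · simpa [pairDegree] using
      IsHomogeneousOfDegree.single (d := pairDegree fun _ : XLetter Γ => 1) (FreeMonoid.of a, 1) 1
  · simpa [pairDegree] using
      IsHomogeneousOfDegree.single (d := pairDegree fun _ : XLetter Γ => 1) (1, FreeMonoid.of a) 1

theorem stuffleCoproduct_finite (Γ : Subgroup ℂˣ) [Fintype Γ] (u v : FreeMonoid (YLetter Γ)) :
    {w | (stuffleCoproduct Γ w).coeff (u, v) ≠ 0}.Finite := by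
  have zero : ∀ n, IsHomogeneousOfDegree (pairDegree fun y : YLetter Γ => (y.1 : ℕ)) 0 n :=
    fun n m hm => absurd rfl hm
  have one : IsHomogeneousOfDegree (pairDegree fun y : YLetter Γ => (y.1 : ℕ)) 1 1 := by
    rw [MonoidAlgebra.one_def]
    simpa using IsHomogeneousOfDegree.single
      (d := pairDegree fun y : YLetter Γ => (y.1 : ℕ)) 1 1
  refine (finite_words_of_degree (fun y : YLetter Γ => (y.1 : ℕ)) (fun y => y.1.pos)
    (fun n => ?_) (pairDegree (fun y : YLetter Γ => (y.1 : ℕ)) (u, v))).subset fun w hw => ?_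
  · have h : {y : ℕ+ × Γ | (y.1 : ℕ) ≤ n} ⊆
        (fun y : ℕ+ × Γ => ((y.1 : ℕ), y.2)) ⁻¹' (Set.Iic n ×ˢ Set.univ) := by
      intro y hy; simpa using hy
    refine Set.Finite.subset (Set.Finite.preimage ?_
      ((Set.finite_Iic n).prod Set.finite_univ)) h
    intro a _ b _ hab
    simp only [Prod.mk.injEq] at hab
    exact Prod.ext (PNat.coe_injective hab.1) hab.2
  · refine (IsHomogeneousOfDegree.lift
      (d := pairDegree fun y : YLetter Γ => (y.1 : ℕ)) (fun y => ?_) w (u, v) hw).symm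
    refine .sum fun kl hkl => .sum fun κ _ => ?_
    rw [← Finset.HasAntidiagonal.mem_antidiagonal.1 hkl, ofAdd_add]
    refine .mul ?_ ?_
    · unfold yElem
      split_ifs with h h'
      · rw [MonoidAlgebra.mapDomain_single]
        simpa [pairDegree] using IsHomogeneousOfDegree.single
          (d := pairDegree fun y : YLetter Γ => (y.1 : ℕ)) (FreeMonoid.of (⟨kl.1, h⟩, κ), 1) 1
      · rw [MonoidAlgebra.one_def, MonoidAlgebra.mapDomain_single, Nat.eq_zero_of_not_pos h]
        exact one
      · simpa using zero _
    · unfold yElem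
      split_ifs with h h'
      · rw [MonoidAlgebra.mapDomain_single]
        simpa [pairDegree] using IsHomogeneousOfDegree.single
          (d := pairDegree fun y : YLetter Γ => (y.1 : ℕ))
          (1, FreeMonoid.of (⟨kl.2, h⟩, κ⁻¹ * y.2)) 1
      · rw [MonoidAlgebra.one_def, MonoidAlgebra.mapDomain_single, Nat.eq_zero_of_not_pos h]
        exact one
      · simpa using zero _

/-! ### Polylogarithm series and iterated integrals -/

/-- The partial sum over `M ≥ k_1 > ⋯ > k_r > 0` of `∏ z_i ^ k_i / k_i ^ s_i`. -/
def polylogPartialSum {r : ℕ} (s : Fin r → ℕ) (z : Fin r → ℂ) (M : ℕ) : ℂ :=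
  open Classical in
  ∑ k ∈ (Fintype.piFinset fun _ : Fin r => Finset.Icc 1 M).filter StrictAnti,
    ∏ i, z i ^ k i / (k i : ℂ) ^ s i

/-- The series `Li_{s_1,…,s_r}(z_1,…,z_r)` converges (its outermost index `k_1` being summed in
increasing order) and its sum is `l`. -/
def HasPolylog {r : ℕ} (s : Fin r → ℕ) (z : Fin r → ℂ) (l : ℂ) : Prop :=
  Tendsto (polylogPartialSum s z) atTop (𝓝 l)

/-- The density of `ω_σ`: `ω_0 = dt / t`, and `ω_σ = dt / (σ⁻¹ - t)` for `σ ≠ 0`. -/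
def omegaDensity {Γ : Subgroup ℂˣ} : XLetter Γ → ℝ → ℂ
  | none, t => 1 / (t : ℂ)
  | some σ, t => 1 / (((σ : ℂˣ) : ℂ)⁻¹ - (t : ℂ))

/-- The simplex `1 ≥ t_1 ≥ ⋯ ≥ t_r ≥ 0`. -/
def orderedSimplex (r : ℕ) : Set (Fin r → ℝ) :=
  {t | (∀ i, t i ∈ Set.Icc (0 : ℝ) 1) ∧ Antitone t}

/-- The iterated integral `I_{[0,1]}(σ_1,…,σ_r)` converges (absolutely), and its value is `l`. -/
def HasIteratedIntegral {Γ : Subgroup ℂˣ} {r : ℕ} (σ : Fin r → XLetter Γ) (l : ℂ) : Prop :=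
  IntegrableOn (fun t : Fin r → ℝ => ∏ i, omegaDensity (σ i) (t i)) (orderedSimplex r) ∧
    ∫ t in orderedSimplex r, ∏ i, omegaDensity (σ i) (t i) = l

/-! ### The regularized generating series -/

/-- The defining properties of the series `ℒ`: it is diagonal for `Δ_*`, its image under `π_cv`
is the generating series `ℒ_cv` of the convergent `Li_{s_1,…,s_r}(σ_1,…,σ_r)`, i.e. those with
`(s_1, σ_1) ≠ (1, 1)`, and the coefficient of `y_{1,1}` is `0`. -/
structure IsPolylogSeries (Γ : Subgroup ℂˣ) [Fintype Γ] (L : NCSeries (YLetter Γ) ℂ) : Prop where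
  diagonal : NCSeries.IsDiagonal (stuffleCoproduct Γ) L
  convergent : ∀ w : FreeMonoid (YLetter Γ), w.toList.head? ≠ some (1, 1) →
    HasPolylog (fun i => ((w.toList.get i).1 : ℕ))
      (fun i => (((w.toList.get i).2 : ℂˣ) : ℂ)) (L w)
  coeff_y_one_one : L (FreeMonoid.of (1, 1)) = 0

/-- The defining properties of the series `ℐ`: it is diagonal for `Δ`, its image under `π_cv`
is the generating series `ℐ_cv` of the convergent `I_{[0,1]}(σ_1,…,σ_r)`, i.e. those with
`σ_1 ≠ 1` and `σ_r ≠ 0`, and the coefficients of `x_0` and `x_1` are `0`. -/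
structure IsIntegralSeries (Γ : Subgroup ℂˣ) (I : NCSeries (XLetter Γ) ℂ) : Prop where
  diagonal : NCSeries.IsDiagonal (shuffleCoproduct Γ) I
  convergent : ∀ w : FreeMonoid (XLetter Γ),
    w.toList.head? ≠ some 1 → w.toList.getLast? ≠ some 0 →
      HasIteratedIntegral (fun i => w.toList.get i) (I w)
  coeff_x_zero : I (FreeMonoid.of 0) = 0
  coeff_x_one : I (FreeMonoid.of 1) = 0

/-- The power series `e^{Tu}` in the variable `u` over `ℂ[T]`. -/
def expTu : PowerSeries (Polynomial ℂ) :=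
  PowerSeries.rescale Polynomial.X (PowerSeries.exp (Polynomial ℂ))

/-- `ℒ' = exp(T y_{1,1}) · ℒ`, a series over `ℂ[T]`. -/
def polylogSeriesT {Γ : Subgroup ℂˣ} (L : NCSeries (YLetter Γ) ℂ) :
    NCSeries (YLetter Γ) (Polynomial ℂ) :=
  NCSeries.ofLetter (1, 1) expTu * NCSeries.mapCoeff Polynomial.C L

/-- `ℐ' = exp(T x_1) · ℐ`, a series over `ℂ[T]`. -/
def integralSeriesT {Γ : Subgroup ℂˣ} (I : NCSeries (XLetter Γ) ℂ) :
    NCSeries (XLetter Γ) (Polynomial ℂ) :=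
  NCSeries.ofLetter 1 expTu * NCSeries.mapCoeff Polynomial.C I

/-- `Li^*_{s_1,…,s_r}(σ_1,…,σ_r)`: the coefficient of `y_{s_1,σ_1} ⋯ y_{s_r,σ_r}` in `ℒ'`. -/
def stuffleRegLi {Γ : Subgroup ℂˣ} (L : NCSeries (YLetter Γ) ℂ) {r : ℕ}
    (s : Fin r → ℕ+) (σ : Fin r → Γ) : Polynomial ℂ :=
  polylogSeriesT L (FreeMonoid.ofList (List.ofFn fun i => (s i, σ i)))

/-- `I^Ш_{[0,1]}(w)`: the coefficient in `ℐ'` of `x_{σ_1} ⋯ x_{σ_n}`, for the sequence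
`w = (σ_1,…,σ_n)` of elements of `Γ ∪ {0}`. -/
def shuffleRegI {Γ : Subgroup ℂˣ} (I : NCSeries (XLetter Γ) ℂ) (w : List (XLetter Γ)) :
    Polynomial ℂ :=
  integralSeriesT I (FreeMonoid.ofList w)

/-- The sequence `({0}^{s_1 - 1}, σ_1, …, {0}^{s_r - 1}, σ_r)`. -/
def integralIndex {Γ : Subgroup ℂˣ} {r : ℕ} (s : Fin r → ℕ+) (σ : Fin r → Γ) :
    List (XLetter Γ) :=
  (List.ofFn fun i => List.replicate ((s i : ℕ) - 1) (0 : XLetter Γ) ++ [((σ i : Γ) : XLetter Γ)]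
    ).flatten

/-- The sequence `(σ_1, σ_2 σ_1⁻¹, …, σ_r σ_{r-1}⁻¹)`. -/
def successiveRatios {G : Type*} [Group G] {r : ℕ} (σ : Fin r → G) : Fin r → G := fun i =>
  if (i : ℕ) = 0 then σ i else σ i * (σ ⟨(i : ℕ) - 1, by omega⟩)⁻¹

/-! ### The map `ρ` -/

/-- `S(u) = exp(∑_{n ≥ 2} (-1)^{n-1} ζ(n) u^n / n)`. -/
def seriesS : PowerSeries ℂ :=
  (PowerSeries.exp ℂ).subst
    (PowerSeries.mk fun n => if 2 ≤ n then (-1) ^ (n - 1) * riemannZeta n / (n : ℂ) else 0)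

/-- `A(u) = S(u)⁻¹`. -/
def seriesA : PowerSeries ℂ := seriesS⁻¹

/-- The `ℂ`-linear map `ρ : ℂ[T] → ℂ[T]` with `ρ(e^{Tu}) = A(u) e^{Tu}`, i.e. `ρ(T^n / n!)` is
the coefficient of `u^n` in `A(u) e^{Tu}`. -/
def rho : Polynomial ℂ →ₗ[ℂ] Polynomial ℂ :=
  (Polynomial.basisMonomials ℂ).constr ℂ fun n =>
    (n.factorial : ℂ) • PowerSeries.coeff n (PowerSeries.map Polynomial.C seriesA * expTu)

/-- `ρ`, applied to the coefficients of the powers of `u`, maps `e^{Tu}` to `A(u) e^{Tu}`. -/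
theorem rho_expTu (n : ℕ) :
    rho (PowerSeries.coeff n expTu) =
      PowerSeries.coeff n (PowerSeries.map Polynomial.C seriesA * expTu) := by
  have h : PowerSeries.coeff n expTu = ((n.factorial : ℂ)⁻¹) • Polynomial.monomial n (1 : ℂ) := by
    simp only [expTu, PowerSeries.coeff_rescale, PowerSeries.coeff_exp]
    rw [Polynomial.smul_monomial, smul_eq_mul, mul_one, ← Polynomial.C_mul_X_pow_eq_monomial,
      mul_comm]
    congr 1
    rw [IsScalarTower.algebraMap_apply ℚ ℂ (Polynomial ℂ), Polynomial.algebraMap_eq]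
    simp
  have h2 : rho (Polynomial.monomial n (1 : ℂ)) = (n.factorial : ℂ) •
      PowerSeries.coeff n (PowerSeries.map Polynomial.C seriesA * expTu) := by
    have := (Polynomial.basisMonomials ℂ).constr_basis ℂ (fun n : ℕ => (n.factorial : ℂ) •
      PowerSeries.coeff n (PowerSeries.map Polynomial.C seriesA * expTu)) n
    rwa [Polynomial.coe_basisMonomials] at this
  rw [h, map_smul, h2, smul_smul, inv_mul_cancel₀ (by exact_mod_cast n.factorial_ne_zero),
    one_smul]

end

/-!
The truncated nested sums of the words in `Y` form a stuffle character, and by reduction to words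
not beginning with `y_{1,1}` each of them is, up to a small error, a polynomial in the harmonic
number `H_M`; the constant terms of these polynomials are the coefficients of `ℒ`. In the same way
the regularized iterated integrals from `0` to `t` form a shuffle character with expansions in
`L = -log (1 - t)`, whose constant terms are the coefficients of `ℐ`.

The two are related by the Abel mean `(1 - t) ∑_M f(M) t^M`: it turns the truncated sum of
`y_{s_1,σ_1} y_{s_2,σ_2σ_1⁻¹} ⋯` into the iterated integral of
`x_0^{s_1-1} x_{σ_1} x_0^{s_2-1} x_{σ_2} ⋯`. On expansions it acts by `ρ`, since
`∏_{k ≤ M} (1 + u/k)` expands as `S(u) e^{H_M u}`, while its Abel mean is exactly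
`(1 - t)^{-u} = e^{Lu}`.
-/

noncomputable section

/-! ### Quasi-shuffle products of words -/

section QuasiShuffle

variable {A R S : Type*} {m : A → A → Option A}

/-- The quasi-shuffle product of two words, as a multiset of words. Two letters `a` and `b` can be
merged into the letter `m a b`, or cannot be merged if `m a b = none`. -/
def quasiShuffle (m : A → A → Option A) : List A → List A → Multiset (List A)
  | [], v => {v}
  | a :: u, [] => {a :: u}
  | a :: u, b :: v =>
    (quasiShuffle m u (b :: v)).map (List.cons a) +
      (quasiShuffle m (a :: u) v).map (List.cons b) +
      (m a b).elim 0 fun c => (quasiShuffle m u v).map (List.cons c)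
termination_by u v => u.length + v.length

/-- The merging rule without any merging, for which the quasi-shuffle product is the shuffle
product. -/
abbrev noMerge : A → A → Option A := fun _ _ => none

@[simp] theorem quasiShuffle_nil_left (v : List A) : quasiShuffle m [] v = {v} := by
  rw [quasiShuffle]

@[simp] theorem quasiShuffle_nil_right (u : List A) : quasiShuffle m u [] = {u} := by
  cases u <;> rw [quasiShuffle]

theorem quasiShuffle_cons_cons (a b : A) (u v : List A) :
    quasiShuffle m (a :: u) (b :: v) =
      (quasiShuffle m u (b :: v)).map (List.cons a) +
      (quasiShuffle m (a :: u) v).map (List.cons b) +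
      (m a b).elim 0 fun c => (quasiShuffle m u v).map (List.cons c) := by
  rw [quasiShuffle]

theorem quasiShuffle_singleton_cons (a b : A) (w : List A) :
    quasiShuffle m [a] (b :: w) =
      {a :: b :: w} + ((quasiShuffle m [a] w).map (List.cons b) +
        (m a b).elim 0 fun c => {c :: w}) := by
  simp [quasiShuffle_cons_cons]

/-- The sum of the values of `χ` over the quasi-shuffle product of two words. -/
def quasiShuffleSum [AddCommMonoid R] (m : A → A → Option A) (χ : List A → R) (u v : List A) : R :=
  ((quasiShuffle m u v).map χ).sum

section Sum

variable [AddCommMonoid R] (χ : List A → R)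

@[simp] theorem quasiShuffleSum_nil_left (v : List A) : quasiShuffleSum m χ [] v = χ v := by
  simp [quasiShuffleSum]

@[simp] theorem quasiShuffleSum_nil_right (u : List A) : quasiShuffleSum m χ u [] = χ u := by
  simp [quasiShuffleSum]

theorem quasiShuffleSum_cons_cons (a b : A) (u v : List A) :
    quasiShuffleSum m χ (a :: u) (b :: v) =
      quasiShuffleSum m (fun w => χ (a :: w)) u (b :: v) +
      quasiShuffleSum m (fun w => χ (b :: w)) (a :: u) v +
      (m a b).elim 0 fun c => quasiShuffleSum m (fun w => χ (c :: w)) u v := by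
  rw [quasiShuffleSum, quasiShuffle_cons_cons]
  cases h : m a b <;> simp [quasiShuffleSum, Multiset.map_map]

theorem quasiShuffleSum_noMerge_cons_cons (a b : A) (u v : List A) :
    quasiShuffleSum noMerge χ (a :: u) (b :: v) =
      quasiShuffleSum noMerge (fun w => χ (a :: w)) u (b :: v) +
      quasiShuffleSum noMerge (fun w => χ (b :: w)) (a :: u) v := by
  simp [quasiShuffleSum_cons_cons]

@[simp] theorem quasiShuffleSum_zero (u v : List A) :
    quasiShuffleSum m (fun _ => (0 : R)) u v = 0 := by
  simp [quasiShuffleSum]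

theorem quasiShuffleSum_add (ψ : List A → R) (u v : List A) :
    quasiShuffleSum m (fun w => χ w + ψ w) u v =
      quasiShuffleSum m χ u v + quasiShuffleSum m ψ u v := by
  simp [quasiShuffleSum, Multiset.sum_map_add]

theorem map_quasiShuffleSum {F : Type*} [AddCommMonoid S] [FunLike F R S]
    [AddMonoidHomClass F R S] (f : F) (u v : List A) :
    f (quasiShuffleSum m χ u v) = quasiShuffleSum m (fun w => f (χ w)) u v := by
  simp [quasiShuffleSum, map_multiset_sum, Multiset.map_map]

theorem quasiShuffleSum_const_mul [NonUnitalNonAssocSemiring S] (χ : List A → S) (c : S)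
    (u v : List A) :
    quasiShuffleSum m (fun w => c * χ w) u v = c * quasiShuffleSum m χ u v :=
  (map_quasiShuffleSum χ (AddMonoidHom.mulLeft c) u v).symm

theorem quasiShuffleSum_noMerge_concat_concat (a b : A) (u v : List A) :
    quasiShuffleSum noMerge χ (u ++ [a]) (v ++ [b]) =
      quasiShuffleSum noMerge (fun w => χ (w ++ [a])) u (v ++ [b]) +
      quasiShuffleSum noMerge (fun w => χ (w ++ [b])) (u ++ [a]) v := by
  induction u generalizing v χ with
  | nil =>
    induction v generalizing χ with
    | nil => simp [quasiShuffleSum_noMerge_cons_cons, add_comm]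
    | cons d v ih =>
      have hv := ih fun w => χ (d :: w)
      simp only [List.nil_append, List.cons_append, quasiShuffleSum_noMerge_cons_cons,
        quasiShuffleSum_nil_left] at hv ⊢
      rw [hv]; abel
  | cons c u ihu =>
    induction v generalizing χ with
    | nil =>
      have hu := ihu (fun w => χ (c :: w)) []
      simp only [List.nil_append, List.cons_append, quasiShuffleSum_noMerge_cons_cons,
        quasiShuffleSum_nil_right] at hu ⊢
      rw [hu]; abel
    | cons d v ihv =>
      have hu := ihu (fun w => χ (c :: w)) (d :: v)
      have hv := ihv fun w => χ (d :: w)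
      simp only [List.cons_append, quasiShuffleSum_noMerge_cons_cons] at hu hv ⊢
      rw [hu, hv]; abel

theorem quasiShuffleSum_noMerge_reverse (u v : List A) :
    quasiShuffleSum noMerge (fun w => χ w.reverse) u v =
      quasiShuffleSum noMerge χ u.reverse v.reverse := by
  induction u generalizing v χ with
  | nil => simp
  | cons a u ihu =>
    induction v generalizing χ with
    | nil => simp
    | cons b v ihv =>
      have hu := ihu (fun w => χ (w ++ [a])) (b :: v)
      have hv := ihv fun w => χ (w ++ [b])
      simp only [List.reverse_cons] at hu hv
      simp only [quasiShuffleSum_noMerge_cons_cons, List.reverse_cons,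
        quasiShuffleSum_noMerge_concat_concat, hu, hv]

theorem quasiShuffleSum_noMerge_singleton_replicate (a : A) (n : ℕ) :
    quasiShuffleSum noMerge χ [a] (List.replicate n a) =
      (n + 1) • χ (List.replicate (n + 1) a) := by
  induction n generalizing χ with
  | zero => simp
  | succ n ih =>
    rw [List.replicate_succ, quasiShuffleSum_noMerge_cons_cons, ih, quasiShuffleSum_nil_left]
    simp only [List.replicate_succ, succ_nsmul' _ (n + 1)]

end Sum

/-! ### Characters of quasi-shuffle algebras -/

/-- `χ`, extended linearly to combinations of words, is a unital ring homomorphism for the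
quasi-shuffle product. -/
structure IsQuasiShuffleChar [CommSemiring R] (m : A → A → Option A) (χ : List A → R) : Prop where
  map_nil : χ [] = 1
  map_mul : ∀ u v, quasiShuffleSum m χ u v = χ u * χ v

namespace IsQuasiShuffleChar

section CommSemiring

variable [CommSemiring R] [CommSemiring S] {χ : List A → R}

theorem comp {F : Type*} [FunLike F R S] [RingHomClass F R S] (h : IsQuasiShuffleChar m χ)
    (f : F) : IsQuasiShuffleChar m fun w => f (χ w) where
  map_nil := by rw [h.map_nil, map_one]
  map_mul u v := by rw [← map_quasiShuffleSum, h.map_mul, _root_.map_mul]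

theorem codRestrict {K : Type*} [CommSemiring K] [Algebra K R] (h : IsQuasiShuffleChar m χ)
    (B : Subalgebra K R) (hB : ∀ w, χ w ∈ B) :
    IsQuasiShuffleChar m fun w => (⟨χ w, hB w⟩ : B) where
  map_nil := Subtype.ext h.map_nil
  map_mul u v := Subtype.ext ((map_quasiShuffleSum _ B.val u v).trans (h.map_mul u v))

theorem prodMk {ψ : List A → S} (hχ : IsQuasiShuffleChar m χ) (hψ : IsQuasiShuffleChar m ψ) :
    IsQuasiShuffleChar m fun w => (χ w, ψ w) where
  map_nil := Prod.ext hχ.map_nil hψ.map_nil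
  map_mul u v := Prod.ext
    ((map_quasiShuffleSum _ (RingHom.fst R S) u v).trans (hχ.map_mul u v))
    ((map_quasiShuffleSum _ (RingHom.snd R S) u v).trans (hψ.map_mul u v))

theorem comp_reverse (h : IsQuasiShuffleChar noMerge χ) :
    IsQuasiShuffleChar noMerge fun w => χ w.reverse :=
  ⟨h.map_nil, fun u v => by rw [quasiShuffleSum_noMerge_reverse, h.map_mul]⟩

theorem factorial_nsmul_replicate (hχ : IsQuasiShuffleChar noMerge χ) (a : A) (n : ℕ) :
    n.factorial • χ (List.replicate n a) = χ [a] ^ n := by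
  induction n with
  | zero => simp [hχ.map_nil]
  | succ n ih =>
    rw [Nat.factorial_succ, mul_nsmul, ← quasiShuffleSum_noMerge_singleton_replicate, hχ.map_mul,
      pow_succ', ← ih, mul_smul_comm]

end CommSemiring

end IsQuasiShuffleChar

/-- The number of letters `a` at the beginning of a word. -/
def leadingCount [DecidableEq A] (a : A) (w : List A) : ℕ :=
  (w.takeWhile (· = a)).length

section LeadingCount

variable [DecidableEq A] {a b : A} {w : List A}

theorem leadingCount_cons_self : leadingCount a (a :: w) = leadingCount a w + 1 := by
  simp [leadingCount]

theorem leadingCount_cons_of_ne (h : b ≠ a) : leadingCount a (b :: w) = 0 := by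
  simp [leadingCount, h]

theorem leadingCount_eq_zero_of_mem_merge (hm : m a b ≠ some a) {v : List A}
    (hv : v ∈ (m a b).elim 0 fun c => ({c :: w} : Multiset (List A))) : leadingCount a v = 0 := by
  cases hc : m a b with
  | none => simp [hc] at hv
  | some c =>
    obtain rfl : v = c :: w := by simpa [hc] using hv
    exact leadingCount_cons_of_ne fun hca => hm (hca ▸ hc)

theorem exists_quasiShuffle_singleton_eq (hm : ∀ b, m a b ≠ some a) (w : List A) :
    ∃ rest : Multiset (List A),
      quasiShuffle m [a] w = (leadingCount a w + 1) • {a :: w} + rest ∧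
      ∀ v ∈ rest, leadingCount a v ≤ leadingCount a w := by
  induction w with
  | nil => exact ⟨0, by simp [leadingCount]⟩
  | cons b w ih =>
    obtain ⟨rest, hrest, hle⟩ := ih
    have hmerge v hv := (leadingCount_eq_zero_of_mem_merge (w := w) (v := v) (hm b) hv).le
    rw [quasiShuffle_singleton_cons]
    obtain rfl | hb := eq_or_ne b a
    · refine ⟨rest.map (List.cons b) + (m b b).elim 0 fun c => {c :: w}, ?_, fun v hv => ?_⟩
      · rw [hrest, leadingCount_cons_self, succ_nsmul' _ (leadingCount b w + 1)]
        simp only [Multiset.map_singleton, Multiset.map_add, Multiset.map_nsmul, add_assoc]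
      · obtain hv | hv := Multiset.mem_add.1 hv
        · obtain ⟨v', hv', rfl⟩ := Multiset.mem_map.1 hv
          simpa only [leadingCount_cons_self, add_le_add_iff_right] using hle v' hv'
        · exact (hmerge v hv).trans (Nat.zero_le _)
    · refine ⟨_, by rw [leadingCount_cons_of_ne hb, zero_add, one_nsmul], fun v hv => ?_⟩
      rw [leadingCount_cons_of_ne hb]
      obtain hv | hv := Multiset.mem_add.1 hv
      · obtain ⟨v', -, rfl⟩ := Multiset.mem_map.1 hv
        exact (leadingCount_cons_of_ne hb).le
      · exact hmerge v hv

end LeadingCount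

/-- With every word `a w`, the set `W` contains `w` and the words in the quasi-shuffle product of
`a` and `w`. -/
def IsQuasiShuffleClosed (m : A → A → Option A) (a : A) (W : Set (List A)) : Prop :=
  ∀ w, a :: w ∈ W → w ∈ W ∧ ∀ v ∈ quasiShuffle m [a] w, v ∈ W

theorem isQuasiShuffleClosed_univ (a : A) : IsQuasiShuffleClosed m a Set.univ :=
  fun _ _ => ⟨trivial, fun _ _ => trivial⟩

theorem getLast?_of_mem_quasiShuffle_noMerge_singleton {a : A} {w v : List A}
    (hv : v ∈ quasiShuffle noMerge [a] w) :
    v.getLast? = some a ∨ v.getLast? = w.getLast? := by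
  induction w generalizing v with
  | nil => simp_all
  | cons b w ih =>
    rw [quasiShuffle_singleton_cons] at hv
    simp only [Option.elim_none, add_zero, Multiset.mem_add, Multiset.mem_singleton,
      Multiset.mem_map] at hv
    obtain rfl | ⟨v', hv', rfl⟩ := hv
    · exact Or.inr List.getLast?_cons_cons
    · obtain h | h := ih hv' <;> simp [List.getLast?_cons, h]

theorem isQuasiShuffleClosed_getLast?_ne {a b : A} (hab : a ≠ b) :
    IsQuasiShuffleClosed noMerge a {w | w.getLast? ≠ some b} := by
  intro w hw
  have hw' : w.getLast? ≠ some b := by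
    cases w with
    | nil => simp
    | cons c w => rwa [← List.getLast?_cons_cons (a := a)]
  refine ⟨hw', fun v hv => ?_⟩
  obtain h | h := getLast?_of_mem_quasiShuffle_noMerge_singleton hv
  · simpa [h] using hab
  · simpa [h] using hw'

namespace IsQuasiShuffleChar

variable [CommRing R] {χ ψ : List A → R} {a b : A}

section Subalgebra

variable {K : Type*} [Field K] [CharZero K] [Algebra K R]

/-- A word `a w` with `n` leading letters `a` occurs `n` times in the quasi-shuffle product of `a`
and `w`, whose other words have fewer leading letters `a`. Hence `χ (a w)` is obtained from values
of `χ` known by induction on `n`. -/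
theorem mem_of_head?_ne (hχ : IsQuasiShuffleChar m χ) (hm : ∀ b, m a b ≠ some a)
    (B : Subalgebra K R) {W : Set (List A)} (hW : IsQuasiShuffleClosed m a W) (ha : χ [a] ∈ B)
    (hB : ∀ w ∈ W, w.head? ≠ some a → χ w ∈ B) {w : List A} (hw : w ∈ W) : χ w ∈ B := by
  classical
  induction hn : leadingCount a w using Nat.strong_induction_on generalizing w with
  | _ n ih =>
  by_cases hhead : w.head? = some a
  swap
  · exact hB w hw hhead
  obtain ⟨v, rfl⟩ := List.head?_eq_some_iff.1 hhead
  rw [leadingCount_cons_self] at hn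
  obtain ⟨rest, hrest, hle⟩ := exists_quasiShuffle_singleton_eq hm v
  obtain ⟨hv, hvW⟩ := hW v hw
  have hmul : (leadingCount a v + 1) • χ (a :: v) + (rest.map χ).sum = χ [a] * χ v := by
    rw [← hχ.map_mul, quasiShuffleSum, hrest]
    simp only [Multiset.map_add, Multiset.map_nsmul, Multiset.map_singleton, Multiset.sum_add,
      Multiset.sum_nsmul, Multiset.sum_singleton]
  have hrest_mem : (rest.map χ).sum ∈ B := by
    refine multiset_sum_mem _ fun x hx => ?_
    obtain ⟨v', hv', rfl⟩ := Multiset.mem_map.1 hx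
    exact ih _ ((hle v' hv').trans_lt (by omega))
      (hvW v' (hrest ▸ Multiset.mem_add.2 (Or.inr hv'))) rfl
  have hsmul : ((leadingCount a v + 1 : ℕ) : K) • χ (a :: v) ∈ B := by
    rw [Nat.cast_smul_eq_nsmul, eq_sub_of_add_eq hmul]
    exact B.sub_mem (B.mul_mem ha (ih _ (by omega) hv rfl)) hrest_mem
  simpa [smul_smul, inv_mul_cancel₀ (Nat.cast_add_one_ne_zero (R := K) _)] using
    B.smul_mem hsmul ((leadingCount a v + 1 : ℕ) : K)⁻¹

theorem mem_of_getLast?_ne (hχ : IsQuasiShuffleChar noMerge χ) (B : Subalgebra K R)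
    (hb : χ [b] ∈ B) (h : ∀ w : List A, w.getLast? ≠ some b → χ w ∈ B) (w : List A) : χ w ∈ B := by
  simpa using hχ.comp_reverse.mem_of_head?_ne (by simp) B (isQuasiShuffleClosed_univ b) hb
    (fun w _ hw => h _ (by rwa [List.getLast?_reverse])) (Set.mem_univ w.reverse)

end Subalgebra

variable [Algebra ℚ R]

theorem eqOn_of_head?_ne (hχ : IsQuasiShuffleChar m χ) (hψ : IsQuasiShuffleChar m ψ)
    (hm : ∀ b, m a b ≠ some a) {W : Set (List A)} (hW : IsQuasiShuffleClosed m a W)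
    (ha : χ [a] = ψ [a]) (h : ∀ w ∈ W, w.head? ≠ some a → χ w = ψ w) : Set.EqOn χ ψ W :=
  fun _ hw => (hχ.prodMk hψ).mem_of_head?_ne hm
    (AlgHom.equalizer (AlgHom.fst ℚ R R) (AlgHom.snd ℚ R R)) hW ha h hw

theorem ext_of_head?_ne (hχ : IsQuasiShuffleChar m χ) (hψ : IsQuasiShuffleChar m ψ)
    (hm : ∀ b, m a b ≠ some a) (ha : χ [a] = ψ [a])
    (h : ∀ w : List A, w.head? ≠ some a → χ w = ψ w) : χ = ψ :=
  (Set.eqOn_univ _ _).1 (hχ.eqOn_of_head?_ne hψ hm (isQuasiShuffleClosed_univ a) ha fun w _ => h w)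

theorem ext_of_head?_ne_of_getLast?_ne (hχ : IsQuasiShuffleChar noMerge χ)
    (hψ : IsQuasiShuffleChar noMerge ψ) (hab : a ≠ b) (ha : χ [a] = ψ [a]) (hb : χ [b] = ψ [b])
    (h : ∀ w, w.head? ≠ some a → w.getLast? ≠ some b → χ w = ψ w) : χ = ψ := by
  have hlast : Set.EqOn χ ψ {w | w.getLast? ≠ some b} :=
    hχ.eqOn_of_head?_ne hψ (by simp) (isQuasiShuffleClosed_getLast?_ne hab) ha
      fun w hw hw' => h w hw' hw
  have hrev := hχ.comp_reverse.ext_of_head?_ne hψ.comp_reverse (a := b) (by simp) hb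
    fun w hw => hlast (by simpa using hw)
  funext w
  simpa using congrFun hrev w.reverse

end IsQuasiShuffleChar

end QuasiShuffle

/-! ### Diagonal series are characters -/

section Diagonal

variable {A : Type*}

open Classical in
theorem coeff_single_ofList_mul (s t u v : List A)
    (p : MonoidAlgebra ℂ (FreeMonoid A × FreeMonoid A)) :
    (MonoidAlgebra.single (FreeMonoid.ofList s, FreeMonoid.ofList t) 1 * p).coeff
        (FreeMonoid.ofList u, FreeMonoid.ofList v) =
      if s <+: u ∧ t <+: v then
        p.coeff (FreeMonoid.ofList (u.drop s.length), FreeMonoid.ofList (v.drop t.length))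
      else 0 := by
  split_ifs with h
  · obtain ⟨⟨u', rfl⟩, ⟨v', rfl⟩⟩ := h
    rw [FreeMonoid.ofList_append, FreeMonoid.ofList_append, ← Prod.mk_mul_mk,
      MonoidAlgebra.coeff_single_mul_mul, one_mul, List.drop_left, List.drop_left]
  · refine MonoidAlgebra.coeff_single_mul_of_forall_mul_ne _ _ fun d hd => h ?_
    exact ⟨⟨d.1.toList, congrArg Prod.fst hd⟩, ⟨d.2.toList, congrArg Prod.snd hd⟩⟩

/-- The coproduct dual to the quasi-shuffle product with merging rule `m`: on a letter `y` it is
`y ⊗ 1 + 1 ⊗ y + ∑ a ⊗ b`, the sum being over the pairs of letters merging to `y`. -/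
def IsQuasiShuffleCoproduct (m : A → A → Option A)
    (Δ : FreeMonoid A →* MonoidAlgebra ℂ (FreeMonoid A × FreeMonoid A)) : Prop :=
  ∀ y, ∃ M : Finset (A × A), (∀ p, p ∈ M ↔ m p.1 p.2 = some y) ∧
    Δ (FreeMonoid.of y) =
      MonoidAlgebra.single (FreeMonoid.of y, 1) 1 + MonoidAlgebra.single (1, FreeMonoid.of y) 1 +
        ∑ p ∈ M, MonoidAlgebra.single (FreeMonoid.of p.1, FreeMonoid.of p.2) 1

theorem count_map_cons [DecidableEq A] (a b : A) (w : List A) (s : Multiset (List A)) :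
    (s.map (List.cons a)).count (b :: w) = if a = b then s.count w else 0 := by
  split_ifs with h
  · rw [h, Multiset.count_map_eq_count' _ _ List.cons_injective]
  · simp [h]

theorem count_nil_quasiShuffle [DecidableEq A] (m : A → A → Option A) (u v : List A) :
    (quasiShuffle m u v).count [] = if u = [] ∧ v = [] then 1 else 0 := by
  cases u with
  | nil => simp [Multiset.count_singleton, eq_comm]
  | cons a u =>
    cases v with
    | nil => simp
    | cons b v =>
      rw [quasiShuffle_cons_cons]
      cases m a b <;> simp

variable {m : A → A → Option A} {Δ : FreeMonoid A →* MonoidAlgebra ℂ (FreeMonoid A × FreeMonoid A)}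

open Classical in
theorem IsQuasiShuffleCoproduct.coeff_eq_count (hΔ : IsQuasiShuffleCoproduct m Δ)
    (w u v : List A) :
    (Δ (FreeMonoid.ofList w)).coeff (FreeMonoid.ofList u, FreeMonoid.ofList v) =
      ((quasiShuffle m u v).count w : ℂ) := by
  induction w generalizing u v with
  | nil =>
    rw [FreeMonoid.ofList_nil, map_one, MonoidAlgebra.one_def, MonoidAlgebra.coeff_single,
      Finsupp.single_apply, count_nil_quasiShuffle]
    simp [Prod.ext_iff, eq_comm, ← FreeMonoid.ofList_nil]
  | cons y w ih =>
    obtain ⟨M, hM, hy⟩ := hΔ y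
    have hcoeff : (Δ (FreeMonoid.ofList (y :: w))).coeff
        (FreeMonoid.ofList u, FreeMonoid.ofList v) =
        (if [y] <+: u then ((quasiShuffle m (u.drop 1) v).count w : ℂ) else 0) +
        (if [y] <+: v then ((quasiShuffle m u (v.drop 1)).count w : ℂ) else 0) +
        ∑ p ∈ M, if [p.1] <+: u ∧ [p.2] <+: v then
          ((quasiShuffle m (u.drop 1) (v.drop 1)).count w : ℂ) else 0 := by
      rw [FreeMonoid.ofList_cons, map_mul, hy]
      simp only [add_mul, Finset.sum_mul,
        MonoidAlgebra.coeff_add, MonoidAlgebra.coeff_sum, Finsupp.add_apply,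
        Finsupp.finsetSum_apply, ← FreeMonoid.ofList_singleton, ← FreeMonoid.ofList_nil,
        coeff_single_ofList_mul, ih]
      simp
    rw [hcoeff]
    cases u with
    | nil => cases v <;> simp [Multiset.count_singleton, eq_comm, apply_ite, ← ite_and, and_comm]
    | cons a u =>
      cases v with
      | nil => simp [Multiset.count_singleton, eq_comm, apply_ite, ← ite_and, and_comm]
      | cons b v =>
        have hmerge : (((m a b).elim 0 fun c => (quasiShuffle m u v).map (List.cons c)).count
            (y :: w) : ℂ) = if (a, b) ∈ M then ((quasiShuffle m u v).count w : ℂ) else 0 := by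
          simp only [hM]
          cases h : m a b <;> simp [count_map_cons]
        have hpair (p : A × A) : ([p.1] <+: a :: u ∧ [p.2] <+: b :: v) ↔ p = (a, b) := by
          simp [Prod.ext_iff]
        rw [quasiShuffle_cons_cons, Multiset.count_add, Multiset.count_add, count_map_cons,
          count_map_cons, Nat.cast_add, Nat.cast_add, hmerge]
        simp only [hpair, Finset.sum_ite_eq']
        simp [eq_comm]

theorem IsQuasiShuffleCoproduct.coproductCoeff_eq (hΔ : IsQuasiShuffleCoproduct m Δ)
    (Φ : NCSeries A ℂ) (u v : List A) :
    NCSeries.coproductCoeff Δ Φ (FreeMonoid.ofList u) (FreeMonoid.ofList v) =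
      quasiShuffleSum m (fun w => Φ (FreeMonoid.ofList w)) u v := by
  classical
  rw [NCSeries.coproductCoeff, quasiShuffleSum, Finset.sum_multiset_map_count,
    ← finsum_comp_equiv (FreeMonoid.ofList (α := A))]
  simp only [hΔ.coeff_eq_count]
  rw [finsum_eq_sum_of_support_subset (s := (quasiShuffle m u v).toFinset)]
  · simp only [nsmul_eq_mul, mul_comm]
  · intro w hw
    contrapose! hw
    simp [Multiset.count_eq_zero_of_notMem (mt Multiset.mem_toFinset.2 hw)]

theorem IsQuasiShuffleCoproduct.isDiagonal_iff (hΔ : IsQuasiShuffleCoproduct m Δ)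
    (Φ : NCSeries A ℂ) :
    NCSeries.IsDiagonal Δ Φ ↔ IsQuasiShuffleChar m fun w => Φ (FreeMonoid.ofList w) :=
  ⟨fun h => ⟨h.1, fun u v => (hΔ.coproductCoeff_eq Φ u v).symm.trans (h.2 _ _)⟩,
    fun h => ⟨h.map_nil, fun u v => (hΔ.coproductCoeff_eq Φ u v).trans (h.map_mul u v)⟩⟩

variable (Γ : Subgroup ℂˣ)

theorem isQuasiShuffleCoproduct_shuffleCoproduct :
    IsQuasiShuffleCoproduct noMerge (shuffleCoproduct Γ) :=
  fun _ => ⟨∅, by simp, by rw [shuffleCoproduct, FreeMonoid.lift_eval_of, Finset.sum_empty,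
    add_zero]⟩

/-- The merging rule of the coproduct `Δ_*`: the letters `y_{k,κ}` and `y_{l,λ}` merge into
`y_{k+l,κλ}`. -/
def stuffleMerge (a b : YLetter Γ) : Option (YLetter Γ) :=
  some (a.1 + b.1, a.2 * b.2)

theorem stuffleMerge_ne (a b : YLetter Γ) : stuffleMerge Γ a b ≠ some (1, 1) := by
  intro h
  have hfst : a.1 + b.1 = 1 := congrArg Prod.fst (Option.some_injective _ h)
  have := congrArg PNat.val hfst
  have := a.1.pos
  have := b.1.pos
  simp only [PNat.val_ofNat, PNat.add_coe] at *
  omega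

theorem pureTensor_yElem {k l : ℕ} (hk : 0 < k) (hl : 0 < l) (κ μ : Γ) :
    pureTensor (yElem Γ k κ) (yElem Γ l μ) =
      MonoidAlgebra.single (FreeMonoid.of (⟨k, hk⟩, κ), FreeMonoid.of (⟨l, hl⟩, μ)) 1 := by
  simp [pureTensor, yElem, hk, hl, MonoidAlgebra.mapDomain_single, MonoidAlgebra.single_mul_single]

open Classical in
theorem pureTensor_yElem_zero_left {l : ℕ} (hl : 0 < l) (κ μ : Γ) :
    pureTensor (yElem Γ 0 κ) (yElem Γ l μ) =
      if κ = 1 then MonoidAlgebra.single (1, FreeMonoid.of (⟨l, hl⟩, μ)) 1 else 0 := by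
  split_ifs with h <;> simp [pureTensor, yElem, hl, h, MonoidAlgebra.mapDomain_single,
    MonoidAlgebra.single_mul_single, MonoidAlgebra.one_def]

open Classical in
theorem pureTensor_yElem_zero_right {k : ℕ} (hk : 0 < k) (κ μ : Γ) :
    pureTensor (yElem Γ k κ) (yElem Γ 0 μ) =
      if μ = 1 then MonoidAlgebra.single (FreeMonoid.of (⟨k, hk⟩, κ), 1) 1 else 0 := by
  split_ifs with h <;> simp [pureTensor, yElem, hk, h, MonoidAlgebra.mapDomain_single,
    MonoidAlgebra.single_mul_single, MonoidAlgebra.one_def]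

/-- The pair of letters `(y_{k,κ}, y_{n-k,ν/κ})` merging to `y = y_{n,ν}`, for `i = (k - 1, κ)`. -/
def stuffleSplit (y : YLetter Γ) (i : Fin ((y.1 : ℕ) - 1) × Γ) : YLetter Γ × YLetter Γ :=
  ((⟨i.1 + 1, Nat.succ_pos _⟩, i.2), (⟨(y.1 : ℕ) - (i.1 + 1), by omega⟩, i.2⁻¹ * y.2))

theorem stuffleSplit_injective (y : YLetter Γ) : Function.Injective (stuffleSplit Γ y) := by
  rintro ⟨k, κ⟩ ⟨k', κ'⟩ h
  obtain ⟨hk, hκ⟩ := Prod.ext_iff.1 (congrArg Prod.fst h)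
  exact Prod.ext (Fin.ext (Nat.succ_injective (congrArg PNat.val hk))) hκ

theorem stuffleMerge_eq_some_iff {y : YLetter Γ} {p : YLetter Γ × YLetter Γ} :
    stuffleMerge Γ p.1 p.2 = some y ↔ ∃ i, stuffleSplit Γ y i = p := by
  obtain ⟨⟨k, κ⟩, ⟨l, μ⟩⟩ := p
  constructor
  · intro h
    obtain rfl := Option.some_injective _ h
    have hkl : ((k + l : ℕ+) : ℕ) = k + l := PNat.add_coe k l
    have hk := k.pos
    have hl := l.pos
    refine ⟨⟨⟨k - 1, by dsimp only; omega⟩, κ⟩, ?_⟩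
    refine Prod.ext (Prod.ext (PNat.coe_injective ?_) rfl)
      (Prod.ext (PNat.coe_injective ?_) (inv_mul_cancel_left _ _)) <;>
      simp only [stuffleSplit, PNat.mk_coe] <;> omega
  · rintro ⟨⟨i, κ'⟩, h⟩
    rw [← h]
    refine congrArg some (Prod.ext (PNat.coe_injective ?_) (mul_inv_cancel_left _ _))
    rw [PNat.add_coe]
    simp only [stuffleSplit, PNat.mk_coe]
    omega

theorem stuffleCoproduct_of [Fintype Γ] (y : YLetter Γ) :
    stuffleCoproduct Γ (FreeMonoid.of y) =
      MonoidAlgebra.single (FreeMonoid.of y, 1) 1 + MonoidAlgebra.single (1, FreeMonoid.of y) 1 +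
        ∑ i, MonoidAlgebra.single
          (FreeMonoid.of (stuffleSplit Γ y i).1, FreeMonoid.of (stuffleSplit Γ y i).2) 1 := by
  classical
  obtain ⟨⟨n, hn⟩, ν⟩ := y
  obtain ⟨n, rfl⟩ := Nat.exists_eq_add_one.2 hn
  have hleft : ∑ κ : Γ, pureTensor (yElem Γ (n + 1) κ) (yElem Γ 0 (κ⁻¹ * ν)) =
      MonoidAlgebra.single (FreeMonoid.of (⟨n + 1, hn⟩, ν), 1) 1 := by
    simp [pureTensor_yElem_zero_right Γ hn, inv_mul_eq_one]
  have hright : ∑ κ : Γ, pureTensor (yElem Γ 0 κ) (yElem Γ (n + 1) (κ⁻¹ * ν)) =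
      MonoidAlgebra.single (1, FreeMonoid.of (⟨n + 1, hn⟩, ν)) 1 := by
    simp [pureTensor_yElem_zero_left Γ hn]
  rw [stuffleCoproduct, FreeMonoid.lift_eval_of]
  simp only [PNat.mk_coe]
  rw [Finset.Nat.sum_antidiagonal_eq_sum_range_succ_mk, Finset.sum_range_succ,
    Finset.sum_range_succ', Nat.sub_self, Nat.sub_zero, hleft, hright, Finset.sum_range,
    add_comm, add_comm (∑ k : Fin n, _), ← add_assoc]
  congr 1
  refine Eq.trans ?_ (Fintype.sum_prod_type _).symm
  exact Finset.sum_congr rfl fun k _ => Finset.sum_congr rfl fun κ _ => pureTensor_yElem Γ _ _ _ _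

theorem isQuasiShuffleCoproduct_stuffleCoproduct [Fintype Γ] :
    IsQuasiShuffleCoproduct (stuffleMerge Γ) (stuffleCoproduct Γ) := fun y =>
  ⟨Finset.univ.map ⟨stuffleSplit Γ y, stuffleSplit_injective Γ y⟩,
    fun p => by simp [stuffleMerge_eq_some_iff], by
      rw [stuffleCoproduct_of, Finset.sum_map, Function.Embedding.coeFn_mk]⟩

variable {Γ}

theorem IsPolylogSeries.isQuasiShuffleChar [Fintype Γ] {L : NCSeries (YLetter Γ) ℂ}
    (hL : IsPolylogSeries Γ L) :
    IsQuasiShuffleChar (stuffleMerge Γ) fun w => L (FreeMonoid.ofList w) :=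
  ((isQuasiShuffleCoproduct_stuffleCoproduct Γ).isDiagonal_iff L).1 hL.diagonal

theorem IsIntegralSeries.isQuasiShuffleChar {I : NCSeries (XLetter Γ) ℂ}
    (hI : IsIntegralSeries Γ I) :
    IsQuasiShuffleChar noMerge fun w => I (FreeMonoid.ofList w) :=
  ((isQuasiShuffleCoproduct_shuffleCoproduct Γ).isDiagonal_iff I).1 hI.diagonal

end Diagonal

/-! ### The series `exp(T a) Φ` -/

section ExpMul

theorem polynomial_eq_of_derivative_eq_of_eval_zero_eq {R : Type*} [Ring R] [IsAddTorsionFree R]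
    {p q : Polynomial R} (hderiv : p.derivative = q.derivative) (heval : p.eval 0 = q.eval 0) :
    p = q := by
  have hconst := Polynomial.eq_C_of_derivative_eq_zero (p := p - q)
    (by rw [Polynomial.derivative_sub, hderiv, sub_self])
  rw [Polynomial.coeff_zero_eq_eval_zero, Polynomial.eval_sub, heval, sub_self, map_zero] at hconst
  exact sub_eq_zero.1 hconst

theorem coeff_expTu (n : ℕ) :
    PowerSeries.coeff n expTu = Polynomial.C ((n.factorial : ℂ)⁻¹) * Polynomial.X ^ n := by
  simp only [expTu, PowerSeries.coeff_rescale, PowerSeries.coeff_exp]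
  rw [mul_comm, IsScalarTower.algebraMap_apply ℚ ℂ (Polynomial ℂ), Polynomial.algebraMap_eq]
  simp

theorem derivative_coeff_zero_expTu : (PowerSeries.coeff 0 expTu).derivative = 0 := by
  simp [coeff_expTu]

theorem derivative_coeff_succ_expTu (n : ℕ) :
    (PowerSeries.coeff (n + 1) expTu).derivative = PowerSeries.coeff n expTu := by
  rw [coeff_expTu, coeff_expTu, Polynomial.derivative_C_mul, Polynomial.derivative_X_pow,
    Nat.add_sub_cancel, ← mul_assoc, ← Polynomial.C_mul, Nat.factorial_succ, Nat.cast_mul,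
    mul_inv_rev, mul_assoc, inv_mul_cancel₀ (Nat.cast_ne_zero.2 n.succ_ne_zero), mul_one]

theorem eval_zero_coeff_expTu (n : ℕ) :
    (PowerSeries.coeff n expTu).eval 0 = if n = 0 then 1 else 0 := by
  split_ifs with h <;> simp [coeff_expTu, h]

variable {A : Type*} (a : A) (Φ : NCSeries A ℂ)

/-- The coefficient of the word `w` in the series `exp(T a) Φ`. -/
def expMulCoeff (w : List A) : Polynomial ℂ :=
  (NCSeries.ofLetter a expTu * NCSeries.mapCoeff Polynomial.C Φ) (FreeMonoid.ofList w)

open Classical in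
theorem expMulCoeff_eq_sum (w : List A) :
    expMulCoeff a Φ w =
      ∑ i ∈ Finset.range (w.length + 1), if w.take i = List.replicate i a then
        Polynomial.C (Φ (FreeMonoid.ofList (w.drop i))) * PowerSeries.coeff i expTu else 0 := by
  have toList_of_pow (n : ℕ) : FreeMonoid.toList (FreeMonoid.of a ^ n) = List.replicate n a := by
    induction n with
    | zero => simp
    | succ n ih => rw [pow_succ', FreeMonoid.toList_of_mul, ih, List.replicate_succ]
  rw [expMulCoeff]
  refine Finset.sum_congr rfl fun i hi => ?_
  have hi : i ≤ w.length := Nat.lt_succ_iff.1 (Finset.mem_range.1 hi)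
  rw [NCSeries.ofLetter, NCSeries.mapCoeff, ite_mul, zero_mul, mul_comm]
  simp only [FreeMonoid.toList_ofList, List.length_take, min_eq_left hi,
    ← FreeMonoid.toList.injective.eq_iff, toList_of_pow]

theorem eval_zero_expMulCoeff (w : List A) :
    (expMulCoeff a Φ w).eval 0 = Φ (FreeMonoid.ofList w) := by
  classical
  rw [expMulCoeff_eq_sum, Polynomial.eval_finsetSum, Finset.sum_range_succ', Finset.sum_eq_zero]
  · simp [eval_zero_coeff_expTu, -PowerSeries.coeff_zero_eq_constantCoeff]
  · intro i _
    split_ifs <;> simp [eval_zero_coeff_expTu]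

open Classical in
theorem derivative_expMulCoeff_cons (b : A) (w : List A) :
    (expMulCoeff a Φ (b :: w)).derivative = if b = a then expMulCoeff a Φ w else 0 := by
  rw [expMulCoeff_eq_sum, expMulCoeff_eq_sum, Finset.sum_range_succ', map_add, map_sum]
  have hzero : (Polynomial.C (Φ (FreeMonoid.ofList (b :: w))) *
      PowerSeries.coeff 0 expTu).derivative = 0 := by
    rw [Polynomial.derivative_C_mul, derivative_coeff_zero_expTu, mul_zero]
  simp only [List.take_zero, List.replicate_zero, if_true, List.drop_zero, hzero, add_zero,
    List.length_cons, List.take_succ_cons, List.replicate_succ, List.drop_succ_cons,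
    List.cons.injEq, ite_and]
  split_ifs
  · refine Finset.sum_congr rfl fun i _ => ?_
    split_ifs
    · rw [Polynomial.derivative_C_mul, derivative_coeff_succ_expTu]
    · simp
  · simp

variable {a Φ}

theorem expMulCoeff_of_head?_ne {w : List A} (hw : w.head? ≠ some a) :
    expMulCoeff a Φ w = Polynomial.C (Φ (FreeMonoid.ofList w)) := by
  classical
  refine polynomial_eq_of_derivative_eq_of_eval_zero_eq ?_
    (by rw [eval_zero_expMulCoeff, Polynomial.eval_C])
  cases w with
  | nil => simp [expMulCoeff_eq_sum, coeff_expTu]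
  | cons b w =>
    rw [derivative_expMulCoeff_cons, if_neg (by simpa using hw), Polynomial.derivative_C]

theorem expMulCoeff_singleton (hone : Φ 1 = 1) (ha : Φ (FreeMonoid.of a) = 0) :
    expMulCoeff a Φ [a] = Polynomial.X := by
  classical
  refine polynomial_eq_of_derivative_eq_of_eval_zero_eq ?_ ?_
  · rw [derivative_expMulCoeff_cons, if_pos rfl, expMulCoeff_of_head?_ne (by simp),
      FreeMonoid.ofList_nil, hone, Polynomial.derivative_X, map_one]
  · rw [eval_zero_expMulCoeff, Polynomial.eval_X, FreeMonoid.ofList_singleton, ha]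

/-- Both sides of the multiplicativity relation have the same value at `T = 0` and, by induction on
the words, the same derivative with respect to `T`. -/
theorem isQuasiShuffleChar_expMulCoeff {m : A → A → Option A} (hm : ∀ b c, m b c ≠ some a)
    (hΦ : IsQuasiShuffleChar m fun w => Φ (FreeMonoid.ofList w)) :
    IsQuasiShuffleChar m (expMulCoeff a Φ) := by
  classical
  have map_nil : expMulCoeff a Φ [] = 1 := by
    rw [expMulCoeff_of_head?_ne (by simp), hΦ.map_nil, map_one]
  refine ⟨map_nil, fun u v => ?_⟩
  induction u generalizing v with
  | nil => rw [quasiShuffleSum_nil_left, map_nil, one_mul]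
  | cons b u ihu =>
    induction v with
    | nil => rw [quasiShuffleSum_nil_right, map_nil, mul_one]
    | cons c v ihv =>
      refine polynomial_eq_of_derivative_eq_of_eval_zero_eq ?_ ?_
      · have hmerge : ((m b c).elim 0 fun d =>
            quasiShuffleSum m (fun w => (expMulCoeff a Φ (d :: w)).derivative) u v) = 0 := by
          cases h : m b c with
          | none => rfl
          | some d =>
            have hd : d ≠ a := fun hda => hm b c (hda ▸ h)
            simp [derivative_expMulCoeff_cons, hd]
        rw [map_quasiShuffleSum, quasiShuffleSum_cons_cons, hmerge, add_zero,
          Polynomial.derivative_mul]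
        simp only [derivative_expMulCoeff_cons]
        congr 1 <;> split_ifs <;> simp [ihu, ihv]
      · rw [← Polynomial.coe_evalRingHom, map_quasiShuffleSum]
        simp only [Polynomial.coe_evalRingHom, Polynomial.eval_mul, eval_zero_expMulCoeff]
        exact hΦ.map_mul _ _

end ExpMul

/-! ### Polynomial asymptotic expansions -/

section Expansion

open Asymptotics

variable {α 𝕜 : Type*} {l : Filter α} {k f g : α → 𝕜}

section Ring

variable [CommRing 𝕜] [TopologicalSpace 𝕜]

/-- `f` equals `P(k)` up to an error which, multiplied by any power of `k`, tends to `0`. -/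
def HasExpansion (l : Filter α) (k f : α → 𝕜) (P : Polynomial 𝕜) : Prop :=
  SuperpolynomialDecay l k fun x => f x - P.eval (k x)

variable {P Q : Polynomial 𝕜}

theorem hasExpansion_zero_iff : HasExpansion l k f 0 ↔ SuperpolynomialDecay l k f := by
  simp [HasExpansion]

theorem HasExpansion.congr (hf : HasExpansion l k f P) (hfg : ∀ x, f x = g x) :
    HasExpansion l k g P :=
  (funext hfg : f = g) ▸ hf

theorem hasExpansion_eval (P : Polynomial 𝕜) : HasExpansion l k (fun x => P.eval (k x)) P :=
  (superpolynomialDecay_zero l k).congr fun _ => (sub_self _).symm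

theorem hasExpansion_const (c : 𝕜) : HasExpansion l k (fun _ => c) (Polynomial.C c) :=
  (hasExpansion_eval _).congr fun _ => Polynomial.eval_C

theorem hasExpansion_self : HasExpansion l k k Polynomial.X :=
  (hasExpansion_eval _).congr fun _ => Polynomial.eval_X

theorem HasExpansion.add [ContinuousAdd 𝕜] (hf : HasExpansion l k f P)
    (hg : HasExpansion l k g Q) : HasExpansion l k (fun x => f x + g x) (P + Q) :=
  (SuperpolynomialDecay.add hf hg).congr fun x => by
    simp only [Pi.add_apply, Polynomial.eval_add]; ring

theorem HasExpansion.sum [ContinuousAdd 𝕜] {ι : Type*} {s : Finset ι} {F : ι → α → 𝕜}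
    {P : ι → Polynomial 𝕜} (hF : ∀ i ∈ s, HasExpansion l k (F i) (P i)) :
    HasExpansion l k (fun x => ∑ i ∈ s, F i x) (∑ i ∈ s, P i) := by
  intro n
  simpa only [Finset.mul_sum, Polynomial.eval_finsetSum, ← Finset.sum_sub_distrib,
    Finset.sum_const_zero] using tendsto_finsetSum s fun i hi => hF i hi n

variable [IsTopologicalRing 𝕜]

theorem HasExpansion.mul (hf : HasExpansion l k f P) (hg : HasExpansion l k g Q) :
    HasExpansion l k (fun x => f x * g x) (P * Q) :=
  ((SuperpolynomialDecay.mul hf hg).add ((SuperpolynomialDecay.polynomial_mul hf Q).add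
    (SuperpolynomialDecay.polynomial_mul hg P))).congr fun x => by
      simp only [Pi.add_apply, Pi.mul_apply, Polynomial.eval_mul]; ring

theorem HasExpansion.const_mul (hf : HasExpansion l k f P) (c : 𝕜) :
    HasExpansion l k (fun x => c * f x) (Polynomial.C c * P) :=
  (hasExpansion_const c).mul hf

theorem HasExpansion.tendsto {c : 𝕜} (hf : HasExpansion l k f (Polynomial.C c)) :
    Tendsto f l (𝓝 c) := by
  simpa using Tendsto.add_const c (hf 0)

variable (l k) in
/-- The functions which have a polynomial expansion. -/
def expansionSubalgebra : Subalgebra 𝕜 (α → 𝕜) where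
  carrier := {f | ∃ P, HasExpansion l k f P}
  mul_mem' := fun ⟨P, hP⟩ ⟨Q, hQ⟩ => ⟨P * Q, hP.mul hQ⟩
  add_mem' := fun ⟨P, hP⟩ ⟨Q, hQ⟩ => ⟨P + Q, hP.add hQ⟩
  algebraMap_mem' := fun c => ⟨Polynomial.C c, hasExpansion_const c⟩

end Ring

section NormedField

variable [NormedField 𝕜] [l.NeBot] {P Q : Polynomial 𝕜}

theorem HasExpansion.unique (hk : Tendsto (fun x => ‖k x‖) l atTop) (hP : HasExpansion l k f P)
    (hQ : HasExpansion l k f Q) : P = Q := by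
  have hlim : Tendsto (fun x => (P - Q).eval (k x)) l (𝓝 0) := by
    simpa using Tendsto.sub (hQ 0) (hP 0)
  rcases lt_or_ge 0 (P - Q).degree with hdeg | hdeg
  · exact absurd hlim.norm
      (not_tendsto_nhds_of_tendsto_atTop (Polynomial.tendsto_norm_atTop _ hdeg hk) _)
  · obtain ⟨c, hc⟩ : ∃ c, P - Q = Polynomial.C c := ⟨_, Polynomial.eq_C_of_degree_le_zero hdeg⟩
    simp only [hc, Polynomial.eval_C] at hlim
    rw [← sub_eq_zero, hc, tendsto_nhds_unique tendsto_const_nhds hlim, map_zero]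

theorem IsQuasiShuffleChar.of_hasExpansion {A : Type*} {m : A → A → Option A}
    {χ : List A → α → 𝕜} (hk : Tendsto (fun x => ‖k x‖) l atTop) (hχ : IsQuasiShuffleChar m χ)
    {P : List A → Polynomial 𝕜} (hP : ∀ w, HasExpansion l k (χ w) (P w)) :
    IsQuasiShuffleChar m P := by
  refine ⟨?_, fun u v => ?_⟩
  · have hone := hP []
    rw [hχ.map_nil] at hone
    exact hone.unique hk (hasExpansion_const 1)
  · have hsum : HasExpansion l k (quasiShuffleSum m χ u v) (quasiShuffleSum m P u v) := by
      rw [quasiShuffleSum, quasiShuffleSum]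
      induction quasiShuffle m u v using Multiset.induction_on with
      | empty => exact hasExpansion_zero_iff.2 (superpolynomialDecay_zero l k)
      | cons w s ih =>
        rw [Multiset.map_cons, Multiset.map_cons, Multiset.sum_cons, Multiset.sum_cons]
        exact (hP w).add ih
    rw [hχ.map_mul] at hsum
    exact hsum.unique hk ((hP u).mul (hP v))

end NormedField

end Expansion

/-! ### Expansions in the harmonic numbers -/

section Harmonic

theorem tendsto_harmonic_atTop : Tendsto (fun n => (harmonic n : ℝ)) atTop atTop :=
  tendsto_atTop_mono log_add_one_le_harmonic
    (Real.tendsto_log_atTop.comp (tendsto_natCast_atTop_atTop.comp (tendsto_add_atTop_nat 1)))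

theorem harmonic_nonneg (n : ℕ) : 0 ≤ (harmonic n : ℝ) :=
  Rat.cast_nonneg.2 (Finset.sum_nonneg fun _ _ => by positivity)

/-- The scale of harmonic numbers, with values in `ℂ`. -/
def harmonicScale (n : ℕ) : ℂ :=
  ((harmonic n : ℝ) : ℂ)

theorem tendsto_norm_harmonicScale : Tendsto (fun n => ‖harmonicScale n‖) atTop atTop := by
  simpa only [harmonicScale, Complex.norm_real, Real.norm_of_nonneg (harmonic_nonneg _)]
    using tendsto_harmonic_atTop

theorem harmonic_le_log (n : ℕ) : (harmonic n : ℝ) ≤ Real.log (Real.exp 1 * ((n : ℝ) + 1)) := by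
  rw [Real.log_mul (Real.exp_ne_zero _) (by positivity), Real.log_exp]
  refine (harmonic_le_one_add_log n).trans ?_
  rcases Nat.eq_zero_or_pos n with rfl | hn
  · simp
  · gcongr
    exact le_add_of_nonneg_right zero_le_one

theorem tendsto_harmonic_pow_div_sqrt (j : ℕ) :
    Tendsto (fun n : ℕ => (harmonic n : ℝ) ^ j / √((n : ℝ) + 1)) atTop (𝓝 0) := by
  have hscale : Tendsto (fun n : ℕ => Real.exp 1 * ((n : ℝ) + 1)) atTop atTop :=
    (tendsto_atTop_add_const_right _ _ tendsto_natCast_atTop_atTop).const_mul_atTop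
      (Real.exp_pos 1)
  have hlog := ((isLittleO_log_rpow_rpow_atTop (s := 1 / 2) (j : ℝ)
    (by norm_num)).tendsto_div_nhds_zero.comp hscale).const_mul √(Real.exp 1)
  rw [mul_zero] at hlog
  refine squeeze_zero (fun n => div_nonneg (pow_nonneg (harmonic_nonneg n) j) (by positivity))
    (fun n => ?_) hlog
  simp only [Function.comp_apply, Real.rpow_natCast, ← Real.sqrt_eq_rpow]
  calc (harmonic n : ℝ) ^ j / √((n : ℝ) + 1)
      ≤ Real.log (Real.exp 1 * ((n : ℝ) + 1)) ^ j / √((n : ℝ) + 1) := by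
        gcongr
        · exact harmonic_nonneg n
        · exact harmonic_le_log n
    _ = _ := by
        rw [Real.sqrt_mul (Real.exp_pos 1).le]
        field_simp

theorem superpolynomialDecay_harmonicScale_of_norm_le {f : ℕ → ℂ} {C : ℝ}
    (hf : ∀ n, ‖f n‖ ≤ C / √((n : ℝ) + 1)) :
    Asymptotics.SuperpolynomialDecay atTop harmonicScale f := by
  intro j
  have hlim := (tendsto_harmonic_pow_div_sqrt j).const_mul C
  rw [mul_zero] at hlim
  refine squeeze_zero_norm (fun n => ?_) hlim
  rw [norm_mul, norm_pow, harmonicScale, Complex.norm_real, Real.norm_of_nonneg (harmonic_nonneg n)]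
  calc (harmonic n : ℝ) ^ j * ‖f n‖ ≤ (harmonic n : ℝ) ^ j * (C / √((n : ℝ) + 1)) := by
        gcongr
        · exact pow_nonneg (harmonic_nonneg n) j
        · exact hf n
    _ = C * ((harmonic n : ℝ) ^ j / √((n : ℝ) + 1)) := by ring

end Harmonic

/-! ### Nested sums -/

section NestedSum

variable {A R : Type*}

section CommSemiring

variable [CommSemiring R]

/-- The sum over `M > k_1 > ⋯ > k_r ≥ 0` of `∏ f a_i k_i`, for the word `a_1 ⋯ a_r`. -/
def nestedSum (f : A → ℕ → R) : List A → ℕ → R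
  | [], _ => 1
  | a :: w, M => ∑ k ∈ Finset.range M, f a k * nestedSum f w k

variable (f : A → ℕ → R) (a : A) (w : List A)

theorem nestedSum_nil (M : ℕ) : nestedSum f [] M = 1 := rfl

theorem nestedSum_cons (M : ℕ) :
    nestedSum f (a :: w) M = ∑ k ∈ Finset.range M, f a k * nestedSum f w k := rfl

theorem nestedSum_cons_zero : nestedSum f (a :: w) 0 = 0 := rfl

theorem nestedSum_cons_succ (M : ℕ) :
    nestedSum f (a :: w) (M + 1) = nestedSum f (a :: w) M + f a M * nestedSum f w M :=
  Finset.sum_range_succ ..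

end CommSemiring

theorem quasiShuffleSum_nestedSum [CommRing R] {m : A → A → Option A} {f : A → ℕ → R}
    (hf : ∀ a b k, (m a b).elim 0 (f · k) = f a k * f b k) (M : ℕ) (u v : List A) :
    quasiShuffleSum m (nestedSum f · M) u v = nestedSum f u M * nestedSum f v M := by
  induction M generalizing u v with
  | zero =>
    rcases u with _ | ⟨a, u⟩
    · simp [nestedSum_nil]
    rcases v with _ | ⟨b, v⟩
    · simp [nestedSum_nil]
    cases hm : m a b <;> simp [quasiShuffleSum_cons_cons, nestedSum_cons_zero, hm]
  | succ M ih =>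
    rcases u with _ | ⟨a, u⟩
    · simp [nestedSum_nil]
    rcases v with _ | ⟨b, v⟩
    · simp [nestedSum_nil]
    have hM := ih (a :: u) (b :: v)
    have hab := hf a b M
    rw [quasiShuffleSum_cons_cons] at hM ⊢
    cases hm : m a b <;>
    · simp only [hm, nestedSum_cons_succ, Option.elim_none, Option.elim_some, quasiShuffleSum_add,
        quasiShuffleSum_const_mul, ih] at hM hab ⊢
      linear_combination hM + nestedSum f u M * nestedSum f v M * hab

theorem isQuasiShuffleChar_nestedSum [CommRing R] {m : A → A → Option A} {f : A → ℕ → R}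
    (hf : ∀ a b k, (m a b).elim 0 (f · k) = f a k * f b k) :
    IsQuasiShuffleChar m (nestedSum f) where
  map_nil := rfl
  map_mul u v := funext fun M =>
    (map_quasiShuffleSum (nestedSum f) (Pi.evalRingHom (fun _ => R) M) u v).trans
      (quasiShuffleSum_nestedSum hf M u v)

end NestedSum

/-! ### Sums over decreasing tuples -/

section StrictAnti

theorem strictAnti_cons_iff {α : Type*} [Preorder α] {r : ℕ} {a : α} {f : Fin r → α} :
    StrictAnti (Fin.cons a f : Fin (r + 1) → α) ↔ (∀ i, f i < a) ∧ StrictAnti f := by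
  refine ⟨fun h => ⟨fun i => by simpa using h i.succ_pos, fun i j hij => by
    simpa using h (Fin.succ_lt_succ_iff.2 hij)⟩, fun ⟨ha, hf⟩ i j hij => ?_⟩
  induction j using Fin.cases with
  | zero => exact absurd hij (Fin.not_lt_zero _)
  | succ j =>
    induction i using Fin.cases with
    | zero => simpa using ha j
    | succ i => simpa using hf (Fin.succ_lt_succ_iff.1 hij)

open Classical in
theorem cons_succ_mem_filter_strictAnti_iff {r M k : ℕ} {κ : Fin r → ℕ} :
    (Fin.cons (k + 1) κ : Fin (r + 1) → ℕ) ∈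
        (Fintype.piFinset fun _ => Finset.Icc 1 M).filter StrictAnti ↔
      k < M ∧ κ ∈ (Fintype.piFinset fun _ => Finset.Icc 1 k).filter StrictAnti := by
  simp only [Finset.mem_filter, Fintype.mem_piFinset, Finset.mem_Icc, strictAnti_cons_iff,
    Fin.forall_fin_succ, Fin.cons_zero, Fin.cons_succ, Nat.lt_succ_iff]
  exact ⟨fun ⟨⟨hk, hκ⟩, hlt, hanti⟩ => ⟨hk.2, fun i => ⟨(hκ i).1, hlt i⟩, hanti⟩,
    fun ⟨hk, hκ, hanti⟩ => ⟨⟨⟨k.succ_pos, hk⟩, fun i => ⟨(hκ i).1, (hκ i).2.trans hk.le⟩⟩,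
      fun i => (hκ i).2, hanti⟩⟩

open Classical in
theorem sum_strictAnti_prod_succ {R : Type*} [CommSemiring R] {r : ℕ} (F : Fin (r + 1) → ℕ → R)
    (M : ℕ) :
    ∑ k ∈ (Fintype.piFinset fun _ => Finset.Icc 1 M).filter StrictAnti, ∏ i, F i (k i) =
      ∑ k ∈ Finset.range M, F 0 (k + 1) *
        ∑ κ ∈ (Fintype.piFinset fun _ => Finset.Icc 1 k).filter StrictAnti,
          ∏ i, F (Fin.succ i) (κ i) := by
  simp only [Finset.mul_sum]
  rw [Finset.sum_sigma']
  refine (Finset.sum_nbij (fun x => (Fin.cons (x.1 + 1) x.2 : Fin (r + 1) → ℕ)) (fun x hx => ?_)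
    (fun x _ y _ hxy => ?_) (fun f hf => ?_) fun x _ => ?_).symm
  · exact cons_succ_mem_filter_strictAnti_iff.2 (by simpa only [Finset.mem_sigma,
      Finset.mem_range] using hx)
  · obtain ⟨h₁, h₂⟩ := Fin.cons_inj.1 hxy
    exact Sigma.ext (Nat.succ_injective h₁) (heq_of_eq h₂)
  · have hf₀ : 1 ≤ f 0 := (Finset.mem_Icc.1 (Fintype.mem_piFinset.1 (Finset.mem_filter.1 hf).1 0)).1
    have hcons : Fin.cons (f 0 - 1 + 1) (Fin.tail f) = f := by
      rw [Nat.sub_add_cancel hf₀, Fin.cons_self_tail]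
    refine ⟨⟨f 0 - 1, Fin.tail f⟩, ?_, hcons⟩
    rw [Finset.mem_coe, ← hcons] at hf
    simpa only [Finset.mem_coe, Finset.mem_sigma, Finset.mem_range]
      using cons_succ_mem_filter_strictAnti_iff.1 hf
  · simp only [Fin.prod_univ_succ, Fin.cons_zero, Fin.cons_succ]

end StrictAnti

/-! ### Sequences converging with a rate -/

section Rate

variable {E : Type*} [NormedAddCommGroup E] [CompleteSpace E]

theorem exists_norm_sub_le_of_norm_succ_sub_le {S : ℕ → E} {b : ℕ → ℝ}
    (hb : Tendsto b atTop (𝓝 0)) (hS : ∀ k, ‖S (k + 1) - S k‖ ≤ b k - b (k + 1)) :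
    ∃ l, ∀ M, ‖S M - l‖ ≤ b M := by
  have hb_nonneg : ∀ k, 0 ≤ b k :=
    (antitone_nat_of_succ_le fun k => sub_nonneg.1 ((norm_nonneg _).trans (hS k))).le_of_tendsto hb
  have htail : ∀ {M N}, M ≤ N → ‖S N - S M‖ ≤ b M - b N := fun {M N} hMN => by
    induction N, hMN using Nat.le_induction with
    | base => simp
    | succ N _ ih => linarith [hS N, norm_sub_le_norm_sub_add_norm_sub (S (N + 1)) (S N) (S M)]
  have hdist : ∀ M N, M ≤ N → dist (S M) (S N) ≤ b M := fun M N hMN => by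
    rw [dist_comm, dist_eq_norm]
    linarith [htail hMN, hb_nonneg N]
  obtain ⟨l, hl⟩ := cauchySeq_tendsto_of_complete (cauchySeq_of_le_tendsto_0' b hdist hb)
  refine ⟨l, fun M => ?_⟩
  rw [← dist_eq_norm]
  exact le_of_tendsto (tendsto_const_nhds.dist hl) (eventually_atTop.2 ⟨M, hdist M⟩)

theorem one_div_mul_sqrt_le {x : ℝ} (hx : 1 ≤ x) :
    1 / (x * √x) ≤ 4 / √x - 4 / √(x + 1) := by
  set p := √x
  set q := √(x + 1)
  have hp_sq : p ^ 2 = x := Real.sq_sqrt (by linarith)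
  have hq_sq : q ^ 2 = x + 1 := Real.sq_sqrt (by linarith)
  have hp_one : 1 ≤ p := Real.one_le_sqrt.2 hx
  have hpq : p ≤ q := Real.sqrt_le_sqrt (by linarith)
  have hq_le : q ≤ 2 * p := by nlinarith
  have hdiff : 4 / p - 4 / q = 4 / (p * q * (q + p)) := by
    rw [div_sub_div _ _ (by positivity) (by positivity),
      div_eq_div_iff (by positivity) (by positivity)]
    linear_combination (4 * p * q) * (hq_sq - hp_sq)
  rw [hdiff, ← hp_sq, div_le_div_iff₀ (by positivity) (by positivity)]
  nlinarith [mul_pos (by linarith : 0 < p) (by linarith : 0 < q)]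

theorem exists_norm_sub_le_div_sqrt {S : ℕ → E} {C : ℝ}
    (hS : ∀ k : ℕ, ‖S (k + 1) - S k‖ ≤ C / (((k : ℝ) + 1) * √((k : ℝ) + 1))) :
    ∃ l C', ∀ M : ℕ, ‖S M - l‖ ≤ C' / √((M : ℝ) + 1) := by
  have hC : 0 ≤ C := by simpa using (norm_nonneg _).trans (hS 0)
  have hlim : Tendsto (fun k : ℕ => 4 * C / √((k : ℝ) + 1)) atTop (𝓝 0) :=
    tendsto_const_nhds.div_atTop (Real.tendsto_sqrt_atTop.comp
      (tendsto_atTop_add_const_right _ _ tendsto_natCast_atTop_atTop))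
  obtain ⟨l, hl⟩ := exists_norm_sub_le_of_norm_succ_sub_le hlim fun k => (hS k).trans <| by
    have hstep := mul_le_mul_of_nonneg_left (one_div_mul_sqrt_le (x := (k : ℝ) + 1) (by simp)) hC
    push_cast
    linear_combination hstep
  exact ⟨l, 4 * C, hl⟩

/-- Summation by parts: up to the boundary term `z ^ (M + 1) * g M`, the sums multiplied by `z - 1`
have increments `z ^ (k + 2) * (g k - g (k + 1))`. -/
theorem exists_norm_sum_pow_mul_sub_le {z : ℂ} (hz : ‖z‖ = 1) (hz_ne : z ≠ 1) {g : ℕ → ℂ} {C D : ℝ}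
    (hg : ∀ k : ℕ, ‖g k‖ ≤ C / √((k : ℝ) + 1))
    (hg_sub : ∀ k : ℕ, ‖g (k + 1) - g k‖ ≤ D / (((k : ℝ) + 1) * √((k : ℝ) + 1))) :
    ∃ l C', ∀ M : ℕ, ‖∑ k ∈ Finset.range M, z ^ (k + 1) * g k - l‖ ≤ C' / √((M : ℝ) + 1) := by
  have hz_sub : z - 1 ≠ 0 := sub_ne_zero.2 hz_ne
  set T : ℕ → ℂ := fun M => ∑ k ∈ Finset.range M, z ^ (k + 1) * g k with hT
  obtain ⟨l, C', hl⟩ := exists_norm_sub_le_div_sqrt (C := D)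
    (S := fun M => (z - 1) * T M - z ^ (M + 1) * g M) fun k => by
      have hstep : (z - 1) * T (k + 1) - z ^ (k + 1 + 1) * g (k + 1) -
          ((z - 1) * T k - z ^ (k + 1) * g k) = -(z ^ (k + 2) * (g (k + 1) - g k)) := by
        simp only [hT, Finset.sum_range_succ]
        ring
      rw [hstep, norm_neg, norm_mul, norm_pow, hz, one_pow, one_mul]
      exact hg_sub k
  refine ⟨l / (z - 1), (C' + C) / ‖z - 1‖, fun M => ?_⟩
  have hsplit : T M - l / (z - 1) =
      (((z - 1) * T M - z ^ (M + 1) * g M - l) + z ^ (M + 1) * g M) / (z - 1) := by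
    field_simp
    ring
  rw [hsplit, norm_div, div_right_comm, add_div]
  gcongr
  refine (norm_add_le _ _).trans (add_le_add (hl M) ?_)
  rw [norm_mul, norm_pow, hz, one_pow, one_mul]
  exact hg M

theorem sum_one_div_sqrt_le (M : ℕ) :
    ∑ k ∈ Finset.range M, 1 / √((k : ℝ) + 1) ≤ 2 * √(M : ℝ) := by
  induction M with
  | zero => simp
  | succ M ih =>
    rw [Finset.sum_range_succ, Nat.cast_succ]
    have hpos : 0 < √((M : ℝ) + 1) := by positivity
    have hsq := Real.sq_sqrt (by positivity : 0 ≤ (M : ℝ) + 1)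
    have hsq' := Real.sq_sqrt (Nat.cast_nonneg M : (0 : ℝ) ≤ M)
    have hterm : 1 / √((M : ℝ) + 1) ≤ 2 * (√((M : ℝ) + 1) - √(M : ℝ)) := by
      rw [div_le_iff₀ hpos]
      nlinarith [sq_nonneg (√((M : ℝ) + 1) - √(M : ℝ))]
    linarith

theorem norm_div_succ_sub_le {T : ℕ → ℂ} {C D : ℝ}
    (hC : ∀ M : ℕ, ‖T M‖ ≤ C * √((M : ℝ) + 1))
    (hD : ∀ M : ℕ, ‖T (M + 1) - T M‖ ≤ D / √((M : ℝ) + 1)) (k : ℕ) :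
    ‖T (k + 1) / (((k + 1 : ℕ) : ℂ) + 1) - T k / ((k : ℂ) + 1)‖ ≤
      (D + C) / (((k : ℝ) + 1) * √((k : ℝ) + 1)) := by
  have hC_nonneg : 0 ≤ C := by simpa using (norm_nonneg _).trans (hC 0)
  have hD_nonneg : 0 ≤ D := by simpa using (norm_nonneg _).trans (hD 0)
  have hnorm : ∀ j : ℕ, ‖(j : ℂ) + 1‖ = (j : ℝ) + 1 := fun j => by
    rw [← Nat.cast_succ, Complex.norm_natCast, Nat.cast_succ]
  have hne : ∀ j : ℕ, (j : ℂ) + 1 ≠ 0 := Nat.cast_add_one_ne_zero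
  have hsplit : T (k + 1) / (((k + 1 : ℕ) : ℂ) + 1) - T k / ((k : ℂ) + 1) =
      (T (k + 1) - T k) / (((k + 1 : ℕ) : ℂ) + 1) -
        T k / (((k : ℂ) + 1) * (((k + 1 : ℕ) : ℂ) + 1)) := by
    have := hne k
    have := hne (k + 1)
    field_simp
    push_cast
    ring
  rw [hsplit]
  calc _ ≤ D / √((k : ℝ) + 1) / ((k : ℝ) + 1) +
        C * √((k : ℝ) + 1) / (((k : ℝ) + 1) * ((k : ℝ) + 1)) := by
        refine (norm_sub_le _ _).trans ?_
        rw [norm_div, norm_div, norm_mul, hnorm, hnorm]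
        gcongr
        · exact hD k
        · simp
        · exact hC k
        · simp
    _ = D / √((k : ℝ) + 1) / ((k : ℝ) + 1) +
        C * (√((k : ℝ) + 1) / ((k : ℝ) + 1)) / ((k : ℝ) + 1) := by
        rw [mul_div_assoc', div_div _ ((k : ℝ) + 1)]
    _ = (D + C) / (((k : ℝ) + 1) * √((k : ℝ) + 1)) := by
        rw [Real.sqrt_div_self']
        field_simp

end Rate

/-! ### Truncated polylogarithm sums -/

section TruncatedSums

variable (Γ : Subgroup ℂˣ)

/-- The summand `ν ^ (k + 1) / (k + 1) ^ n` belonging to the letter `y_{n,ν}`. -/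
def letterTerm (y : YLetter Γ) (k : ℕ) : ℂ :=
  ((y.2 : ℂˣ) : ℂ) ^ (k + 1) / ((k : ℂ) + 1) ^ (y.1 : ℕ)

/-- The sum over `M ≥ k_1 > ⋯ > k_r > 0` of `∏ σ_i ^ k_i / k_i ^ s_i`, for a word in the letters
`y_{s,σ}`; its summation indices are shifted down by one. -/
def truncatedSum : List (YLetter Γ) → ℕ → ℂ :=
  nestedSum (letterTerm Γ)

theorem isQuasiShuffleChar_truncatedSum :
    IsQuasiShuffleChar (stuffleMerge Γ) (truncatedSum Γ) :=
  isQuasiShuffleChar_nestedSum fun a b k => by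
    simp only [stuffleMerge, Option.elim_some, letterTerm, PNat.add_coe, pow_add,
      Subgroup.coe_mul, Units.val_mul, mul_pow]
    field_simp

theorem truncatedSum_cons_succ (y : YLetter Γ) (w : List (YLetter Γ)) (M : ℕ) :
    truncatedSum Γ (y :: w) (M + 1) =
      truncatedSum Γ (y :: w) M + letterTerm Γ y M * truncatedSum Γ w M :=
  nestedSum_cons_succ ..

theorem polylogPartialSum_eq_truncatedSum (w : List (YLetter Γ)) (M : ℕ) :
    polylogPartialSum (fun i => ((w.get i).1 : ℕ)) (fun i => (((w.get i).2 : ℂˣ) : ℂ)) M =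
      truncatedSum Γ w M := by
  induction w generalizing M with
  | nil =>
    rw [polylogPartialSum, Finset.filter_true_of_mem fun _ _ i => i.elim0]
    simp [truncatedSum, nestedSum_nil]
  | cons y w ih =>
    refine (sum_strictAnti_prod_succ (r := w.length) (fun i k =>
      ((((y :: w).get i).2 : ℂˣ) : ℂ) ^ k / (k : ℂ) ^ (((y :: w).get i).1 : ℕ)) M).trans ?_
    refine Finset.sum_congr rfl fun k _ => congrArg₂ _ ?_ (ih k)
    rw [letterTerm, ← Nat.cast_succ]
    rfl

theorem truncatedSum_singleton_one : truncatedSum Γ [(1, 1)] = harmonicScale := by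
  funext M
  simp [truncatedSum, nestedSum_cons, nestedSum_nil, letterTerm, harmonic, harmonicScale]

variable [Finite Γ]

theorem norm_coe_subgroup (ν : Γ) : ‖((ν : ℂˣ) : ℂ)‖ = 1 := by
  refine Complex.norm_eq_one_of_pow_eq_one (n := Nat.card Γ) ?_ Nat.card_pos.ne'
  rw [← Units.val_pow_eq_pow_val, ← Subgroup.coe_pow, pow_card_eq_one', Subgroup.coe_one,
    Units.val_one]

theorem norm_letterTerm_le (y : YLetter Γ) {n : ℕ} (hn : n ≤ y.1) (k : ℕ) :
    ‖letterTerm Γ y k‖ ≤ 1 / ((k : ℝ) + 1) ^ n := by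
  have hk : (1 : ℝ) ≤ (k : ℝ) + 1 := le_add_of_nonneg_left k.cast_nonneg
  rw [letterTerm, norm_div, norm_pow, norm_pow, norm_coe_subgroup, one_pow, ← Nat.cast_succ,
    Complex.norm_natCast, Nat.cast_succ]
  gcongr

theorem exists_norm_truncatedSum_le (w : List (YLetter Γ)) :
    ∃ C : ℝ, ∀ M : ℕ, ‖truncatedSum Γ w M‖ ≤ C * √((M : ℝ) + 1) := by
  induction w with
  | nil => exact ⟨1, fun M => by simp [truncatedSum, nestedSum_nil, Real.one_le_sqrt]⟩
  | cons y w ih =>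
    obtain ⟨C, h⟩ := ih
    have hC : 0 ≤ C := by simpa using (norm_nonneg _).trans (h 0)
    refine ⟨C * 2, fun M => ?_⟩
    calc ‖truncatedSum Γ (y :: w) M‖
        ≤ ∑ k ∈ Finset.range M, ‖letterTerm Γ y k‖ * ‖truncatedSum Γ w k‖ := by
          rw [truncatedSum, nestedSum_cons]
          exact norm_sum_le_of_le _ fun _ _ => norm_mul_le _ _
      _ ≤ ∑ k ∈ Finset.range M, 1 / ((k : ℝ) + 1) ^ 1 * (C * √((k : ℝ) + 1)) := by
          gcongr with k
          · exact norm_letterTerm_le Γ y y.1.pos k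
          · exact h k
      _ = C * ∑ k ∈ Finset.range M, 1 / √((k : ℝ) + 1) := by
          rw [Finset.mul_sum]
          refine Finset.sum_congr rfl fun k _ => ?_
          rw [← Real.sqrt_div_self']
          ring
      _ ≤ C * (2 * √(M : ℝ)) := by gcongr; exact sum_one_div_sqrt_le M
      _ ≤ C * 2 * √((M : ℝ) + 1) := by
          rw [← mul_assoc]
          gcongr
          exact le_add_of_nonneg_right zero_le_one

theorem exists_norm_letterTerm_mul_truncatedSum_le (w : List (YLetter Γ)) :
    ∃ C : ℝ, ∀ (y : YLetter Γ) (n k : ℕ), n + 1 ≤ y.1 →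
      ‖letterTerm Γ y k * truncatedSum Γ w k‖ ≤ C / (((k : ℝ) + 1) ^ n * √((k : ℝ) + 1)) := by
  obtain ⟨C, hC⟩ := exists_norm_truncatedSum_le Γ w
  refine ⟨C, fun y n k hn => ?_⟩
  calc ‖letterTerm Γ y k * truncatedSum Γ w k‖
      ≤ 1 / ((k : ℝ) + 1) ^ (n + 1) * (C * √((k : ℝ) + 1)) := by
        rw [norm_mul]
        gcongr
        · exact norm_letterTerm_le Γ y hn k
        · exact hC k
    _ = C * (√((k : ℝ) + 1) / ((k : ℝ) + 1)) / ((k : ℝ) + 1) ^ n := by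
        rw [pow_succ]
        field_simp
    _ = C / (((k : ℝ) + 1) ^ n * √((k : ℝ) + 1)) := by
        rw [Real.sqrt_div_self']
        field_simp

theorem exists_norm_truncatedSum_succ_sub_le (w : List (YLetter Γ)) :
    ∃ C : ℝ, ∀ M : ℕ,
      ‖truncatedSum Γ w (M + 1) - truncatedSum Γ w M‖ ≤ C / √((M : ℝ) + 1) := by
  rcases w with _ | ⟨y, w⟩
  · exact ⟨0, fun M => by simp [truncatedSum, nestedSum_nil]⟩
  · obtain ⟨C, hC⟩ := exists_norm_letterTerm_mul_truncatedSum_le Γ w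
    refine ⟨C, fun M => ?_⟩
    rw [truncatedSum_cons_succ, add_sub_cancel_left]
    simpa only [pow_zero, one_mul] using hC y 0 M y.1.pos

theorem exists_norm_truncatedSum_sub_le_of_two_le {y : YLetter Γ} (hy : 2 ≤ (y.1 : ℕ))
    (w : List (YLetter Γ)) :
    ∃ l C, ∀ M : ℕ, ‖truncatedSum Γ (y :: w) M - l‖ ≤ C / √((M : ℝ) + 1) := by
  obtain ⟨C, hC⟩ := exists_norm_letterTerm_mul_truncatedSum_le Γ w
  refine exists_norm_sub_le_div_sqrt (C := C) fun k => ?_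
  rw [truncatedSum_cons_succ, add_sub_cancel_left]
  simpa only [pow_one] using hC y 1 k hy

theorem exists_norm_truncatedSum_sub_le_of_ne_one {ν : Γ} (hν : ν ≠ 1) (w : List (YLetter Γ)) :
    ∃ l C, ∀ M : ℕ, ‖truncatedSum Γ ((1, ν) :: w) M - l‖ ≤ C / √((M : ℝ) + 1) := by
  obtain ⟨C, hC⟩ := exists_norm_truncatedSum_le Γ w
  obtain ⟨D, hD⟩ := exists_norm_truncatedSum_succ_sub_le Γ w
  have hν_ne : ((ν : ℂˣ) : ℂ) ≠ 1 := fun h => hν (Subtype.ext (Units.ext h))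
  obtain ⟨l, C', hl⟩ := exists_norm_sum_pow_mul_sub_le (norm_coe_subgroup Γ ν) hν_ne (C := C)
    (g := fun k => truncatedSum Γ w k / ((k : ℂ) + 1)) (fun k => by
      rw [norm_div, ← Nat.cast_succ, Complex.norm_natCast, Nat.cast_succ]
      refine (div_le_div_of_nonneg_right (hC k) (by positivity)).trans_eq ?_
      rw [mul_div_assoc, Real.sqrt_div_self', mul_one_div])
    (norm_div_succ_sub_le hC hD)
  refine ⟨l, C', fun M => ?_⟩
  have hsum : truncatedSum Γ ((1, ν) :: w) M =
      ∑ k ∈ Finset.range M, ((ν : ℂˣ) : ℂ) ^ (k + 1) * (truncatedSum Γ w k / ((k : ℂ) + 1)) := by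
    rw [truncatedSum, nestedSum_cons]
    refine Finset.sum_congr rfl fun k _ => ?_
    rw [letterTerm, PNat.one_coe, pow_one, div_mul_eq_mul_div, mul_div_assoc]
  rw [hsum]
  exact hl M

theorem exists_hasExpansion_truncatedSum_of_head?_ne {w : List (YLetter Γ)}
    (hw : w.head? ≠ some (1, 1)) :
    ∃ l, HasExpansion atTop harmonicScale (truncatedSum Γ w) (Polynomial.C l) := by
  obtain ⟨l, C, h⟩ : ∃ l C, ∀ M : ℕ, ‖truncatedSum Γ w M - l‖ ≤ C / √((M : ℝ) + 1) := by
    rcases w with _ | ⟨⟨s, ν⟩, w⟩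
    · exact ⟨1, 0, fun M => by simp [truncatedSum, nestedSum_nil]⟩
    rcases (one_le : 1 ≤ s).eq_or_lt with rfl | hs
    · exact exists_norm_truncatedSum_sub_le_of_ne_one Γ (fun hν => hw (by rw [hν]; rfl)) w
    · exact exists_norm_truncatedSum_sub_le_of_two_le Γ (y := (s, ν))
        ((PNat.coe_lt_coe 1 s).2 hs) w
  refine ⟨l, superpolynomialDecay_harmonicScale_of_norm_le (C := C) fun n => ?_⟩
  simpa using h n

theorem exists_hasExpansion_truncatedSum (w : List (YLetter Γ)) :
    ∃ P, HasExpansion atTop harmonicScale (truncatedSum Γ w) P :=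
  (isQuasiShuffleChar_truncatedSum Γ).mem_of_head?_ne (stuffleMerge_ne Γ (1, 1))
    (expansionSubalgebra atTop harmonicScale) (isQuasiShuffleClosed_univ _)
    ⟨Polynomial.X, truncatedSum_singleton_one Γ ▸ hasExpansion_self⟩
    (fun _ _ hw => (exists_hasExpansion_truncatedSum_of_head?_ne Γ hw).imp' _ fun _ h => h)
    (Set.mem_univ w)

/-- The polynomial in the harmonic numbers approximating a truncated sum. -/
def polylogPoly (w : List (YLetter Γ)) : Polynomial ℂ :=
  (exists_hasExpansion_truncatedSum Γ w).choose

theorem hasExpansion_polylogPoly (w : List (YLetter Γ)) :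
    HasExpansion atTop harmonicScale (truncatedSum Γ w) (polylogPoly Γ w) :=
  (exists_hasExpansion_truncatedSum Γ w).choose_spec

theorem isQuasiShuffleChar_polylogPoly : IsQuasiShuffleChar (stuffleMerge Γ) (polylogPoly Γ) :=
  (isQuasiShuffleChar_truncatedSum Γ).of_hasExpansion tendsto_norm_harmonicScale
    (hasExpansion_polylogPoly Γ)

theorem polylogPoly_singleton_one : polylogPoly Γ [(1, 1)] = Polynomial.X :=
  (hasExpansion_polylogPoly Γ _).unique tendsto_norm_harmonicScale
    (truncatedSum_singleton_one Γ ▸ hasExpansion_self)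

theorem polylogPoly_of_head?_ne {w : List (YLetter Γ)} (hw : w.head? ≠ some (1, 1)) :
    ∃ l, polylogPoly Γ w = Polynomial.C l ∧ Tendsto (truncatedSum Γ w) atTop (𝓝 l) := by
  obtain ⟨l, hl⟩ := exists_hasExpansion_truncatedSum_of_head?_ne Γ hw
  exact ⟨l, (hasExpansion_polylogPoly Γ w).unique tendsto_norm_harmonicScale hl, hl.tendsto⟩

end TruncatedSums

/-! ### The polylogarithm series -/

section PolylogSeries

variable (Γ : Subgroup ℂˣ) [Fintype Γ] {L : NCSeries (YLetter Γ) ℂ}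

theorem polylogPoly_eq_C (hL : IsPolylogSeries Γ L) {w : List (YLetter Γ)}
    (hw : w.head? ≠ some (1, 1)) :
    polylogPoly Γ w = Polynomial.C (L (FreeMonoid.ofList w)) := by
  obtain ⟨l, hl, hlim⟩ := polylogPoly_of_head?_ne Γ hw
  have hconv : Tendsto (truncatedSum Γ w) atTop (𝓝 (L (FreeMonoid.ofList w))) :=
    (hL.convergent (FreeMonoid.ofList w) hw).congr (polylogPartialSum_eq_truncatedSum Γ w)
  rw [hl, tendsto_nhds_unique hlim hconv]

theorem polylogPoly_eq_expMulCoeff (hL : IsPolylogSeries Γ L) :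
    polylogPoly Γ = expMulCoeff (1, 1) L :=
  (isQuasiShuffleChar_polylogPoly Γ).ext_of_head?_ne
    (isQuasiShuffleChar_expMulCoeff (stuffleMerge_ne Γ) hL.isQuasiShuffleChar)
    (stuffleMerge_ne Γ (1, 1))
    (by rw [polylogPoly_singleton_one, expMulCoeff_singleton hL.diagonal.1 hL.coeff_y_one_one])
    fun w hw => by rw [polylogPoly_eq_C Γ hL hw, expMulCoeff_of_head?_ne hw]

theorem isPolylogSeries_eval_zero_polylogPoly :
    IsPolylogSeries Γ fun w => (polylogPoly Γ w.toList).eval 0 where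
  diagonal := ((isQuasiShuffleCoproduct_stuffleCoproduct Γ).isDiagonal_iff _).2
    ((isQuasiShuffleChar_polylogPoly Γ).comp (Polynomial.evalRingHom 0))
  convergent w hw := by
    obtain ⟨l, hl, hlim⟩ := polylogPoly_of_head?_ne Γ hw
    rw [hl, Polynomial.eval_C]
    exact hlim.congr fun M => (polylogPartialSum_eq_truncatedSum Γ w.toList M).symm
  coeff_y_one_one := by
    rw [FreeMonoid.toList_of, polylogPoly_singleton_one, Polynomial.eval_X]

theorem existsUnique_isPolylogSeries : ∃! L : NCSeries (YLetter Γ) ℂ, IsPolylogSeries Γ L :=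
  ⟨_, isPolylogSeries_eval_zero_polylogPoly Γ, fun L hL => funext fun w => by
    rw [polylogPoly_eq_expMulCoeff Γ hL, eval_zero_expMulCoeff]; rfl⟩

end PolylogSeries

/-! ### Power series with coefficients of polynomial growth -/

section PolynomialGrowth

variable {𝕜 : Type*}

section NormedField

variable [NormedField 𝕜]

theorem exists_norm_coeff_mul_le {f g : PowerSeries 𝕜} {C D : ℝ} {k l : ℕ}
    (hf : ∀ n : ℕ, ‖PowerSeries.coeff n f‖ ≤ C * ((n : ℝ) + 1) ^ k)
    (hg : ∀ n : ℕ, ‖PowerSeries.coeff n g‖ ≤ D * ((n : ℝ) + 1) ^ l) (n : ℕ) :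
    ‖PowerSeries.coeff n (f * g)‖ ≤ C * D * ((n : ℝ) + 1) ^ (k + l + 1) := by
  have hC : 0 ≤ C := (norm_nonneg _).trans (by simpa using hf 0)
  have hD : 0 ≤ D := (norm_nonneg _).trans (by simpa using hg 0)
  have hterm : ∀ p ∈ Finset.HasAntidiagonal.antidiagonal n,
      ‖PowerSeries.coeff p.1 f * PowerSeries.coeff p.2 g‖ ≤
        C * D * ((n : ℝ) + 1) ^ (k + l) := by
    intro p hp
    have hsum := Finset.HasAntidiagonal.mem_antidiagonal.1 hp
    have hfst : (p.1 : ℝ) ≤ n := by exact_mod_cast (by lia : p.1 ≤ n)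
    have hsnd : (p.2 : ℝ) ≤ n := by exact_mod_cast (by lia : p.2 ≤ n)
    calc ‖PowerSeries.coeff p.1 f * PowerSeries.coeff p.2 g‖
        ≤ C * ((p.1 : ℝ) + 1) ^ k * (D * ((p.2 : ℝ) + 1) ^ l) := by
          rw [norm_mul]
          exact mul_le_mul (hf _) (hg _) (norm_nonneg _) (by positivity)
      _ ≤ C * ((n : ℝ) + 1) ^ k * (D * ((n : ℝ) + 1) ^ l) := by gcongr
      _ = C * D * ((n : ℝ) + 1) ^ (k + l) := by ring
  rw [PowerSeries.coeff_mul]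
  refine (norm_sum_le_of_le _ hterm).trans (le_of_eq ?_)
  rw [Finset.sum_const, Finset.Nat.card_antidiagonal, nsmul_eq_mul]
  push_cast
  ring

variable (𝕜) in
/-- The power series whose coefficients are bounded by a polynomial in their index. -/
def polynomialGrowthSubalgebra : Subalgebra 𝕜 (PowerSeries 𝕜) where
  carrier := {f | ∃ (C : ℝ) (k : ℕ), ∀ n : ℕ, ‖PowerSeries.coeff n f‖ ≤ C * ((n : ℝ) + 1) ^ k}
  mul_mem' := fun ⟨_, _, hf⟩ ⟨_, _, hg⟩ => ⟨_, _, exists_norm_coeff_mul_le hf hg⟩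
  add_mem' := by
    rintro f g ⟨C, k, hf⟩ ⟨D, l, hg⟩
    have hC : 0 ≤ C := (norm_nonneg _).trans (by simpa using hf 0)
    have hD : 0 ≤ D := (norm_nonneg _).trans (by simpa using hg 0)
    refine ⟨C + D, max k l, fun n => ?_⟩
    rw [map_add, add_mul]
    refine norm_add_le_of_le ((hf n).trans ?_) ((hg n).trans ?_)
    · gcongr
      exacts [by simp, le_max_left k l]
    · gcongr
      exacts [by simp, le_max_right k l]
  algebraMap_mem' := fun c => ⟨‖c‖, 0, fun n => by
    rw [PowerSeries.algebraMap_apply, Algebra.algebraMap_self_apply, PowerSeries.coeff_C]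
    split_ifs <;> simp⟩

theorem mk_mem_polynomialGrowthSubalgebra_of_norm_le {f : ℕ → 𝕜} {C : ℝ} (hf : ∀ n, ‖f n‖ ≤ C) :
    PowerSeries.mk f ∈ polynomialGrowthSubalgebra 𝕜 :=
  ⟨C, 0, fun n => by simpa using hf n⟩

theorem X_mem_polynomialGrowthSubalgebra :
    PowerSeries.X ∈ polynomialGrowthSubalgebra 𝕜 :=
  ⟨1, 0, fun n => by rw [PowerSeries.coeff_X]; split_ifs <;> simp⟩

theorem derivative_mem_polynomialGrowthSubalgebra {f : PowerSeries 𝕜}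
    (hf : f ∈ polynomialGrowthSubalgebra 𝕜) :
    PowerSeries.derivative 𝕜 f ∈ polynomialGrowthSubalgebra 𝕜 := by
  obtain ⟨C, k, hf⟩ := hf
  have hC : 0 ≤ C := (norm_nonneg _).trans (by simpa using hf 0)
  refine ⟨C * 2 ^ k, k + 1, fun n => ?_⟩
  have hn : ‖(n : 𝕜) + 1‖ ≤ (n : ℝ) + 1 := by
    simpa using Nat.norm_cast_le (α := 𝕜) (n + 1)
  calc ‖PowerSeries.coeff n (PowerSeries.derivative 𝕜 f)‖
      ≤ C * (((n + 1 : ℕ) : ℝ) + 1) ^ k * ((n : ℝ) + 1) := by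
        rw [PowerSeries.coeff_derivative, norm_mul]
        exact mul_le_mul (hf _) hn (norm_nonneg _) (by positivity)
    _ ≤ C * (2 * ((n : ℝ) + 1)) ^ k * ((n : ℝ) + 1) := by
        gcongr
        push_cast
        linarith [(Nat.cast_nonneg n : (0 : ℝ) ≤ n)]
    _ = C * 2 ^ k * ((n : ℝ) + 1) ^ (k + 1) := by
        rw [mul_pow]
        ring

/-- The value at `z` of a power series, meaningful when the series converges there. -/
def seriesEval (z : 𝕜) (f : PowerSeries 𝕜) : 𝕜 :=
  ∑' n, PowerSeries.coeff n f * z ^ n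

variable {f g : PowerSeries 𝕜} {z : 𝕜}

theorem seriesEval_zero : seriesEval 0 f = PowerSeries.constantCoeff f := by
  rw [seriesEval, tsum_eq_single 0 fun n hn => by rw [zero_pow hn, mul_zero]]
  simp

theorem seriesEval_algebraMap (c : 𝕜) : seriesEval z (algebraMap 𝕜 (PowerSeries 𝕜) c) = c := by
  rw [seriesEval, tsum_eq_single 0 fun n hn => by
    rw [PowerSeries.algebraMap_apply, PowerSeries.coeff_C, if_neg hn, zero_mul]]
  simp

theorem seriesEval_X : seriesEval z PowerSeries.X = z := by
  rw [seriesEval, tsum_eq_single 1 fun n hn => by simp [PowerSeries.coeff_X, hn]]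
  simp

theorem summable_norm_coeff_mul_pow (hf : f ∈ polynomialGrowthSubalgebra 𝕜) (hz : ‖z‖ < 1) :
    Summable fun n => ‖PowerSeries.coeff n f * z ^ n‖ := by
  obtain ⟨C, k, hf⟩ := hf
  have hgeom : Summable fun n : ℕ => ((n : ℝ) + 1) ^ k * ‖z‖ ^ n := by
    simp only [add_pow, one_pow, mul_one, Finset.sum_mul]
    refine summable_sum fun i _ => ?_
    have hi := summable_pow_mul_geometric_of_norm_lt_one (R := ℝ) i ((norm_norm z).trans_lt hz)
    exact (hi.mul_right (k.choose i : ℝ)).congr fun n => by ring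
  refine .of_nonneg_of_le (fun _ => norm_nonneg _) (fun n => ?_) (hgeom.mul_left C)
  rw [norm_mul, norm_pow, ← mul_assoc]
  exact mul_le_mul_of_nonneg_right (hf n) (by positivity)

variable [CompleteSpace 𝕜]

theorem summable_coeff_mul_pow (hf : f ∈ polynomialGrowthSubalgebra 𝕜) (hz : ‖z‖ < 1) :
    Summable fun n => PowerSeries.coeff n f * z ^ n :=
  (summable_norm_coeff_mul_pow hf hz).of_norm

theorem seriesEval_add (hf : f ∈ polynomialGrowthSubalgebra 𝕜)
    (hg : g ∈ polynomialGrowthSubalgebra 𝕜) (hz : ‖z‖ < 1) :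
    seriesEval z (f + g) = seriesEval z f + seriesEval z g := by
  simp only [seriesEval, map_add, add_mul]
  exact (summable_coeff_mul_pow hf hz).tsum_add (summable_coeff_mul_pow hg hz)

theorem seriesEval_mul (hf : f ∈ polynomialGrowthSubalgebra 𝕜)
    (hg : g ∈ polynomialGrowthSubalgebra 𝕜) (hz : ‖z‖ < 1) :
    seriesEval z (f * g) = seriesEval z f * seriesEval z g := by
  rw [seriesEval, seriesEval, seriesEval,
    tsum_mul_tsum_eq_tsum_sum_antidiagonal_of_summable_norm (R := 𝕜)
      (f := fun n => PowerSeries.coeff n f * z ^ n) (g := fun n => PowerSeries.coeff n g * z ^ n)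
      (summable_norm_coeff_mul_pow hf hz) (summable_norm_coeff_mul_pow hg hz)]
  refine tsum_congr fun n => ?_
  rw [PowerSeries.coeff_mul, Finset.sum_mul]
  refine Finset.sum_congr rfl fun p hp => ?_
  rw [← Finset.HasAntidiagonal.mem_antidiagonal.1 hp, pow_add]
  ring

/-- Evaluation at a point of the open unit disc. -/
def seriesEvalHom (hz : ‖z‖ < 1) : polynomialGrowthSubalgebra 𝕜 →ₐ[𝕜] 𝕜 where
  toFun f := seriesEval z f
  map_one' := (congrArg _ (map_one (algebraMap 𝕜 (PowerSeries 𝕜))).symm).trans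
    (seriesEval_algebraMap 1)
  map_mul' f g := seriesEval_mul f.2 g.2 hz
  map_zero' := (congrArg _ (map_zero (algebraMap 𝕜 (PowerSeries 𝕜))).symm).trans
    (seriesEval_algebraMap 0)
  map_add' f g := seriesEval_add f.2 g.2 hz
  commutes' c := seriesEval_algebraMap c

theorem seriesEvalHom_apply (hz : ‖z‖ < 1) (f : polynomialGrowthSubalgebra 𝕜) :
    seriesEvalHom hz f = seriesEval z f := rfl

end NormedField

section RCLike

variable [RCLike 𝕜] {f : PowerSeries 𝕜} {z : 𝕜}

theorem hasSum_coeff_derivative_mul_pow (hf : f ∈ polynomialGrowthSubalgebra 𝕜) (hz : ‖z‖ < 1) :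
    HasSum (fun n : ℕ => PowerSeries.coeff n f * (n * z ^ (n - 1)))
      (seriesEval z (PowerSeries.derivative 𝕜 f)) := by
  have hsum := (summable_coeff_mul_pow (derivative_mem_polynomialGrowthSubalgebra hf) hz).hasSum
  rw [← hasSum_nat_add_iff' 1]
  simpa [seriesEval, PowerSeries.coeff_derivative, mul_assoc] using hsum

theorem summable_norm_coeff_mul_natCast_mul_pow (hf : f ∈ polynomialGrowthSubalgebra 𝕜) {r : ℝ}
    (hr0 : 0 ≤ r) (hr : r < 1) :
    Summable fun n : ℕ => ‖PowerSeries.coeff n f‖ * (n * r ^ (n - 1)) := by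
  rw [← summable_nat_add_iff 1]
  refine (summable_norm_coeff_mul_pow (derivative_mem_polynomialGrowthSubalgebra hf)
    (z := (r : 𝕜)) (by rwa [RCLike.norm_ofReal, abs_of_nonneg hr0])).congr fun n => ?_
  rw [PowerSeries.coeff_derivative, norm_mul, norm_mul, norm_pow, RCLike.norm_ofReal,
    abs_of_nonneg hr0, Nat.add_sub_cancel, mul_assoc]
  congr 2
  exact_mod_cast RCLike.norm_natCast (K := 𝕜) (n + 1)

theorem hasDerivAt_seriesEval (hf : f ∈ polynomialGrowthSubalgebra 𝕜) (hz : ‖z‖ < 1) :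
    HasDerivAt (fun z => seriesEval z f) (seriesEval z (PowerSeries.derivative 𝕜 f)) z := by
  obtain ⟨r, hzr, hr⟩ := exists_between hz
  have hmem : z ∈ Metric.ball 0 r := mem_ball_zero_iff.2 hzr
  rw [← (hasSum_coeff_derivative_mul_pow hf hz).tsum_eq]
  refine hasDerivAt_tsum_of_isPreconnected
    (summable_norm_coeff_mul_natCast_mul_pow hf ((norm_nonneg z).trans hzr.le) hr)
    Metric.isOpen_ball (convex_ball (0 : 𝕜) r).isPreconnected
    (fun n y _ => (hasDerivAt_pow n y).const_mul _) (fun n y hy => ?_) hmem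
    (summable_coeff_mul_pow hf hz) hmem
  have hy : ‖y‖ ≤ r := (mem_ball_zero_iff.1 hy).le
  rw [norm_mul, norm_mul, norm_pow, RCLike.norm_natCast]
  gcongr

end RCLike

end PolynomialGrowth

/-! ### Generating series of iterated integrals -/

section Euler

variable {K : Type*} [Field K]

variable (K) in
/-- The derivation `t d/dt` of power series in `t`. -/
def eulerDerivation : Derivation K (PowerSeries K) (PowerSeries K) :=
  (PowerSeries.X : PowerSeries K) • PowerSeries.derivative K

theorem coeff_eulerDerivation (f : PowerSeries K) (n : ℕ) :
    PowerSeries.coeff n (eulerDerivation K f) = n * PowerSeries.coeff n f := by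
  cases n with
  | zero => simp [eulerDerivation]
  | succ n =>
    rw [eulerDerivation, Derivation.smul_apply, smul_eq_mul, PowerSeries.coeff_succ_X_mul,
      PowerSeries.coeff_derivative, mul_comm, Nat.cast_succ]

/-- The operator dividing the coefficient of `t ^ n` by `n`, an inverse of `t d/dt` on series
without constant term. -/
def logIntegral (f : PowerSeries K) : PowerSeries K :=
  PowerSeries.mk fun n => PowerSeries.coeff n f / n

theorem coeff_logIntegral (f : PowerSeries K) (n : ℕ) :
    PowerSeries.coeff n (logIntegral f) = PowerSeries.coeff n f / n :=
  PowerSeries.coeff_mk n _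

theorem constantCoeff_logIntegral (f : PowerSeries K) :
    PowerSeries.constantCoeff (logIntegral f) = 0 := by
  rw [← PowerSeries.coeff_zero_eq_constantCoeff_apply, coeff_logIntegral, Nat.cast_zero, div_zero]

variable [CharZero K]

theorem eulerDerivation_logIntegral {f : PowerSeries K} (hf : PowerSeries.constantCoeff f = 0) :
    eulerDerivation K (logIntegral f) = f := by
  ext n
  rw [coeff_eulerDerivation, coeff_logIntegral]
  rcases eq_or_ne n 0 with rfl | hn
  · simpa using hf.symm
  · exact mul_div_cancel₀ _ (Nat.cast_ne_zero.2 hn)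

theorem eq_of_eulerDerivation_eq {f g : PowerSeries K}
    (h : eulerDerivation K f = eulerDerivation K g)
    (h₀ : PowerSeries.constantCoeff f = PowerSeries.constantCoeff g) : f = g := by
  ext n
  rcases eq_or_ne n 0 with rfl | hn
  · simpa using h₀
  · have hcoeff := congrArg (PowerSeries.coeff n) h
    rw [coeff_eulerDerivation, coeff_eulerDerivation] at hcoeff
    exact mul_left_cancel₀ (Nat.cast_ne_zero.2 hn) hcoeff

end Euler

theorem logIntegral_mem_polynomialGrowthSubalgebra {𝕜 : Type*} [RCLike 𝕜] {f : PowerSeries 𝕜}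
    (hf : f ∈ polynomialGrowthSubalgebra 𝕜) : logIntegral f ∈ polynomialGrowthSubalgebra 𝕜 := by
  obtain ⟨C, k, hf⟩ := hf
  refine ⟨C, k, fun n => le_trans ?_ (hf n)⟩
  rw [coeff_logIntegral, norm_div, RCLike.norm_natCast]
  rcases Nat.eq_zero_or_pos n with rfl | hn
  · simp
  · exact div_le_self (norm_nonneg _) (by exact_mod_cast hn)

section IteratedSeries

variable (Γ : Subgroup ℂˣ)

/-- The expansion at `t = 0` of `t ω_a(t) / dt`. -/
def letterSeries : XLetter Γ → PowerSeries ℂ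
  | none => 1
  | some σ => PowerSeries.mk fun n => if n = 0 then 0 else ((σ : ℂˣ) : ℂ) ^ n

theorem letterSeries_zero : letterSeries Γ 0 = 1 := rfl

theorem coeff_letterSeries_coe (σ : Γ) (n : ℕ) :
    PowerSeries.coeff n (letterSeries Γ (σ : XLetter Γ)) =
      if n = 0 then 0 else ((σ : ℂˣ) : ℂ) ^ n :=
  PowerSeries.coeff_mk n fun n => if n = 0 then 0 else ((σ : ℂˣ) : ℂ) ^ n

theorem constantCoeff_letterSeries_coe (σ : Γ) :
    PowerSeries.constantCoeff (letterSeries Γ (σ : XLetter Γ)) = 0 := by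
  rw [← PowerSeries.coeff_zero_eq_constantCoeff_apply, coeff_letterSeries_coe, if_pos rfl]

open Classical in
/-- The expansion at `t = 0` of the iterated integral of a word from `0` to `t`, regularized so
that the integral of `dt / t` is `log t`, and evaluated at `log t = 0`: deleting a last letter
`x_0` is minus the derivative with respect to `log t`. -/
def iteratedSeries : List (XLetter Γ) → PowerSeries ℂ
  | [] => 1
  | a :: w => logIntegral (letterSeries Γ a * iteratedSeries w -
      if (a :: w).getLast? = some 0 then iteratedSeries (a :: w).dropLast else 0)
termination_by w => w.length

theorem iteratedSeries_nil : iteratedSeries Γ [] = 1 := by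
  rw [iteratedSeries]

theorem constantCoeff_iteratedSeries {w : List (XLetter Γ)} (hw : w ≠ []) :
    PowerSeries.constantCoeff (iteratedSeries Γ w) = 0 := by
  obtain ⟨a, w, rfl⟩ := List.exists_cons_of_ne_nil hw
  rw [iteratedSeries, constantCoeff_logIntegral]

/-- The part of `t d/dt` of the iterated integral of a word coming from its first letter. -/
def frontSeries : List (XLetter Γ) → PowerSeries ℂ
  | [] => 0
  | a :: w => letterSeries Γ a * iteratedSeries Γ w

open Classical in
/-- The part of `t d/dt` of the iterated integral of a word coming from its last letter. -/
def backSeries (w : List (XLetter Γ)) : PowerSeries ℂ :=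
  if w.getLast? = some 0 then iteratedSeries Γ w.dropLast else 0

open Classical in
theorem backSeries_concat (w : List (XLetter Γ)) (a : XLetter Γ) :
    backSeries Γ (w ++ [a]) = if a = 0 then iteratedSeries Γ w else 0 := by
  simp [backSeries]

theorem constantCoeff_frontSeries (w : List (XLetter Γ)) :
    PowerSeries.constantCoeff (frontSeries Γ w) = PowerSeries.constantCoeff (backSeries Γ w) := by
  match w with
  | [] => simp [frontSeries, backSeries]
  | [a] =>
    rw [← List.nil_append [a], backSeries_concat, List.nil_append, frontSeries, map_mul,
      iteratedSeries_nil, map_one, mul_one]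
    rcases eq_or_ne a 0 with rfl | ha
    · rw [if_pos rfl, letterSeries_zero]
    · obtain ⟨σ, rfl⟩ := WithZero.ne_zero_iff_exists.1 ha
      rw [if_neg ha, constantCoeff_letterSeries_coe, map_zero]
  | a :: b :: w =>
    rw [frontSeries, map_mul, constantCoeff_iteratedSeries Γ (List.cons_ne_nil b w), mul_zero,
      backSeries]
    split_ifs
    · rw [constantCoeff_iteratedSeries Γ (by simp)]
    · rw [map_zero]

theorem eulerDerivation_iteratedSeries (w : List (XLetter Γ)) :
    eulerDerivation ℂ (iteratedSeries Γ w) = frontSeries Γ w - backSeries Γ w := by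
  cases w with
  | nil => simp [iteratedSeries_nil, frontSeries, backSeries]
  | cons a w =>
    rw [iteratedSeries]
    refine eulerDerivation_logIntegral ?_
    rw [map_sub, sub_eq_zero]
    exact constantCoeff_frontSeries Γ (a :: w)

section Shuffle

variable {u v : List (XLetter Γ)}

theorem quasiShuffleSum_frontSeries (hu : u ≠ []) (hv : v ≠ [])
    (h : ∀ u' v', u'.length + v'.length < u.length + v.length →
      quasiShuffleSum noMerge (iteratedSeries Γ) u' v' =
        iteratedSeries Γ u' * iteratedSeries Γ v') :
    quasiShuffleSum noMerge (frontSeries Γ) u v =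
      frontSeries Γ u * iteratedSeries Γ v + iteratedSeries Γ u * frontSeries Γ v := by
  obtain ⟨a, u, rfl⟩ := List.exists_cons_of_ne_nil hu
  obtain ⟨b, v, rfl⟩ := List.exists_cons_of_ne_nil hv
  rw [quasiShuffleSum_noMerge_cons_cons]
  simp only [frontSeries, quasiShuffleSum_const_mul]
  rw [h u (b :: v) (by simp), h (a :: u) v (by simp)]
  ring

theorem quasiShuffleSum_backSeries (hu : u ≠ []) (hv : v ≠ [])
    (h : ∀ u' v', u'.length + v'.length < u.length + v.length →
      quasiShuffleSum noMerge (iteratedSeries Γ) u' v' =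
        iteratedSeries Γ u' * iteratedSeries Γ v') :
    quasiShuffleSum noMerge (backSeries Γ) u v =
      backSeries Γ u * iteratedSeries Γ v + iteratedSeries Γ u * backSeries Γ v := by
  obtain ⟨u, a, rfl⟩ := (List.eq_nil_or_concat u).resolve_left hu
  obtain ⟨v, b, rfl⟩ := (List.eq_nil_or_concat v).resolve_left hv
  simp only [List.concat_eq_append] at h ⊢
  rw [quasiShuffleSum_noMerge_concat_concat]
  simp only [backSeries_concat]
  congr 1
  · split_ifs
    · exact h u (v ++ [b]) (by simp)
    · rw [quasiShuffleSum_zero, zero_mul]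
  · split_ifs
    · exact h (u ++ [a]) v (by simp)
    · rw [quasiShuffleSum_zero, mul_zero]

theorem constantCoeff_quasiShuffleSum_iteratedSeries (hu : u ≠ []) (hv : v ≠ []) :
    PowerSeries.constantCoeff (quasiShuffleSum noMerge (iteratedSeries Γ) u v) = 0 := by
  obtain ⟨a, u, rfl⟩ := List.exists_cons_of_ne_nil hu
  obtain ⟨b, v, rfl⟩ := List.exists_cons_of_ne_nil hv
  rw [map_quasiShuffleSum, quasiShuffleSum_noMerge_cons_cons]
  simp [constantCoeff_iteratedSeries]

theorem quasiShuffleSum_iteratedSeries (u v : List (XLetter Γ)) :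
    quasiShuffleSum noMerge (iteratedSeries Γ) u v =
      iteratedSeries Γ u * iteratedSeries Γ v := by
  rcases eq_or_ne u [] with rfl | hu
  · rw [quasiShuffleSum_nil_left, iteratedSeries_nil, one_mul]
  rcases eq_or_ne v [] with rfl | hv
  · rw [quasiShuffleSum_nil_right, iteratedSeries_nil, mul_one]
  have ih : ∀ u' v' : List (XLetter Γ), u'.length + v'.length < u.length + v.length →
      quasiShuffleSum noMerge (iteratedSeries Γ) u' v' =
        iteratedSeries Γ u' * iteratedSeries Γ v' :=
    fun u' v' _ => quasiShuffleSum_iteratedSeries u' v'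
  refine eq_of_eulerDerivation_eq ?_ ?_
  · have hsplit := quasiShuffleSum_add (m := noMerge)
      (fun w => frontSeries Γ w - backSeries Γ w) (backSeries Γ) u v
    simp only [sub_add_cancel] at hsplit
    rw [map_quasiShuffleSum, Derivation.leibniz, smul_eq_mul, smul_eq_mul]
    simp only [eulerDerivation_iteratedSeries]
    linear_combination quasiShuffleSum_frontSeries Γ hu hv ih -
      quasiShuffleSum_backSeries Γ hu hv ih - hsplit
  · rw [constantCoeff_quasiShuffleSum_iteratedSeries Γ hu hv, map_mul,
      constantCoeff_iteratedSeries Γ hu, zero_mul]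
termination_by u.length + v.length

theorem isQuasiShuffleChar_iteratedSeries : IsQuasiShuffleChar noMerge (iteratedSeries Γ) :=
  ⟨iteratedSeries_nil Γ, quasiShuffleSum_iteratedSeries Γ⟩

end Shuffle

section Growth

variable [Finite Γ]

theorem letterSeries_mem_polynomialGrowthSubalgebra (a : XLetter Γ) :
    letterSeries Γ a ∈ polynomialGrowthSubalgebra ℂ := by
  cases a with
  | none => exact one_mem (polynomialGrowthSubalgebra ℂ)
  | some σ =>
    refine mk_mem_polynomialGrowthSubalgebra_of_norm_le (𝕜 := ℂ) (C := 1) fun n => ?_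
    split_ifs
    · simp
    · rw [norm_pow, norm_coe_subgroup, one_pow]

theorem iteratedSeries_mem_polynomialGrowthSubalgebra (w : List (XLetter Γ)) :
    iteratedSeries Γ w ∈ polynomialGrowthSubalgebra ℂ := by
  cases w with
  | nil => exact iteratedSeries_nil Γ ▸ one_mem _
  | cons a w =>
    rw [iteratedSeries]
    refine logIntegral_mem_polynomialGrowthSubalgebra (sub_mem (mul_mem
      (letterSeries_mem_polynomialGrowthSubalgebra Γ a)
      (iteratedSeries_mem_polynomialGrowthSubalgebra w)) ?_)
    split_ifs
    · exact iteratedSeries_mem_polynomialGrowthSubalgebra (a :: w).dropLast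
    · exact zero_mem _
termination_by w.length

end Growth

/-! ### Words in the two alphabets -/

/-- The word `x_0^{s_1 - 1} x_{σ_1} ⋯ x_0^{s_r - 1} x_{σ_r}`. -/
def xWord : List (YLetter Γ) → List (XLetter Γ)
  | [] => []
  | y :: l => List.replicate ((y.1 : ℕ) - 1) 0 ++ (y.2 : XLetter Γ) :: xWord l

/-- The word with the letters `y_{s_i, σ_i σ_{i-1}⁻¹}`, where `σ_0 = p`. -/
def relativeRatios : Γ → List (YLetter Γ) → List (YLetter Γ)
  | _, [] => []
  | p, y :: l => (y.1, y.2 * p⁻¹) :: relativeRatios y.2 l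

theorem xWord_replicate_one (n : ℕ) :
    xWord Γ (List.replicate n (1, 1)) = List.replicate n 1 := by
  induction n with
  | zero => rfl
  | succ n ih => rw [List.replicate_succ, xWord, ih]; rfl

theorem relativeRatios_replicate_one (n : ℕ) :
    relativeRatios Γ 1 (List.replicate n (1, 1)) = List.replicate n (1, 1) := by
  induction n with
  | zero => rfl
  | succ n ih => simp [List.replicate_succ, relativeRatios, ih]

theorem getLast?_append_coe_cons_xWord_ne (u : List (XLetter Γ)) (σ : Γ) (l : List (YLetter Γ)) :
    (u ++ (σ : XLetter Γ) :: xWord Γ l).getLast? ≠ some 0 := by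
  induction l generalizing u σ with
  | nil => simp [xWord]
  | cons y l ih =>
    rw [xWord, ← List.cons_append, ← List.append_assoc]
    exact ih _ _

theorem exists_xWord_eq {w : List (XLetter Γ)} (hw : w.getLast? ≠ some 0) :
    ∃ l, xWord Γ l = w := by
  induction w with
  | nil => exact ⟨[], rfl⟩
  | cons a w ih =>
    have hw' : w.getLast? ≠ some 0 := by
      rcases List.eq_nil_or_concat w with rfl | ⟨w', c, rfl⟩
      · simp
      · simpa [List.getLast?_cons] using hw
    obtain ⟨l, rfl⟩ := ih hw'
    rcases eq_or_ne a 0 with rfl | ha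
    · cases l with
      | nil => simp [xWord] at hw
      | cons y l =>
        have hy : ((y.1 + 1 : ℕ+) : ℕ) - 1 = (y.1 : ℕ) - 1 + 1 := by
          have := y.1.pos
          rw [PNat.add_coe, PNat.one_coe]
          lia
        exact ⟨(y.1 + 1, y.2) :: l, by
          rw [xWord, xWord, hy, List.replicate_succ, List.cons_append]⟩
    · obtain ⟨σ, rfl⟩ := WithZero.ne_zero_iff_exists.1 ha
      exact ⟨(1, σ) :: l, rfl⟩

/-! ### Iterated integrals as generating series of truncated sums -/

theorem coeff_iteratedSeries_zero_cons {w : List (XLetter Γ)}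
    (hw : ((0 : XLetter Γ) :: w).getLast? ≠ some 0) (n : ℕ) :
    PowerSeries.coeff n (iteratedSeries Γ (0 :: w)) =
      PowerSeries.coeff n (iteratedSeries Γ w) / n := by
  rw [iteratedSeries, if_neg hw, sub_zero, letterSeries_zero, one_mul, coeff_logIntegral]

theorem coeff_iteratedSeries_coe_cons (σ : Γ) {w : List (XLetter Γ)}
    (hw : ((σ : XLetter Γ) :: w).getLast? ≠ some 0) (k : ℕ) :
    PowerSeries.coeff (k + 1) (iteratedSeries Γ (σ :: w)) =
      (∑ m ∈ Finset.range (k + 1), PowerSeries.coeff m (iteratedSeries Γ w) *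
        ((σ : ℂˣ) : ℂ) ^ (k + 1 - m)) / ((k : ℂ) + 1) := by
  rw [iteratedSeries, if_neg hw, sub_zero, mul_comm, coeff_logIntegral, PowerSeries.coeff_mul,
    Finset.Nat.sum_antidiagonal_eq_sum_range_succ_mk, Finset.sum_range_succ]
  simp only [coeff_letterSeries_coe, Nat.sub_self, if_true, mul_zero, add_zero, Nat.cast_succ]
  congr 1
  refine Finset.sum_congr rfl fun m hm => ?_
  rw [if_neg (Nat.sub_ne_zero_of_lt (Finset.mem_range.1 hm))]

theorem coeff_iteratedSeries_replicate_append (j : ℕ) (σ : Γ) (l : List (YLetter Γ)) (n : ℕ) :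
    PowerSeries.coeff n (iteratedSeries Γ (List.replicate j 0 ++ (σ : XLetter Γ) :: xWord Γ l)) =
      PowerSeries.coeff n (iteratedSeries Γ ((σ : XLetter Γ) :: xWord Γ l)) / (n : ℂ) ^ j := by
  induction j with
  | zero => simp
  | succ j ih =>
    rw [List.replicate_succ, List.cons_append, coeff_iteratedSeries_zero_cons, ih, div_div,
      pow_succ]
    exact getLast?_append_coe_cons_xWord_ne Γ (0 :: List.replicate j 0) σ l

theorem coeff_iteratedSeries_xWord_cons_eq_sum (y : YLetter Γ) (l : List (YLetter Γ)) (k : ℕ) :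
    PowerSeries.coeff (k + 1) (iteratedSeries Γ (xWord Γ (y :: l))) =
      (∑ m ∈ Finset.range (k + 1), PowerSeries.coeff m (iteratedSeries Γ (xWord Γ l)) *
        ((y.2 : ℂˣ) : ℂ) ^ (k + 1 - m)) / ((k : ℂ) + 1) ^ (y.1 : ℕ) := by
  rw [xWord, coeff_iteratedSeries_replicate_append, coeff_iteratedSeries_coe_cons Γ _
    (getLast?_append_coe_cons_xWord_ne Γ [] y.2 l), div_div, Nat.cast_succ,
    mul_pow_sub_one y.1.pos.ne']

theorem sum_coeff_iteratedSeries_xWord (σ : Γ) (l : List (YLetter Γ)) (k : ℕ) :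
    ∑ m ∈ Finset.range (k + 1), PowerSeries.coeff m (iteratedSeries Γ (xWord Γ l)) *
        ((σ : ℂˣ) : ℂ) ^ (k + 1 - m) =
      ((σ : ℂˣ) : ℂ) ^ (k + 1) * truncatedSum Γ (relativeRatios Γ σ l) k := by
  induction l generalizing σ k with
  | nil =>
    rw [Finset.sum_range_succ', Finset.sum_eq_zero fun m _ => by
      rw [xWord, iteratedSeries_nil, PowerSeries.coeff_one, if_neg m.succ_ne_zero, zero_mul]]
    simp [xWord, iteratedSeries_nil, relativeRatios, truncatedSum, nestedSum_nil]
  | cons z l ih =>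
    rw [Finset.sum_range_succ', PowerSeries.coeff_zero_eq_constantCoeff_apply,
      constantCoeff_iteratedSeries Γ (by simp [xWord]), zero_mul, add_zero, relativeRatios,
      truncatedSum, nestedSum_cons, Finset.mul_sum]
    refine Finset.sum_congr rfl fun m hm => ?_
    have hpow : ((σ : ℂˣ) : ℂ) ^ (k + 1) =
        ((σ : ℂˣ) : ℂ) ^ (k + 1 - (m + 1)) * ((σ : ℂˣ) : ℂ) ^ (m + 1) := by
      rw [← pow_add, Nat.sub_add_cancel (Nat.succ_le_succ (Finset.mem_range.1 hm).le)]
    have hσ : ((σ : ℂˣ) : ℂ) ≠ 0 := Units.ne_zero _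
    rw [coeff_iteratedSeries_xWord_cons_eq_sum, ih, hpow, ← truncatedSum]
    simp only [letterTerm, Subgroup.coe_mul, Subgroup.coe_inv, Units.val_mul,
      Units.val_inv_eq_inv_val, mul_pow, inv_pow]
    field_simp

theorem coeff_iteratedSeries_xWord_cons (y : YLetter Γ) (l : List (YLetter Γ)) (k : ℕ) :
    PowerSeries.coeff (k + 1) (iteratedSeries Γ (xWord Γ (y :: l))) =
      letterTerm Γ y k * truncatedSum Γ (relativeRatios Γ y.2 l) k := by
  rw [coeff_iteratedSeries_xWord_cons_eq_sum, sum_coeff_iteratedSeries_xWord, mul_div_right_comm,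
    letterTerm]

theorem one_sub_X_mul_mk_truncatedSum (l : List (YLetter Γ)) :
    (1 - PowerSeries.X) * PowerSeries.mk (truncatedSum Γ (relativeRatios Γ 1 l)) =
      iteratedSeries Γ (xWord Γ l) := by
  ext n
  rw [sub_mul, one_mul, map_sub]
  cases n with
  | zero =>
    cases l <;> simp [xWord, relativeRatios, truncatedSum, nestedSum_nil, nestedSum_cons_zero,
      iteratedSeries_nil, constantCoeff_iteratedSeries]
  | succ n =>
    rw [PowerSeries.coeff_succ_X_mul, PowerSeries.coeff_mk, PowerSeries.coeff_mk]
    cases l with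
    | nil => simp [xWord, relativeRatios, truncatedSum, nestedSum_nil, iteratedSeries_nil]
    | cons y l =>
      rw [coeff_iteratedSeries_xWord_cons, relativeRatios, truncatedSum_cons_succ,
        add_sub_cancel_left, inv_one, mul_one]

theorem iteratedSeries_singleton_zero : iteratedSeries Γ [0] = 0 := by
  ext n
  rw [iteratedSeries, List.getLast?_singleton, if_pos rfl, List.dropLast_singleton,
    letterSeries_zero, iteratedSeries_nil, mul_one, sub_self, coeff_logIntegral, map_zero, zero_div]

theorem coeff_iteratedSeries_singleton_one (n : ℕ) :
    PowerSeries.coeff n (iteratedSeries Γ [1]) = 1 / n := by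
  cases n with
  | zero => simp [constantCoeff_iteratedSeries]
  | succ n =>
    rw [show [1] = xWord Γ [(1, 1)] from rfl, coeff_iteratedSeries_xWord_cons]
    simp [letterTerm, relativeRatios, truncatedSum, nestedSum_nil]

theorem mk_truncatedSum_mem_polynomialGrowthSubalgebra [Finite Γ] (w : List (YLetter Γ)) :
    PowerSeries.mk (truncatedSum Γ w) ∈ polynomialGrowthSubalgebra ℂ := by
  obtain ⟨C, hC⟩ := exists_norm_truncatedSum_le Γ w
  have hC₀ : 0 ≤ C := (norm_nonneg _).trans (by simpa using hC 0)
  refine ⟨C, 1, fun n => ?_⟩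
  rw [PowerSeries.coeff_mk, pow_one]
  refine (hC n).trans (mul_le_mul_of_nonneg_left ?_ hC₀)
  have hn : 1 ≤ (n : ℝ) + 1 := by simp
  exact Real.sqrt_le_iff.2 ⟨by positivity, le_self_pow₀ hn two_ne_zero⟩

end IteratedSeries

/-! ### Abel means -/

section AbelMean

instance nonempty_Ioo_zero_one : Nonempty (Set.Ioo (0 : ℝ) 1) :=
  Set.nonempty_Ioo_subtype zero_lt_one

/-- The scale `-log (1 - t)` for the behaviour of iterated integrals as `t` tends to `1` from
below. That limit is encoded as `atTop` on the interval `(0, 1)`. -/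
def logScale (t : Set.Ioo (0 : ℝ) 1) : ℂ :=
  ((-Real.log (1 - t) : ℝ) : ℂ)

theorem norm_coe_Ioo_zero_one_lt_one (t : Set.Ioo (0 : ℝ) 1) : ‖((t : ℝ) : ℂ)‖ < 1 := by
  rw [Complex.norm_real, Real.norm_of_nonneg t.2.1.le]
  exact t.2.2

theorem norm_logScale (t : Set.Ioo (0 : ℝ) 1) : ‖logScale t‖ = -Real.log (1 - t) := by
  rw [logScale, Complex.norm_real, Real.norm_of_nonneg]
  exact neg_nonneg.2 (Real.log_nonpos (sub_nonneg.2 t.2.2.le) (sub_le_self 1 t.2.1.le))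

theorem exp_neg_norm_logScale (t : Set.Ioo (0 : ℝ) 1) : Real.exp (-‖logScale t‖) = 1 - t := by
  rw [norm_logScale, neg_neg, Real.exp_log (sub_pos.2 t.2.2)]

theorem tendsto_norm_logScale : Tendsto (fun t => ‖logScale t‖) atTop atTop := by
  simp only [norm_logScale]
  refine (tendsto_comp_coe_Ioo_atTop (f := fun t : ℝ => -Real.log (1 - t)) zero_lt_one).2 ?_
  refine tendsto_neg_atBot_atTop.comp (Real.tendsto_log_nhdsGT_zero.comp ?_)
  refine tendsto_nhdsWithin_iff.2 ⟨?_,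
    eventually_mem_nhdsWithin.mono fun t ht => Set.mem_Ioi.2 (sub_pos.2 ht)⟩
  have hlim : Tendsto (fun t : ℝ => 1 - t) (𝓝 1) (𝓝 (1 - 1)) := tendsto_const_nhds.sub tendsto_id
  rw [sub_self] at hlim
  exact hlim.mono_left nhdsWithin_le_nhds

/-- The Abel mean `(1 - t) ∑ f(n) t^n` of a sequence. -/
def abelMean (f : ℕ → ℂ) (t : Set.Ioo (0 : ℝ) 1) : ℂ :=
  ((1 - t : ℝ) : ℂ) * seriesEval ((t : ℝ) : ℂ) (PowerSeries.mk f)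

variable {f g : ℕ → ℂ}

theorem abelMean_add (hf : PowerSeries.mk f ∈ polynomialGrowthSubalgebra ℂ)
    (hg : PowerSeries.mk g ∈ polynomialGrowthSubalgebra ℂ) (t : Set.Ioo (0 : ℝ) 1) :
    abelMean (fun n => f n + g n) t = abelMean f t + abelMean g t := by
  simp only [abelMean, ← mul_add]
  rw [← seriesEval_add hf hg (norm_coe_Ioo_zero_one_lt_one t)]
  rfl

theorem abelMean_const_mul (c : ℂ) (f : ℕ → ℂ) (t : Set.Ioo (0 : ℝ) 1) :
    abelMean (fun n => c * f n) t = c * abelMean f t := by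
  rw [abelMean, abelMean, mul_left_comm, seriesEval, seriesEval, ← tsum_mul_left (a := c)]
  simp only [PowerSeries.coeff_mk, mul_assoc]

theorem norm_abelMean_le {C δ : ℝ} {N : ℕ} (hC : ∀ n, ‖f n‖ ≤ C)
    (hδ : ∀ n, N ≤ n → ‖f n‖ ≤ δ) (t : Set.Ioo (0 : ℝ) 1) :
    ‖abelMean f t‖ ≤ C * N * (1 - t) + δ := by
  have ht0 : (0 : ℝ) ≤ t := t.2.1.le
  have ht : (0 : ℝ) < 1 - t := sub_pos.2 t.2.2
  have hδ0 : 0 ≤ δ := (norm_nonneg _).trans (hδ N le_rfl)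
  have hsum : HasSum (fun n => (if n ∈ Finset.range N then C else 0) + δ * (t : ℝ) ^ n)
      ((∑ n ∈ Finset.range N, if n ∈ Finset.range N then C else 0) + δ * (1 - (t : ℝ))⁻¹) :=
    (hasSum_sum_of_ne_finset_zero fun n hn => if_neg hn).add
      ((hasSum_geometric_of_lt_one ht0 t.2.2).mul_left δ)
  rw [Finset.sum_congr rfl fun n hn => if_pos hn, Finset.sum_const, Finset.card_range,
    nsmul_eq_mul] at hsum
  have hbound : ‖seriesEval ((t : ℝ) : ℂ) (PowerSeries.mk f)‖ ≤ N * C + δ * (1 - (t : ℝ))⁻¹ := by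
    refine tsum_of_norm_bounded hsum fun n => ?_
    rw [PowerSeries.coeff_mk, norm_mul, norm_pow, Complex.norm_real, Real.norm_of_nonneg ht0]
    split_ifs with hn
    · refine le_add_of_le_of_nonneg ?_ (by positivity)
      exact (mul_le_of_le_one_right (norm_nonneg _) (pow_le_one₀ ht0 t.2.2.le)).trans (hC n)
    · rw [zero_add]
      gcongr
      exact hδ n (by simpa using hn)
  rw [abelMean, norm_mul, Complex.norm_real, Real.norm_of_nonneg ht.le]
  calc (1 - (t : ℝ)) * ‖seriesEval ((t : ℝ) : ℂ) (PowerSeries.mk f)‖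
      ≤ (1 - t) * (N * C + δ * (1 - (t : ℝ))⁻¹) := by gcongr
    _ = C * N * (1 - t) + δ := by field_simp

theorem le_harmonic_of_exp_le {x : ℝ} {n : ℕ} (hx : Real.exp x ≤ n) : x ≤ harmonic n := by
  refine le_trans ?_ (log_add_one_le_harmonic n)
  rw [Real.le_log_iff_exp_le (by positivity)]
  exact hx.trans (by simp)

/-- The terms with `n < exp (‖logScale t‖ / 2) = (1 - t)^(-1/2)` have total weight about
`(1 - t)^(1/2)` in the Abel mean, and all the others have `harmonic n ≥ ‖logScale t‖ / 2`. -/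
theorem norm_logScale_pow_mul_abelMean_le {j : ℕ} {C D : ℝ} (hC : ∀ n, ‖f n‖ ≤ C)
    (hD : ∀ n, ‖harmonicScale n ^ j * f n‖ ≤ D) (t : Set.Ioo (0 : ℝ) 1) :
    ‖logScale t ^ j * abelMean f t‖ ≤ 2 ^ j * (2 * C * j.factorial + D) := by
  set L := ‖logScale t‖
  have hL : 0 ≤ L := norm_nonneg _
  have hC0 : 0 ≤ C := (norm_nonneg _).trans (hC 0)
  set N := ⌈Real.exp (L / 2)⌉₊
  have hhead : ∀ n, ‖logScale t ^ j * f n‖ ≤ L ^ j * C := fun n => by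
    rw [norm_mul, norm_pow]
    gcongr
    exact hC n
  have htail : ∀ n, N ≤ n → ‖logScale t ^ j * f n‖ ≤ 2 ^ j * D := fun n hn => by
    have hle : L / 2 ≤ harmonic n :=
      le_harmonic_of_exp_le ((Nat.le_ceil _).trans (Nat.cast_le.2 hn))
    have hDn := hD n
    rw [norm_mul, norm_pow, harmonicScale, Complex.norm_real,
      Real.norm_of_nonneg (harmonic_nonneg n)] at hDn
    calc ‖logScale t ^ j * f n‖ = 2 ^ j * ((L / 2) ^ j * ‖f n‖) := by
          rw [norm_mul, norm_pow, div_pow, ← mul_assoc, mul_div_cancel₀ _ (by positivity)]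
      _ ≤ 2 ^ j * ((harmonic n : ℝ) ^ j * ‖f n‖) := by gcongr
      _ ≤ 2 ^ j * D := by gcongr
  have hN : (N : ℝ) ≤ 2 * Real.exp (L / 2) := by
    linarith [(Nat.ceil_lt_add_one (Real.exp_pos (L / 2)).le).le,
      Real.one_le_exp (div_nonneg hL zero_le_two)]
  have hexp : (L / 2) ^ j ≤ j.factorial * Real.exp (L / 2) :=
    (div_le_iff₀' (by positivity)).1 (Real.pow_div_factorial_le_exp _ (by positivity) j)
  rw [← abelMean_const_mul]
  calc ‖abelMean (fun n => logScale t ^ j * f n) t‖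
      ≤ L ^ j * C * N * Real.exp (-L) + 2 ^ j * D := by
        rw [exp_neg_norm_logScale]
        exact norm_abelMean_le hhead htail t
    _ = 2 ^ j * ((L / 2) ^ j * C * N * Real.exp (-L) + D) := by
        rw [div_pow]
        field_simp
    _ ≤ 2 ^ j * (j.factorial * Real.exp (L / 2) * C * (2 * Real.exp (L / 2)) * Real.exp (-L)
          + D) := by gcongr
    _ = 2 ^ j * (2 * C * j.factorial * Real.exp (L / 2 + L / 2 + -L) + D) := by
        rw [Real.exp_add, Real.exp_add]
        ring
    _ = 2 ^ j * (2 * C * j.factorial + D) := by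
        rw [add_halves, add_neg_cancel, Real.exp_zero, mul_one]

theorem superpolynomialDecay_abelMean
    (hf : Asymptotics.SuperpolynomialDecay atTop harmonicScale f) :
    Asymptotics.SuperpolynomialDecay atTop logScale (abelMean f) := by
  have hbdd : ∀ j, ∃ C, ∀ n, ‖harmonicScale n ^ j * f n‖ ≤ C := fun j => by
    obtain ⟨C, hC⟩ := (Metric.isBounded_range_of_tendsto _ (hf j)).exists_norm_le
    exact ⟨C, fun n => hC _ ⟨n, rfl⟩⟩
  rw [Asymptotics.superpolynomialDecay_iff_superpolynomialDecay_norm,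
    Asymptotics.superpolynomialDecay_iff_abs_isBoundedUnder _ tendsto_norm_logScale]
  intro j
  obtain ⟨C, hC⟩ := hbdd 0
  obtain ⟨D, hD⟩ := hbdd j
  refine isBoundedUnder_of ⟨2 ^ j * (2 * C * j.factorial + D), fun t => ?_⟩
  rw [abs_of_nonneg (by positivity), ← norm_pow, ← norm_mul]
  exact norm_logScale_pow_mul_abelMean_le (by simpa using hC) hD t

end AbelMean

/-! ### Iterated integrals as Abel means of truncated sums -/

section IteratedValue

variable (Γ : Subgroup ℂˣ)

/-- The values on `(0, 1)` of the iterated integrals of words, regularized at `0`. -/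
def iteratedValue (w : List (XLetter Γ)) (t : Set.Ioo (0 : ℝ) 1) : ℂ :=
  seriesEval ((t : ℝ) : ℂ) (iteratedSeries Γ w)

theorem iteratedValue_singleton_zero : iteratedValue Γ [0] = 0 := by
  funext t
  simp [iteratedValue, iteratedSeries_singleton_zero, seriesEval]

theorem iteratedValue_singleton_one : iteratedValue Γ [1] = logScale := by
  funext t
  have ht : |(t : ℝ)| < 1 := by
    rw [abs_of_pos t.2.1]
    exact t.2.2
  have hsum := Complex.hasSum_ofReal.2 (Real.hasSum_pow_div_log_of_abs_lt_one ht)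
  refine HasSum.tsum_eq ((hasSum_nat_add_iff' 1).1 ?_)
  simpa [coeff_iteratedSeries_singleton_one, logScale, inv_mul_eq_div] using hsum

variable [Finite Γ]

theorem isQuasiShuffleChar_iteratedValue : IsQuasiShuffleChar noMerge (iteratedValue Γ) :=
  ((isQuasiShuffleChar_iteratedSeries Γ).codRestrict (polynomialGrowthSubalgebra ℂ)
    (iteratedSeries_mem_polynomialGrowthSubalgebra Γ)).comp
      (RingHom.pi fun t => (seriesEvalHom (norm_coe_Ioo_zero_one_lt_one t)).toRingHom)

theorem abelMean_truncatedSum_relativeRatios (l : List (YLetter Γ)) :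
    abelMean (truncatedSum Γ (relativeRatios Γ 1 l)) = iteratedValue Γ (xWord Γ l) := by
  funext t
  have ht := norm_coe_Ioo_zero_one_lt_one t
  have hX := X_mem_polynomialGrowthSubalgebra (𝕜 := ℂ)
  have hsub : seriesEval ((t : ℝ) : ℂ) (1 - PowerSeries.X) = ((1 - t : ℝ) : ℂ) := by
    have := map_sub (seriesEvalHom ht) 1 ⟨_, hX⟩
    rw [map_one, seriesEvalHom_apply, seriesEvalHom_apply, seriesEval_X] at this
    exact_mod_cast this
  rw [iteratedValue, ← one_sub_X_mul_mk_truncatedSum,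
    seriesEval_mul (sub_mem (one_mem _) hX) (mk_truncatedSum_mem_polynomialGrowthSubalgebra Γ _) ht,
    hsub, abelMean]

theorem abelMean_truncatedSum_replicate (n : ℕ) (t : Set.Ioo (0 : ℝ) 1) :
    abelMean (truncatedSum Γ (List.replicate n (1, 1))) t =
      (PowerSeries.coeff n expTu).eval (logScale t) := by
  have hpow := congrFun ((isQuasiShuffleChar_iteratedValue Γ).factorial_nsmul_replicate 1 n) t
  rw [iteratedValue_singleton_one, ← xWord_replicate_one, ← abelMean_truncatedSum_relativeRatios,
    relativeRatios_replicate_one, Pi.smul_apply, Pi.pow_apply, nsmul_eq_mul] at hpow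
  rw [coeff_expTu, Polynomial.eval_mul, Polynomial.eval_C, Polynomial.eval_pow, Polynomial.eval_X,
    ← hpow, inv_mul_cancel_left₀ (Nat.cast_ne_zero.2 n.factorial_ne_zero)]

end IteratedValue

/-! ### The generating series of the truncated sums of powers of `y_{1,1}` -/

section GeneratingSeries

theorem mk_nestedSum_replicate {A R : Type*} [CommSemiring R] (f : A → ℕ → R) (a : A) (M : ℕ) :
    (PowerSeries.mk fun n => nestedSum f (List.replicate n a) M) =
      ∏ k ∈ Finset.range M, (1 + PowerSeries.C (f a k) * PowerSeries.X) := by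
  induction M with
  | zero =>
    ext n
    cases n <;> simp [nestedSum_nil, List.replicate_succ, nestedSum_cons_zero]
  | succ M ih =>
    rw [Finset.prod_range_succ, ← ih, mul_add, mul_one, mul_left_comm]
    ext n
    cases n with
    | zero => simp [nestedSum_nil]
    | succ n => simp [List.replicate_succ, nestedSum_cons_succ, PowerSeries.coeff_succ_mul_X,
        ← mul_assoc]

variable {R : Type*} [CommRing R]

theorem derivative_mul_of_derivative_eq_mul {f g a b : PowerSeries R}
    (hf : PowerSeries.derivative R f = f * a) (hg : PowerSeries.derivative R g = g * b) :
    PowerSeries.derivative R (f * g) = f * g * (a + b) := by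
  rw [Derivation.leibniz, hf, hg, smul_eq_mul, smul_eq_mul]
  ring

theorem derivative_one_add_C_mul_X (c : R) :
    PowerSeries.derivative R (1 + PowerSeries.C c * PowerSeries.X) =
      (1 + PowerSeries.C c * PowerSeries.X) * PowerSeries.mk fun n => (-1) ^ n * c ^ (n + 1) := by
  rw [map_add, Derivation.map_one_eq_zero, zero_add, Derivation.leibniz, PowerSeries.derivative_C,
    PowerSeries.derivative_X, smul_zero, add_zero, smul_eq_mul, mul_one, add_mul, one_mul,
    mul_assoc]
  ext n
  cases n with
  | zero => simp
  | succ n =>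
    simp only [map_add, PowerSeries.coeff_mk, PowerSeries.coeff_C_mul,
      PowerSeries.coeff_succ_X_mul, PowerSeries.coeff_C, Nat.succ_ne_zero, if_false]
    ring

theorem derivative_prod_one_add_C_mul_X {ι : Type*} (s : Finset ι) (c : ι → R) :
    PowerSeries.derivative R (∏ i ∈ s, (1 + PowerSeries.C (c i) * PowerSeries.X)) =
      (∏ i ∈ s, (1 + PowerSeries.C (c i) * PowerSeries.X)) *
        PowerSeries.mk fun n => (-1) ^ n * ∑ i ∈ s, c i ^ (n + 1) := by
  classical
  induction s using Finset.induction_on with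
  | empty => simp [PowerSeries.ext_iff]
  | insert a s ha ih =>
    rw [Finset.prod_insert ha,
      derivative_mul_of_derivative_eq_mul (derivative_one_add_C_mul_X (c a)) ih]
    congr 1
    ext n
    simp only [map_add, PowerSeries.coeff_mk, Finset.sum_insert ha, mul_add]

theorem HasExpansion.coeff_of_derivative_eq_mul {α 𝕜 : Type*} {l : Filter α} {k : α → 𝕜}
    [Field 𝕜] [CharZero 𝕜] [TopologicalSpace 𝕜] [IsTopologicalRing 𝕜]
    {F G : α → PowerSeries 𝕜} {f g : PowerSeries (Polynomial 𝕜)}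
    (hF : ∀ x, PowerSeries.derivative 𝕜 (F x) = F x * G x)
    (hf : PowerSeries.derivative (Polynomial 𝕜) f = f * g)
    (hzero : HasExpansion l k (fun x => PowerSeries.coeff 0 (F x)) (PowerSeries.coeff 0 f))
    (hG : ∀ n, HasExpansion l k (fun x => PowerSeries.coeff n (G x)) (PowerSeries.coeff n g))
    (n : ℕ) : HasExpansion l k (fun x => PowerSeries.coeff n (F x)) (PowerSeries.coeff n f) := by
  induction n using Nat.strong_induction_on with
  | _ n ih =>
    rcases n with _ | n
    · exact hzero
    have hn : (n : 𝕜) + 1 ≠ 0 := n.cast_add_one_ne_zero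
    have hcoeff {R : Type _} [CommRing R] {φ ψ : PowerSeries R}
        (h : PowerSeries.derivative R φ = φ * ψ) :
        PowerSeries.coeff (n + 1) φ * (n + 1) = ∑ p ∈ Finset.HasAntidiagonal.antidiagonal n,
          PowerSeries.coeff p.1 φ * PowerSeries.coeff p.2 ψ := by
      rw [← PowerSeries.coeff_derivative, h, PowerSeries.coeff_mul]
    have hsum : HasExpansion l k (fun x => PowerSeries.coeff (n + 1) (F x) * (n + 1))
        (PowerSeries.coeff (n + 1) f * (n + 1)) := by
      rw [hcoeff hf]
      refine (HasExpansion.sum fun p hp => ?_).congr fun x => (hcoeff (hF x)).symm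
      have hp := Finset.HasAntidiagonal.antidiagonal.fst_le hp
      exact (ih p.1 (Nat.lt_succ_of_le hp)).mul (hG p.2)
    have hC : Polynomial.C ((n : 𝕜) + 1)⁻¹ * ((n : Polynomial 𝕜) + 1) = 1 := by
      rw [← map_natCast Polynomial.C, ← map_one Polynomial.C, ← map_add, ← map_mul,
        inv_mul_cancel₀ hn]
    have hdiv := (hsum.const_mul ((n : 𝕜) + 1)⁻¹).congr fun x => by
      rw [mul_left_comm, inv_mul_cancel₀ hn, mul_one]
    rwa [mul_left_comm, hC, mul_one] at hdiv

end GeneratingSeries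

/-! ### The map `ρ` -/

section Rho

/-- The logarithmic derivative of `seriesS`. -/
def zetaSeries : PowerSeries ℂ :=
  PowerSeries.mk fun n => if n = 0 then 0 else (-1) ^ n * riemannZeta ((n + 1 : ℕ) : ℂ)

theorem constantCoeff_log_seriesS : PowerSeries.constantCoeff (PowerSeries.mk fun n : ℕ =>
    if 2 ≤ n then (-1) ^ (n - 1) * riemannZeta n / (n : ℂ) else 0) = 0 := by
  simp [← PowerSeries.coeff_zero_eq_constantCoeff_apply]

theorem constantCoeff_seriesS : PowerSeries.constantCoeff seriesS = 1 := by
  refine (PowerSeries.constantCoeff_subst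
    (.of_constantCoeff_zero' constantCoeff_log_seriesS) (PowerSeries.exp ℂ)).trans ?_
  rw [finsum_eq_single _ 0]
  · simp
  · intro d hd
    change _ • PowerSeries.constantCoeff _ = _
    rw [map_pow, constantCoeff_log_seriesS, zero_pow hd, smul_zero]

theorem derivative_seriesS : PowerSeries.derivative ℂ seriesS = seriesS * zetaSeries := by
  rw [seriesS, PowerSeries.derivative_subst (.of_constantCoeff_zero' constantCoeff_log_seriesS),
    PowerSeries.derivative_exp]
  congr 1
  ext n
  rw [PowerSeries.coeff_derivative, PowerSeries.coeff_mk, zetaSeries, PowerSeries.coeff_mk]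
  rcases n with _ | n
  · simp
  · rw [if_pos (by lia), if_neg n.succ_ne_zero, Nat.add_sub_cancel, Nat.cast_add_one (n + 1),
      div_mul_cancel₀ _ (n + 1).cast_add_one_ne_zero]

/-- The series `S(u) e^{Tu}`, whose coefficients are the expansions in the harmonic numbers of the
truncated sums of powers of `y_{1,1}`. -/
def seriesSMulExpTu : PowerSeries (Polynomial ℂ) :=
  PowerSeries.map Polynomial.C seriesS * expTu

theorem map_seriesA_mul_seriesSMulExpTu :
    PowerSeries.map Polynomial.C seriesA * seriesSMulExpTu = expTu := by
  have hone : seriesA * seriesS = 1 :=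
    PowerSeries.inv_mul_cancel _ (constantCoeff_seriesS.trans_ne one_ne_zero)
  rw [seriesSMulExpTu, ← mul_assoc, ← map_mul, hone, map_one, one_mul]

theorem derivative_seriesSMulExpTu : PowerSeries.derivative (Polynomial ℂ) seriesSMulExpTu =
    seriesSMulExpTu *
      (PowerSeries.map Polynomial.C zetaSeries + PowerSeries.C Polynomial.X) := by
  have hS : PowerSeries.derivative (Polynomial ℂ) (PowerSeries.map Polynomial.C seriesS) =
      PowerSeries.map Polynomial.C seriesS * PowerSeries.map Polynomial.C zetaSeries := by
    rw [← map_mul, ← derivative_seriesS]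
    ext1 n
    simp only [PowerSeries.coeff_derivative, PowerSeries.coeff_map, map_mul, map_add, map_natCast,
      map_one]
  have hexp : PowerSeries.derivative (Polynomial ℂ) expTu = expTu * PowerSeries.C Polynomial.X := by
    ext1 n
    have hfac : Polynomial.C (((n + 1).factorial : ℂ)⁻¹) * (n + 1) =
        Polynomial.C ((n.factorial : ℂ)⁻¹) := by
      rw [← map_natCast Polynomial.C, ← map_one Polynomial.C, ← map_add, ← map_mul,
        Nat.factorial_succ, Nat.cast_mul, Nat.cast_add_one, mul_inv_rev, mul_assoc,
        inv_mul_cancel₀ n.cast_add_one_ne_zero, mul_one]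
    rw [PowerSeries.coeff_derivative, PowerSeries.coeff_mul_C, coeff_expTu, coeff_expTu, ← hfac]
    ring
  exact derivative_mul_of_derivative_eq_mul hS hexp

theorem rho_seriesSMulExpTu (n : ℕ) :
    rho (PowerSeries.coeff n seriesSMulExpTu) = PowerSeries.coeff n expTu := by
  simp only [seriesSMulExpTu]
  conv_rhs => rw [← map_seriesA_mul_seriesSMulExpTu, seriesSMulExpTu, mul_left_comm]
  simp only [PowerSeries.coeff_mul _ (PowerSeries.map _ seriesS), PowerSeries.coeff_map, map_sum,
    ← Polynomial.smul_eq_C_mul, map_smul, rho_expTu]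

theorem span_coeff_seriesSMulExpTu :
    Submodule.span ℂ (Set.range fun n => PowerSeries.coeff n seriesSMulExpTu) = ⊤ := by
  rw [← top_le_iff, ← (Polynomial.basisMonomials ℂ).span_eq, Submodule.span_le]
  rintro _ ⟨n, rfl⟩
  have hmonomial : Polynomial.basisMonomials ℂ n =
      (n.factorial : ℂ) • PowerSeries.coeff n expTu := by
    rw [Polynomial.coe_basisMonomials, coeff_expTu, Polynomial.smul_eq_C_mul, ← mul_assoc,
      ← Polynomial.C_mul, mul_inv_cancel₀ (Nat.cast_ne_zero.2 n.factorial_ne_zero),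
      Polynomial.C_mul_X_pow_eq_monomial]
  rw [hmonomial, ← map_seriesA_mul_seriesSMulExpTu, PowerSeries.coeff_mul]
  refine Submodule.smul_mem _ _ (Submodule.sum_mem _ fun p _ => ?_)
  rw [PowerSeries.coeff_map, ← Polynomial.smul_eq_C_mul]
  exact Submodule.smul_mem _ _ (Submodule.subset_span ⟨p.2, rfl⟩)

end Rho

/-! ### Abel means transform expansions by `ρ` -/

section AbelMeanExpansion

variable (Γ : Subgroup ℂˣ)

theorem truncatedSum_singleton_succPNat_one (n M : ℕ) :
    truncatedSum Γ [(n.succPNat, 1)] M =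
      ∑ k ∈ Finset.range M, letterTerm Γ (1, 1) k ^ (n + 1) := by
  simp [truncatedSum, nestedSum_cons, nestedSum_nil, letterTerm]

theorem tendsto_truncatedSum_singleton_zeta {n : ℕ} (hn : n ≠ 0) :
    Tendsto (truncatedSum Γ [(n.succPNat, 1)]) atTop (𝓝 (riemannZeta ((n + 1 : ℕ) : ℂ))) := by
  have hsummable : Summable fun k : ℕ => (1 : ℂ) / (k : ℂ) ^ (n + 1) := by
    simpa using Complex.summable_ofReal.2
      (Real.summable_one_div_nat_pow.2 (by lia : 1 < n + 1))
  have hsum := ((summable_nat_add_iff 1).2 hsummable).hasSum.tendsto_sum_nat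
  have hzeta : ∑' k : ℕ, (1 : ℂ) / ((k + 1 : ℕ) : ℂ) ^ (n + 1) =
      riemannZeta ((n + 1 : ℕ) : ℂ) := by
    rw [zeta_nat_eq_tsum_of_gt_one (by lia), hsummable.tsum_eq_zero_add]
    simp
  rw [hzeta] at hsum
  refine hsum.congr fun M => ?_
  simp [truncatedSum_singleton_succPNat_one, letterTerm]

variable [Finite Γ]

theorem hasExpansion_truncatedSum_singleton_zeta {n : ℕ} (hn : n ≠ 0) :
    HasExpansion atTop harmonicScale (truncatedSum Γ [(n.succPNat, 1)])
      (Polynomial.C (riemannZeta ((n + 1 : ℕ) : ℂ))) := by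
  have hhead : [((n.succPNat, 1) : YLetter Γ)].head? ≠ some (1, 1) := fun h =>
    hn (Nat.succPNat_injective (congrArg Prod.fst (Option.some_inj.1 h)))
  obtain ⟨l, hl⟩ := exists_hasExpansion_truncatedSum_of_head?_ne Γ hhead
  rwa [← tendsto_nhds_unique hl.tendsto (tendsto_truncatedSum_singleton_zeta Γ hn)]

theorem hasExpansion_truncatedSum_replicate_one (n : ℕ) :
    HasExpansion atTop harmonicScale (truncatedSum Γ (List.replicate n (1, 1)))
      (PowerSeries.coeff n seriesSMulExpTu) := by
  refine (HasExpansion.coeff_of_derivative_eq_mul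
    (F := fun M => ∏ k ∈ Finset.range M, (1 + PowerSeries.C (letterTerm Γ (1, 1) k) *
      PowerSeries.X)) (fun M => derivative_prod_one_add_C_mul_X _ _) derivative_seriesSMulExpTu
    ?_ (fun n => ?_) n).congr fun M => ?_
  · have hone : PowerSeries.coeff 0 seriesSMulExpTu = Polynomial.C 1 := by
      simp only [seriesSMulExpTu, PowerSeries.coeff_mul, Finset.HasAntidiagonal.antidiagonal_zero,
        Finset.sum_singleton, PowerSeries.coeff_map, coeff_expTu]
      simp [constantCoeff_seriesS]
    rw [hone]
    exact (hasExpansion_const 1).congr fun M => by simp [map_prod]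
  · simp only [PowerSeries.coeff_mk, map_add, PowerSeries.coeff_map, PowerSeries.coeff_C,
      ← truncatedSum_singleton_succPNat_one, zetaSeries]
    rcases eq_or_ne n 0 with rfl | hn
    · simpa [show Nat.succPNat 0 = 1 from rfl, truncatedSum_singleton_one] using
        hasExpansion_self
    · rw [if_neg hn, if_neg hn, add_zero, map_mul]
      exact (hasExpansion_truncatedSum_singleton_zeta Γ hn).const_mul _
  · rw [← mk_nestedSum_replicate, PowerSeries.coeff_mk, truncatedSum]

theorem mk_eval_harmonicScale_mem_polynomialGrowthSubalgebra (P : Polynomial ℂ) :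
    (PowerSeries.mk fun n => P.eval (harmonicScale n)) ∈ polynomialGrowthSubalgebra ℂ := by
  have hpow (j : ℕ) :
      (PowerSeries.mk fun n => harmonicScale n ^ j) ∈ polynomialGrowthSubalgebra ℂ := by
    obtain ⟨C, hC⟩ :=
      (Metric.isBounded_range_of_tendsto _ (tendsto_harmonic_pow_div_sqrt j)).exists_norm_le
    refine ⟨C, 1, fun n => ?_⟩
    have hn : (1 : ℝ) ≤ n + 1 := by simp
    have hle := (Real.le_norm_self _).trans (hC _ ⟨n, rfl⟩)
    rw [div_le_iff₀ (by positivity)] at hle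
    rw [PowerSeries.coeff_mk, norm_pow, harmonicScale, Complex.norm_real,
      Real.norm_of_nonneg (harmonic_nonneg n), pow_one]
    refine hle.trans (mul_le_mul_of_nonneg_left ?_ ((norm_nonneg _).trans (hC _ ⟨0, rfl⟩)))
    exact Real.sqrt_le_iff.2 ⟨by positivity, le_self_pow₀ hn two_ne_zero⟩
  have hsum : (PowerSeries.mk fun n => P.eval (harmonicScale n)) =
      ∑ j ∈ P.support, P.coeff j • PowerSeries.mk fun n => harmonicScale n ^ j := by
    ext n
    simp [Polynomial.eval_eq_sum, Polynomial.sum]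
  rw [hsum]
  exact sum_mem fun j _ => Subalgebra.smul_mem _ (hpow j) _

theorem HasExpansion.mk_mem_polynomialGrowthSubalgebra {f : ℕ → ℂ} {P : Polynomial ℂ}
    (hf : HasExpansion atTop harmonicScale f P) :
    PowerSeries.mk f ∈ polynomialGrowthSubalgebra ℂ := by
  obtain ⟨C, hC⟩ := (Metric.isBounded_range_of_tendsto _ (hf 0)).exists_norm_le
  have herror : (PowerSeries.mk fun n => f n - P.eval (harmonicScale n)) ∈
      polynomialGrowthSubalgebra ℂ :=
    mk_mem_polynomialGrowthSubalgebra_of_norm_le fun n => by simpa using hC _ ⟨n, rfl⟩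
  convert add_mem herror (mk_eval_harmonicScale_mem_polynomialGrowthSubalgebra P)
  ext n
  simp

theorem HasExpansion.abelMean_congr {f g : ℕ → ℂ} {P Q : Polynomial ℂ}
    (hf : HasExpansion atTop harmonicScale f P) (hg : HasExpansion atTop harmonicScale g P)
    (hQ : HasExpansion atTop logScale (abelMean f) Q) :
    HasExpansion atTop logScale (abelMean g) Q := by
  have hsub : HasExpansion atTop harmonicScale (fun n => g n + -1 * f n) 0 := by
    simpa using hg.add (hf.const_mul (-1))
  have hzero := hasExpansion_zero_iff.2
    (superpolynomialDecay_abelMean (hasExpansion_zero_iff.1 hsub))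
  have hadd := hQ.add hzero
  rw [add_zero] at hadd
  refine hadd.congr fun t => ?_
  rw [← abelMean_add hf.mk_mem_polynomialGrowthSubalgebra hsub.mk_mem_polynomialGrowthSubalgebra]
  simp

theorem HasExpansion.abelMean {f : ℕ → ℂ} {P : Polynomial ℂ}
    (hf : HasExpansion atTop harmonicScale f P) :
    HasExpansion atTop logScale (abelMean f) (rho P) := by
  have hP : P ∈ Submodule.span ℂ (Set.range fun n => PowerSeries.coeff n seriesSMulExpTu) :=
    span_coeff_seriesSMulExpTu ▸ Submodule.mem_top
  induction hP using Submodule.span_induction generalizing f with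
  | mem P hP =>
    obtain ⟨n, rfl⟩ := hP
    refine (hasExpansion_truncatedSum_replicate_one (⊥ : Subgroup ℂˣ) n).abelMean_congr hf ?_
    rw [rho_seriesSMulExpTu]
    exact (hasExpansion_eval _).congr fun t => (abelMean_truncatedSum_replicate _ n t).symm
  | zero =>
    rw [map_zero]
    exact hasExpansion_zero_iff.2 (superpolynomialDecay_abelMean (hasExpansion_zero_iff.1 hf))
  | add P Q _ _ ihP ihQ =>
    have hP := hasExpansion_eval (l := atTop) (k := harmonicScale) P
    have hQ := hasExpansion_eval (l := atTop) (k := harmonicScale) Q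
    refine (hP.add hQ).abelMean_congr hf ?_
    rw [map_add]
    exact ((ihP hP).add (ihQ hQ)).congr fun t => (abelMean_add
      hP.mk_mem_polynomialGrowthSubalgebra hQ.mk_mem_polynomialGrowthSubalgebra t).symm
  | smul c P _ ih =>
    have hP := hasExpansion_eval (l := atTop) (k := harmonicScale) P
    have hcP := hP.const_mul c
    rw [← Polynomial.smul_eq_C_mul] at hcP
    refine hcP.abelMean_congr hf ?_
    rw [map_smul, Polynomial.smul_eq_C_mul]
    exact ((ih hP).const_mul c).congr fun t => (abelMean_const_mul c _ t).symm

end AbelMeanExpansion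

/-! ### Integrals over simplices -/

section Simplex

/-- The simplex `s ≥ t_1 ≥ ⋯ ≥ t_r ≥ 0`; by definition `orderedSimplex r = simplexUpTo r 1`. -/
def simplexUpTo (r : ℕ) (s : ℝ) : Set (Fin r → ℝ) :=
  {t | (∀ i, t i ∈ Set.Icc (0 : ℝ) s) ∧ Antitone t}

theorem measurableSet_simplexUpTo (r : ℕ) (s : ℝ) : MeasurableSet (simplexUpTo r s) := by
  have h : simplexUpTo r s = (⋂ i, {t : Fin r → ℝ | t i ∈ Set.Icc (0 : ℝ) s}) ∩
      ⋂ i, ⋂ j, ⋂ _ : i ≤ j, {t : Fin r → ℝ | t j ≤ t i} := by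
    ext t
    simp only [simplexUpTo, Antitone, Set.mem_inter_iff, Set.mem_iInter]
    rfl
  rw [h]
  refine (MeasurableSet.iInter fun i => ?_).inter
    (MeasurableSet.iInter fun i => MeasurableSet.iInter fun j => MeasurableSet.iInter fun _ => ?_)
  · exact measurable_pi_apply i measurableSet_Icc
  · exact measurableSet_le (measurable_pi_apply j) (measurable_pi_apply i)

theorem simplexUpTo_zero (s : ℝ) : simplexUpTo 0 s = Set.univ :=
  Set.eq_univ_of_forall fun _ => ⟨fun i => i.elim0, fun i => i.elim0⟩

theorem cons_mem_simplexUpTo {r : ℕ} {s x : ℝ} {t : Fin r → ℝ} :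
    (Fin.cons x t : Fin (r + 1) → ℝ) ∈ simplexUpTo (r + 1) s ↔
      x ∈ Set.Icc 0 s ∧ t ∈ simplexUpTo r x := by
  constructor
  · rintro ⟨hmem, hanti⟩
    refine ⟨by simpa using hmem 0, fun i => ⟨by simpa using (hmem i.succ).1, ?_⟩, fun i j hij => ?_⟩
    · simpa using hanti (Fin.zero_le i.succ)
    · simpa using hanti (Fin.succ_le_succ_iff.2 hij)
  · rintro ⟨hx, hmem, hanti⟩
    refine ⟨Fin.forall_fin_succ.2 ⟨by simpa using hx, fun i => ?_⟩, fun i j hij => ?_⟩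
    · exact ⟨by simpa using (hmem i).1, by simpa using (hmem i).2.trans hx.2⟩
    · induction j using Fin.cases with
      | zero => rw [Fin.le_zero_iff.1 hij]
      | succ j =>
        induction i using Fin.cases with
        | zero => simpa using (hmem j).2
        | succ i => simpa using hanti (Fin.succ_le_succ_iff.1 hij)

section Fubini

theorem measurePreserving_finCons (r : ℕ) :
    MeasurePreserving fun p : ℝ × (Fin r → ℝ) => (Fin.cons p.1 p.2 : Fin (r + 1) → ℝ) := by
  simpa [MeasurableEquiv.piFinSuccAbove, Fin.insertNthEquiv] using
    (volume_preserving_piFinSuccAbove (fun _ : Fin (r + 1) => ℝ) 0).symm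

theorem measurableEmbedding_finCons (r : ℕ) :
    MeasurableEmbedding fun p : ℝ × (Fin r → ℝ) => (Fin.cons p.1 p.2 : Fin (r + 1) → ℝ) := by
  simpa [MeasurableEquiv.piFinSuccAbove, Fin.insertNthEquiv] using
    (MeasurableEquiv.piFinSuccAbove (fun _ : Fin (r + 1) => ℝ) 0).symm.measurableEmbedding

variable {E : Type*} [NormedAddCommGroup E] {r : ℕ} {s : ℝ} {F : (Fin (r + 1) → ℝ) → E}

theorem integrable_indicator_simplexUpTo_comp_finCons
    (hF : IntegrableOn F (simplexUpTo (r + 1) s)) :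
    Integrable fun p : ℝ × (Fin r → ℝ) =>
      (simplexUpTo (r + 1) s).indicator F (Fin.cons p.1 p.2) :=
  ((measurePreserving_finCons r).integrable_comp_emb (measurableEmbedding_finCons r)).2
    (hF.integrable_indicator (measurableSet_simplexUpTo _ s))

variable [NormedSpace ℝ E]

open Classical in
theorem integral_indicator_simplexUpTo_finCons (x : ℝ) :
    ∫ t, (simplexUpTo (r + 1) s).indicator F (Fin.cons x t) =
      (Set.Icc 0 s).indicator (fun x => ∫ t in simplexUpTo r x, F (Fin.cons x t)) x := by
  by_cases hx : x ∈ Set.Icc 0 s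
  · rw [Set.indicator_of_mem hx, ← integral_indicator (measurableSet_simplexUpTo r x)]
    exact integral_congr_ae <| Eventually.of_forall fun t =>
      if_congr (cons_mem_simplexUpTo.trans (and_iff_right hx)) rfl rfl
  · simp only [Set.indicator_apply, cons_mem_simplexUpTo, hx, false_and, if_false, integral_zero]

theorem integrableOn_integral_simplexUpTo (hF : IntegrableOn F (simplexUpTo (r + 1) s)) :
    IntegrableOn (fun x => ∫ t in simplexUpTo r x, F (Fin.cons x t)) (Set.Icc 0 s) := by
  rw [← integrable_indicator_iff measurableSet_Icc]
  exact (integrable_indicator_simplexUpTo_comp_finCons hF).integral_prod_left.congr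
    (Eventually.of_forall integral_indicator_simplexUpTo_finCons)

theorem integral_simplexUpTo_succ (hF : IntegrableOn F (simplexUpTo (r + 1) s)) :
    ∫ t in simplexUpTo (r + 1) s, F t =
      ∫ x in Set.Icc 0 s, ∫ t in simplexUpTo r x, F (Fin.cons x t) := by
  rw [← integral_indicator (measurableSet_simplexUpTo _ s), ← integral_indicator measurableSet_Icc,
    ← (measurePreserving_finCons r).integral_comp (measurableEmbedding_finCons r)]
  exact (integral_prod _ (integrable_indicator_simplexUpTo_comp_finCons hF)).trans
    (integral_congr_ae (Eventually.of_forall integral_indicator_simplexUpTo_finCons))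

end Fubini

section Integrability

theorem integrableOn_rpow_mul_one_sub_rpow {a b : ℝ} (ha : 0 < a) (hb : 0 < b) :
    IntegrableOn (fun x : ℝ => x ^ (a - 1) * (1 - x) ^ (b - 1)) (Set.Ioo 0 1) := by
  have h := Complex.betaIntegral_convergent (u := a) (v := b) (by simpa) (by simpa)
  rw [intervalIntegrable_iff_integrableOn_Ioo_of_le zero_le_one] at h
  refine IntegrableOn.congr_fun h.norm (fun x hx => ?_) measurableSet_Ioo
  have h_sub : (0 : ℝ) < 1 - x := sub_pos.2 hx.2
  rw [norm_mul, ← Complex.ofReal_one, ← Complex.ofReal_sub, ← Complex.ofReal_sub,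
    ← Complex.ofReal_sub, Complex.norm_cpow_eq_rpow_re_of_pos hx.1,
    Complex.norm_cpow_eq_rpow_re_of_pos h_sub, Complex.ofReal_re, Complex.ofReal_re]

theorem simplexUpTo_ae_eq_inter_pi_Ioo (r : ℕ) {s : ℝ} (hs : s ≤ 1) :
    simplexUpTo r s =ᵐ[volume]
      (simplexUpTo r s ∩ Set.univ.pi fun _ => Set.Ioo (0 : ℝ) 1 : Set _) := by
  have h_sub : simplexUpTo r s ⊆ (Set.Icc (fun _ => 0) (fun _ => 1) : Set (Fin r → ℝ)) :=
    fun t ht => ⟨fun i => (ht.1 i).1, fun i => (ht.1 i).2.trans hs⟩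
  have h := (ae_eq_refl (μ := volume) (simplexUpTo r s)).inter
    (Measure.univ_pi_Ioo_ae_eq_Icc (f := fun _ : Fin r => (0 : ℝ)) (g := fun _ => 1)).symm
  rwa [Set.inter_eq_left.2 h_sub] at h

theorem le_prod_rpow_inv_card {ι : Type*} [Fintype ι] {x : ι → ℝ} {j : ι} (hj : 0 ≤ x j)
    (h : ∀ i, x j ≤ x i) : x j ≤ ∏ i, x i ^ (Fintype.card ι : ℝ)⁻¹ := by
  have : Nonempty ι := ⟨j⟩
  calc x j = ∏ _i : ι, x j ^ (Fintype.card ι : ℝ)⁻¹ := by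
        rw [Finset.prod_const, Finset.card_univ, Real.rpow_inv_natCast_pow hj Fintype.card_ne_zero]
    _ ≤ ∏ i, x i ^ (Fintype.card ι : ℝ)⁻¹ :=
        Finset.prod_le_prod (fun _ _ => Real.rpow_nonneg hj _) fun i _ =>
          Real.rpow_le_rpow hj (h i) (by positivity)

theorem mul_prod_inv_le_prod_rpow {ι : Type*} [Fintype ι] {x : ι → ℝ} {j : ι} (hj : 0 < x j)
    (h : ∀ i, x j ≤ x i) :
    x j * ∏ i, (x i)⁻¹ ≤ ∏ i, x i ^ ((Fintype.card ι : ℝ)⁻¹ - 1) := by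
  have hx : ∀ i, 0 < x i := fun i => hj.trans_le (h i)
  calc x j * ∏ i, (x i)⁻¹ ≤ (∏ i, x i ^ (Fintype.card ι : ℝ)⁻¹) * ∏ i, (x i)⁻¹ := by
        gcongr
        · exact Finset.prod_nonneg fun i _ => inv_nonneg.2 (hx i).le
        · exact le_prod_rpow_inv_card hj.le h
    _ = ∏ i, x i ^ ((Fintype.card ι : ℝ)⁻¹ - 1) := by
        rw [← Finset.prod_mul_distrib]
        exact Finset.prod_congr rfl fun i _ => by
          rw [Real.rpow_sub_one (hx i).ne', div_eq_mul_inv]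

/-- The missing poles at `t_1 = 1` and at `t_r = 0` are spread over all the coordinates: as `t_r` is
the smallest of them, `t_r ≤ ∏ t_i ^ (1 / r)`, and similarly for `1 - t_1`. This leaves a product of
beta densities. -/
theorem integrableOn_simplexUpTo {E : Type*} [NormedAddCommGroup E] {r : ℕ} {s C : ℝ}
    (hs : s ≤ 1) (hC : 0 ≤ C) {F : (Fin (r + 1) → ℝ) → E} (hFm : AEStronglyMeasurable F)
    (hF : ∀ t ∈ simplexUpTo (r + 1) s, (∀ i, t i ∈ Set.Ioo 0 1) →
      ‖F t‖ ≤ C * ((t (Fin.last r) * ∏ i, (t i)⁻¹) * ((1 - t 0) * ∏ i, (1 - t i)⁻¹))) :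
    IntegrableOn F (simplexUpTo (r + 1) s) := by
  set δ : ℝ := (Fintype.card (Fin (r + 1)) : ℝ)⁻¹
  have hδ_pos : 0 < δ := inv_pos.2 (Nat.cast_pos.2 Fintype.card_pos)
  rw [integrableOn_congr_set_ae (simplexUpTo_ae_eq_inter_pi_Ioo _ hs)]
  have h_beta : IntegrableOn (fun t : Fin (r + 1) → ℝ =>
      C * ∏ i, (t i ^ (δ - 1) * (1 - t i) ^ (δ - 1))) (Set.univ.pi fun _ => Set.Ioo 0 1) := by
    rw [IntegrableOn, volume_pi, Measure.restrict_pi_pi]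
    exact (Integrable.fintype_prod fun _ =>
      integrableOn_rpow_mul_one_sub_rpow hδ_pos hδ_pos).const_mul C
  refine (h_beta.mono_set Set.inter_subset_right).mono' hFm.restrict <|
    ae_restrict_of_forall_mem ((measurableSet_simplexUpTo _ s).inter
      (MeasurableSet.univ_pi fun _ => measurableSet_Ioo)) fun t ⟨ht, htU⟩ => ?_
  have ht_mem : ∀ i, t i ∈ Set.Ioo (0 : ℝ) 1 := fun i => htU i trivial
  have h_last : t (Fin.last r) * ∏ i, (t i)⁻¹ ≤ ∏ i, t i ^ (δ - 1) :=
    mul_prod_inv_le_prod_rpow (ht_mem _).1 fun i => ht.2 (Fin.le_last i)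
  have h_first : (1 - t 0) * ∏ i, (1 - t i)⁻¹ ≤ ∏ i, (1 - t i) ^ (δ - 1) :=
    mul_prod_inv_le_prod_rpow (x := fun i => 1 - t i) (sub_pos.2 (ht_mem 0).2) fun i =>
      sub_le_sub_left (ht.2 (Fin.zero_le i)) 1
  refine (hF t ht ht_mem).trans ?_
  rw [Finset.prod_mul_distrib]
  gcongr
  · exact mul_nonneg (sub_nonneg.2 (ht_mem 0).2.le) <|
      Finset.prod_nonneg fun i _ => inv_nonneg.2 (sub_nonneg.2 (ht_mem i).2.le)
  · exact Finset.prod_nonneg fun i _ => Real.rpow_nonneg (ht_mem i).1.le _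

end Integrability

end Simplex

/-! ### Convergent iterated integrals -/

section Density

variable {Γ : Subgroup ℂˣ}

theorem omegaDensity_zero (x : ℝ) : omegaDensity (0 : XLetter Γ) x = 1 / (x : ℂ) := rfl

theorem omegaDensity_coe (σ : Γ) (x : ℝ) :
    omegaDensity (σ : XLetter Γ) x = 1 / (((σ : ℂˣ) : ℂ)⁻¹ - (x : ℂ)) := rfl

theorem measurable_omegaDensity (a : XLetter Γ) : Measurable (omegaDensity a) := by
  rcases eq_or_ne a 0 with rfl | ha
  · simp only [funext omegaDensity_zero]
    fun_prop
  · obtain ⟨σ, rfl⟩ := WithZero.ne_zero_iff_exists.1 ha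
    simp only [funext (omegaDensity_coe σ)]
    fun_prop

theorem norm_omegaDensity_zero {x : ℝ} (hx : 0 ≤ x) : ‖omegaDensity (0 : XLetter Γ) x‖ = x⁻¹ := by
  rw [omegaDensity_zero, norm_div, norm_one, one_div, Complex.norm_real, Real.norm_of_nonneg hx]

theorem norm_omegaDensity_one {x : ℝ} (hx : x ≤ 1) :
    ‖omegaDensity (1 : XLetter Γ) x‖ = (1 - x)⁻¹ := by
  rw [← WithZero.coe_one, omegaDensity_coe, OneMemClass.coe_one, Units.val_one, inv_one, norm_div,
    norm_one, one_div, ← Complex.ofReal_one, ← Complex.ofReal_sub, Complex.norm_real,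
    Real.norm_of_nonneg (sub_nonneg.2 hx)]

variable [Finite Γ]

theorem exists_norm_omegaDensity_coe_le {σ : Γ} (hσ : σ ≠ 1) :
    ∃ C, ∀ x ∈ Set.Icc (0 : ℝ) 1, ‖omegaDensity (σ : XLetter Γ) x‖ ≤ C := by
  refine isCompact_Icc.exists_bound_of_continuousOn ?_
  refine continuousOn_const.div (by fun_prop) fun x hx h => hσ ?_
  rw [sub_eq_zero] at h
  have hx_one := congrArg norm h
  rw [norm_inv, norm_coe_subgroup, inv_one, Complex.norm_real, Real.norm_of_nonneg hx.1] at hx_one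
  rw [← hx_one, Complex.ofReal_one, inv_eq_one] at h
  exact Subtype.ext (Units.ext h)

open Classical in
theorem exists_norm_omegaDensity_le (a : XLetter Γ) :
    ∃ C, 0 ≤ C ∧ ∀ x ∈ Set.Ioo (0 : ℝ) 1, ‖omegaDensity a x‖ ≤
      C * ((if a = 0 then x⁻¹ else 1) * (if a = 1 then (1 - x)⁻¹ else 1)) := by
  rcases eq_or_ne a 0 with rfl | h_zero
  · exact ⟨1, zero_le_one, fun x hx => by simp [norm_omegaDensity_zero hx.1.le]⟩
  rcases eq_or_ne a 1 with rfl | h_one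
  · exact ⟨1, zero_le_one, fun x hx => by simp [norm_omegaDensity_one hx.2.le]⟩
  obtain ⟨σ, rfl⟩ := WithZero.ne_zero_iff_exists.1 h_zero
  obtain ⟨C, hC⟩ := exists_norm_omegaDensity_coe_le (σ := σ) (by rintro rfl; exact h_one rfl)
  refine ⟨C, (norm_nonneg _).trans (hC 0 (by simp)), fun x hx => ?_⟩
  rw [if_neg h_zero, if_neg h_one, mul_one, mul_one]
  exact hC x (Set.Ioo_subset_Icc_self hx)

theorem seriesEval_letterSeries (a : XLetter Γ) {x : ℝ} (hx : x ∈ Set.Ioo (0 : ℝ) 1) :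
    seriesEval (x : ℂ) (letterSeries Γ a) = x * omegaDensity a x := by
  have hx_ne : (x : ℂ) ≠ 0 := Complex.ofReal_ne_zero.2 hx.1.ne'
  rcases eq_or_ne a 0 with rfl | ha
  · rw [letterSeries_zero, ← map_one (algebraMap ℂ (PowerSeries ℂ)), seriesEval_algebraMap,
      omegaDensity_zero, mul_one_div_cancel hx_ne]
  · obtain ⟨σ, rfl⟩ := WithZero.ne_zero_iff_exists.1 ha
    have hσ : ((σ : ℂˣ) : ℂ) ≠ 0 := Units.ne_zero _
    have hnorm : ‖((σ : ℂˣ) : ℂ) * x‖ < 1 := by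
      rw [norm_mul, norm_coe_subgroup, one_mul]
      exact norm_coe_Ioo_zero_one_lt_one ⟨x, hx⟩
    have hval : (x : ℂ) * omegaDensity (σ : XLetter Γ) x =
        ((σ : ℂˣ) : ℂ) * x * (1 - ((σ : ℂˣ) : ℂ) * x)⁻¹ := by
      have hden : ((σ : ℂˣ) : ℂ)⁻¹ - x = (1 - ((σ : ℂˣ) : ℂ) * x) / ((σ : ℂˣ) : ℂ) := by
        field_simp
      rw [omegaDensity_coe, hden, one_div_div]
      ring
    have hsum : HasSum (fun n => PowerSeries.coeff (n + 1) (letterSeries Γ (σ : XLetter Γ)) *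
        (x : ℂ) ^ (n + 1)) (x * omegaDensity (σ : XLetter Γ) x) := by
      rw [hval]
      refine ((hasSum_geometric_of_norm_lt_one hnorm).mul_left _).congr_fun fun n => ?_
      rw [coeff_letterSeries_coe, if_neg n.succ_ne_zero, ← mul_pow, pow_succ']
    have h := HasSum.zero_add
      (f := fun n => PowerSeries.coeff n (letterSeries Γ (σ : XLetter Γ)) * (x : ℂ) ^ n) hsum
    rw [coeff_letterSeries_coe, if_pos rfl, zero_mul, zero_add] at h
    exact h.tsum_eq

end Density

section SimplexIntegral

theorem prod_ite_inv_le_prod_inv {ι : Type*} {p : ι → Prop} [DecidablePred p] (s : Finset ι)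
    {x : ι → ℝ} (hx : ∀ i, x i ∈ Set.Ioo (0 : ℝ) 1) :
    ∏ i ∈ s, (if p i then (x i)⁻¹ else 1) ≤ ∏ i ∈ s, (x i)⁻¹ := by
  refine Finset.prod_le_prod (fun i _ => ?_) fun i _ => ?_
  · split_ifs <;> [exact inv_nonneg.2 (hx i).1.le; exact zero_le_one]
  · split_ifs <;> [exact le_rfl; exact (one_le_inv₀ (hx i).1).2 (hx i).2.le]

theorem prod_ite_inv_le_mul_prod_inv {ι : Type*} [Fintype ι] {p : ι → Prop} [DecidablePred p]
    {x : ι → ℝ} (hx : ∀ i, x i ∈ Set.Ioo (0 : ℝ) 1) {j : ι} (hj : ¬p j) :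
    ∏ i, (if p i then (x i)⁻¹ else 1) ≤ x j * ∏ i, (x i)⁻¹ := by
  classical
  rw [← Finset.mul_prod_erase _ _ (Finset.mem_univ j), ← Finset.mul_prod_erase _ _
    (Finset.mem_univ j), if_neg hj, one_mul, mul_inv_cancel_left₀ (hx j).1.ne']
  exact prod_ite_inv_le_prod_inv _ hx

theorem exists_prod_ite_inv_one_sub_le {r : ℕ} {s : ℝ} {p : Fin (r + 1) → Prop} [DecidablePred p]
    (hp : ¬p 0 ∨ s < 1) :
    ∃ D, 0 ≤ D ∧ ∀ t ∈ simplexUpTo (r + 1) s, (∀ i, t i ∈ Set.Ioo (0 : ℝ) 1) →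
      ∏ i, (if p i then (1 - t i)⁻¹ else 1) ≤ D * ((1 - t 0) * ∏ i, (1 - t i)⁻¹) := by
  have h_mem : ∀ {t : Fin (r + 1) → ℝ}, (∀ i, t i ∈ Set.Ioo (0 : ℝ) 1) →
      ∀ i, 1 - t i ∈ Set.Ioo (0 : ℝ) 1 := fun ht i =>
    ⟨sub_pos.2 (ht i).2, sub_lt_self 1 (ht i).1⟩
  rcases hp with hp | hs
  · refine ⟨1, zero_le_one, fun t _ ht => ?_⟩
    rw [one_mul]
    exact prod_ite_inv_le_mul_prod_inv (h_mem ht) hp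
  · refine ⟨(1 - s)⁻¹, inv_nonneg.2 (sub_pos.2 hs).le, fun t hts ht => ?_⟩
    refine (prod_ite_inv_le_prod_inv _ (h_mem ht)).trans ?_
    rw [← mul_assoc]
    refine le_mul_of_one_le_left
      (Finset.prod_nonneg fun i _ => inv_nonneg.2 (h_mem ht i).1.le) ?_
    rw [inv_mul_eq_div, one_le_div (sub_pos.2 hs)]
    exact sub_le_sub_left (hts.1 0).2 1

variable {Γ : Subgroup ℂˣ}

/-- The iterated integral of a word over the simplex with `t_1 ≤ s`. -/
def simplexIntegral (w : List (XLetter Γ)) (s : ℝ) : ℂ :=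
  ∫ t in simplexUpTo w.length s, ∏ i, omegaDensity (w.get i) (t i)

theorem simplexIntegral_nil (s : ℝ) : simplexIntegral ([] : List (XLetter Γ)) s = 1 := by
  change ∫ t in simplexUpTo 0 s, ∏ i : Fin 0, omegaDensity (([] : List (XLetter Γ)).get i) (t i) = 1
  rw [simplexUpTo_zero, Measure.restrict_univ, volume_pi, Measure.pi_of_empty]
  simp

theorem integral_simplexUpTo_prod_cons (a : XLetter Γ) (w : List (XLetter Γ)) (x : ℝ) :
    ∫ t in simplexUpTo w.length x, ∏ i : Fin (w.length + 1),
      omegaDensity ((a :: w).get i) ((Fin.cons x t : Fin (w.length + 1) → ℝ) i) =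
        omegaDensity a x * simplexIntegral w x := by
  rw [simplexIntegral, ← integral_const_mul]
  simp only [Fin.prod_univ_succ, Fin.cons_zero, Fin.cons_succ]
  rfl

variable [Finite Γ]

theorem integrableOn_prod_omegaDensity {r : ℕ} {σ : Fin (r + 1) → XLetter Γ}
    (h_last : σ (Fin.last r) ≠ 0) {s : ℝ} (hs : s ≤ 1) (h_first : σ 0 ≠ 1 ∨ s < 1) :
    IntegrableOn (fun t : Fin (r + 1) → ℝ => ∏ i, omegaDensity (σ i) (t i))
      (simplexUpTo (r + 1) s) := by
  classical
  choose C hC_nonneg hC using fun i => exists_norm_omegaDensity_le (σ i)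
  obtain ⟨D, hD_nonneg, hD⟩ := exists_prod_ite_inv_one_sub_le (p := fun i => σ i = 1) h_first
  have hC_prod : 0 ≤ ∏ i, C i := Finset.prod_nonneg fun i _ => hC_nonneg i
  refine integrableOn_simplexUpTo hs (mul_nonneg hC_prod hD_nonneg)
    (Finset.measurable_prod _ fun i _ => (measurable_omegaDensity (σ i)).comp
      (measurable_pi_apply i)).aestronglyMeasurable fun t hts ht => ?_
  have h_poles_zero := prod_ite_inv_le_mul_prod_inv (p := fun i => σ i = 0) ht h_last
  have h_poles_one := hD t hts ht
  calc ‖∏ i, omegaDensity (σ i) (t i)‖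
      ≤ ∏ i, (C i * ((if σ i = 0 then (t i)⁻¹ else 1) *
          (if σ i = 1 then (1 - t i)⁻¹ else 1))) := by
        rw [norm_prod]
        exact Finset.prod_le_prod (fun i _ => norm_nonneg _) fun i _ => hC i (t i) (ht i)
    _ = (∏ i, C i) * ((∏ i, if σ i = 0 then (t i)⁻¹ else 1) *
          ∏ i, if σ i = 1 then (1 - t i)⁻¹ else 1) := by
        rw [Finset.prod_mul_distrib, Finset.prod_mul_distrib]
    _ ≤ (∏ i, C i) * ((t (Fin.last r) * ∏ i, (t i)⁻¹) *
          (D * ((1 - t 0) * ∏ i, (1 - t i)⁻¹))) := by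
        gcongr
        · refine Finset.prod_nonneg fun i _ => ?_
          split_ifs <;> [exact inv_nonneg.2 (sub_pos.2 (ht i).2).le; exact zero_le_one]
        · exact mul_nonneg (ht _).1.le (Finset.prod_nonneg fun i _ => inv_nonneg.2 (ht i).1.le)
    _ = _ := by ring

theorem integrableOn_simplexUpTo_word {w : List (XLetter Γ)} (h_last : w.getLast? ≠ some 0) {s : ℝ}
    (hs : s ≤ 1) (h_first : w.head? ≠ some 1 ∨ s < 1) :
    IntegrableOn (fun t : Fin w.length → ℝ => ∏ i, omegaDensity (w.get i) (t i))
      (simplexUpTo w.length s) := by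
  cases w with
  | nil =>
    have h_sub : (simplexUpTo 0 s).Subsingleton := Set.subsingleton_of_subsingleton
    exact (h_sub.continuousOn _).integrableOn_compact h_sub.isCompact
  | cons a w =>
    refine integrableOn_prod_omegaDensity (r := w.length) (σ := (a :: w).get) ?_ hs ?_
    · rintro h
      refine h_last ?_
      rw [List.getLast?_eq_getElem?, ← h]
      simp
    · simpa using h_first

variable {a : XLetter Γ} {w : List (XLetter Γ)} {s : ℝ}

theorem intervalIntegrable_omegaDensity_mul_simplexIntegral
    (h_last : (a :: w).getLast? ≠ some 0) (hs0 : 0 ≤ s) (hs1 : s ≤ 1) (h_first : a ≠ 1 ∨ s < 1) :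
    IntervalIntegrable (fun x => omegaDensity a x * simplexIntegral w x) volume 0 s := by
  rw [intervalIntegrable_iff_integrableOn_Icc_of_le hs0]
  simp only [← integral_simplexUpTo_prod_cons]
  exact integrableOn_integral_simplexUpTo
    (integrableOn_simplexUpTo_word h_last hs1 (by simpa using h_first))

theorem simplexIntegral_cons (h_last : (a :: w).getLast? ≠ some 0) (hs0 : 0 ≤ s) (hs1 : s ≤ 1)
    (h_first : a ≠ 1 ∨ s < 1) :
    simplexIntegral (a :: w) s = ∫ x in (0 : ℝ)..s, omegaDensity a x * simplexIntegral w x := by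
  rw [intervalIntegral.integral_of_le hs0, ← integral_Icc_eq_integral_Ioc]
  simp only [← integral_simplexUpTo_prod_cons]
  exact integral_simplexUpTo_succ
    (integrableOn_simplexUpTo_word h_last hs1 (by simpa using h_first))

theorem continuousOn_simplexIntegral (h_first : w.head? ≠ some 1) (h_last : w.getLast? ≠ some 0) :
    ContinuousOn (simplexIntegral w) (Set.Icc 0 1) := by
  cases w with
  | nil => exact continuousOn_const.congr fun s _ => simplexIntegral_nil s
  | cons a w =>
    have ha : a ≠ 1 := by simpa using h_first
    have hint := intervalIntegrable_omegaDensity_mul_simplexIntegral h_last zero_le_one le_rfl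
      (Or.inl ha)
    rw [intervalIntegrable_iff_integrableOn_Icc_of_le zero_le_one,
      ← Set.uIcc_of_le zero_le_one] at hint
    rw [← Set.uIcc_of_le zero_le_one]
    refine (intervalIntegral.continuousOn_primitive_interval hint).congr fun s hs => ?_
    rw [Set.uIcc_of_le zero_le_one] at hs
    exact simplexIntegral_cons h_last hs.1 hs.2 (Or.inl ha)

theorem seriesEval_derivative_iteratedSeries_cons (h_last : (a :: w).getLast? ≠ some 0) {x : ℝ}
    (hx : x ∈ Set.Ioo (0 : ℝ) 1) :
    seriesEval (x : ℂ) (PowerSeries.derivative ℂ (iteratedSeries Γ (a :: w))) =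
      omegaDensity a x * seriesEval (x : ℂ) (iteratedSeries Γ w) := by
  have hnorm := norm_coe_Ioo_zero_one_lt_one ⟨x, hx⟩
  have h := congrArg (seriesEval (x : ℂ)) (eulerDerivation_iteratedSeries Γ (a :: w))
  rw [backSeries, if_neg h_last, sub_zero, frontSeries, eulerDerivation, Derivation.smul_apply,
    smul_eq_mul, seriesEval_mul X_mem_polynomialGrowthSubalgebra
      (derivative_mem_polynomialGrowthSubalgebra
        (iteratedSeries_mem_polynomialGrowthSubalgebra Γ _)) hnorm, seriesEval_X,
    seriesEval_mul (letterSeries_mem_polynomialGrowthSubalgebra Γ a)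
      (iteratedSeries_mem_polynomialGrowthSubalgebra Γ w) hnorm,
    seriesEval_letterSeries a hx, mul_assoc] at h
  exact mul_left_cancel₀ (Complex.ofReal_ne_zero.2 hx.1.ne') h

theorem simplexIntegral_eq_seriesEval (h_last : w.getLast? ≠ some 0) (hs0 : 0 ≤ s) (hs1 : s < 1) :
    simplexIntegral w s = seriesEval (s : ℂ) (iteratedSeries Γ w) := by
  induction w generalizing s with
  | nil =>
    rw [simplexIntegral_nil, iteratedSeries_nil, ← map_one (algebraMap ℂ (PowerSeries ℂ)),
      seriesEval_algebraMap]
  | cons a w ih =>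
    have h_last' : w.getLast? ≠ some 0 := by
      cases w with
      | nil => simp
      | cons b w => rwa [List.getLast?_cons_cons] at h_last
    have hderiv : ∀ x ∈ Set.Icc 0 s, HasDerivAt
        (fun x : ℝ => seriesEval (x : ℂ) (iteratedSeries Γ (a :: w)))
        (seriesEval (x : ℂ) (PowerSeries.derivative ℂ (iteratedSeries Γ (a :: w)))) x :=
      fun x hx => (hasDerivAt_seriesEval (iteratedSeries_mem_polynomialGrowthSubalgebra Γ _) <| by
        rw [Complex.norm_real, Real.norm_of_nonneg hx.1]
        exact hx.2.trans_lt hs1).comp_ofReal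
    have hderiv_eq : ∀ x ∈ Set.Ioo 0 s,
        seriesEval (x : ℂ) (PowerSeries.derivative ℂ (iteratedSeries Γ (a :: w))) =
          omegaDensity a x * simplexIntegral w x := fun x hx => by
      rw [seriesEval_derivative_iteratedSeries_cons h_last ⟨hx.1, hx.2.trans hs1⟩,
        ih h_last' hx.1.le (hx.2.trans hs1)]
    rw [simplexIntegral_cons h_last hs0 hs1.le (Or.inr hs1),
      intervalIntegral.integral_eq_sub_of_hasDerivAt_of_le hs0
        (fun x hx => (hderiv x hx).continuousAt.continuousWithinAt)
        (fun x hx => (hderiv x (Set.Ioo_subset_Icc_self hx)).congr_deriv (hderiv_eq x hx))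
        (intervalIntegrable_omegaDensity_mul_simplexIntegral h_last hs0 hs1.le (Or.inr hs1)),
      Complex.ofReal_zero, seriesEval_zero, constantCoeff_iteratedSeries Γ (List.cons_ne_nil a w),
      sub_zero]

theorem hasIteratedIntegral_simplexIntegral (h_first : w.head? ≠ some 1)
    (h_last : w.getLast? ≠ some 0) :
    HasIteratedIntegral (fun i => w.get i) (simplexIntegral w 1) :=
  ⟨integrableOn_simplexUpTo_word h_last le_rfl (Or.inl h_first), rfl⟩

theorem tendsto_iteratedValue (h_first : w.head? ≠ some 1) (h_last : w.getLast? ≠ some 0) :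
    Tendsto (iteratedValue Γ w) atTop (𝓝 (simplexIntegral w 1)) := by
  have hval : iteratedValue Γ w = fun t : Set.Ioo (0 : ℝ) 1 => simplexIntegral w t :=
    funext fun t => (simplexIntegral_eq_seriesEval h_last t.2.1.le t.2.2).symm
  rw [hval, tendsto_comp_coe_Ioo_atTop zero_lt_one, ← nhdsWithin_Ioo_eq_nhdsLT zero_lt_one]
  exact ((continuousOn_simplexIntegral h_first h_last 1 (Set.right_mem_Icc.2 zero_le_one)).mono
    Set.Ioo_subset_Icc_self).tendsto

end SimplexIntegral

/-! ### The integral series -/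

theorem rho_C (c : ℂ) : rho (Polynomial.C c) = Polynomial.C c := by
  have hA : PowerSeries.coeff 0 seriesA = 1 := by
    rw [seriesA, PowerSeries.coeff_zero_eq_constantCoeff_apply, PowerSeries.constantCoeff_inv,
      constantCoeff_seriesS, inv_one]
  have hT : PowerSeries.coeff 0 expTu = 1 := by
    rw [coeff_expTu, pow_zero, mul_one, Nat.factorial_zero, Nat.cast_one, inv_one, map_one]
  have h_one : rho 1 = 1 := by
    have h := rho_expTu 0
    rwa [PowerSeries.coeff_mul, Finset.HasAntidiagonal.antidiagonal_zero, Finset.sum_singleton,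
      PowerSeries.coeff_map, hA, hT, Polynomial.C_1, mul_one] at h
  rw [← mul_one (Polynomial.C c), ← Polynomial.smul_eq_C_mul, map_smul, h_one]

section Indices

variable (Γ : Subgroup ℂˣ)

theorem head?_relativeRatios_ne {l : List (YLetter Γ)} (hl : (xWord Γ l).head? ≠ some 1) :
    (relativeRatios Γ 1 l).head? ≠ some (1, 1) := by
  cases l with
  | nil => simp [relativeRatios]
  | cons y l =>
    obtain ⟨n, σ⟩ := y
    intro h
    simp only [relativeRatios, List.head?_cons, inv_one, mul_one, Option.some.injEq,
      Prod.mk.injEq] at h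
    obtain ⟨rfl, rfl⟩ := h
    exact hl rfl

theorem xWord_ofFn {r : ℕ} (s : Fin r → ℕ+) (σ : Fin r → Γ) :
    xWord Γ (List.ofFn fun i => (s i, σ i)) = integralIndex s σ := by
  induction r with
  | zero => simp [xWord, integralIndex]
  | succ r ih =>
    have h := ih (fun i => s i.succ) (fun i => σ i.succ)
    rw [integralIndex] at h ⊢
    rw [List.ofFn_succ, List.ofFn_succ, xWord, h, List.flatten_cons, List.append_assoc]
    rfl

theorem relativeRatios_ofFn (p : Γ) {r : ℕ} (s : Fin r → ℕ+) (σ : Fin r → Γ) :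
    relativeRatios Γ p (List.ofFn fun i => (s i, σ i)) = List.ofFn fun i : Fin r =>
      (s i, σ i * ((Fin.cons p σ : Fin (r + 1) → Γ) i.castSucc)⁻¹) := by
  induction r generalizing p with
  | zero => simp [relativeRatios]
  | succ r ih =>
    rw [List.ofFn_succ, List.ofFn_succ, relativeRatios,
      ih (σ 0) (fun i => s i.succ) (fun i => σ i.succ)]
    congr 2
    funext i
    cases r with
    | zero => exact i.elim0
    | succ r =>
      induction i using Fin.cases with
      | zero => simp
      | succ i => simp

theorem relativeRatios_one_ofFn {r : ℕ} (s : Fin r → ℕ+) (σ : Fin r → Γ) :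
    relativeRatios Γ 1 (List.ofFn fun i => (s i, σ i)) =
      List.ofFn fun i => (s i, successiveRatios σ i) := by
  rw [relativeRatios_ofFn]
  congr 1
  funext i
  cases r with
  | zero => exact i.elim0
  | succ r =>
    induction i using Fin.cases with
    | zero => simp [successiveRatios]
    | succ i =>
      rw [← Fin.succ_castSucc, Fin.cons_succ, successiveRatios, if_neg (by simp)]
      rfl

end Indices

section IntegralPoly

variable (Γ : Subgroup ℂˣ) [Finite Γ]

theorem hasExpansion_iteratedValue_xWord (l : List (YLetter Γ)) :
    HasExpansion atTop logScale (iteratedValue Γ (xWord Γ l))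
      (rho (polylogPoly Γ (relativeRatios Γ 1 l))) :=
  abelMean_truncatedSum_relativeRatios Γ l ▸ (hasExpansion_polylogPoly Γ _).abelMean

theorem exists_hasExpansion_iteratedValue (w : List (XLetter Γ)) :
    ∃ P, HasExpansion atTop logScale (iteratedValue Γ w) P := by
  refine (isQuasiShuffleChar_iteratedValue Γ).mem_of_getLast?_ne (b := 0)
    (expansionSubalgebra atTop logScale) ?_ (fun w hw => ?_) w
  · rw [iteratedValue_singleton_zero]
    exact zero_mem _
  · obtain ⟨l, rfl⟩ := exists_xWord_eq Γ hw
    exact ⟨_, hasExpansion_iteratedValue_xWord Γ l⟩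

/-- The polynomial `P` such that the regularized iterated integral of the word `w` up to `t` is
`P(-log (1 - t))`, up to a small error as `t → 1`. -/
def integralPoly (w : List (XLetter Γ)) : Polynomial ℂ :=
  (exists_hasExpansion_iteratedValue Γ w).choose

theorem hasExpansion_integralPoly (w : List (XLetter Γ)) :
    HasExpansion atTop logScale (iteratedValue Γ w) (integralPoly Γ w) :=
  (exists_hasExpansion_iteratedValue Γ w).choose_spec

theorem isQuasiShuffleChar_integralPoly : IsQuasiShuffleChar noMerge (integralPoly Γ) :=
  (isQuasiShuffleChar_iteratedValue Γ).of_hasExpansion tendsto_norm_logScale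
    (hasExpansion_integralPoly Γ)

theorem integralPoly_singleton_one : integralPoly Γ [1] = Polynomial.X :=
  (hasExpansion_integralPoly Γ _).unique tendsto_norm_logScale
    (iteratedValue_singleton_one Γ ▸ hasExpansion_self)

theorem integralPoly_singleton_zero : integralPoly Γ [0] = 0 := by
  have h : HasExpansion atTop logScale (iteratedValue Γ [0]) (Polynomial.C 0) :=
    iteratedValue_singleton_zero Γ ▸ hasExpansion_const 0
  rw [(hasExpansion_integralPoly Γ _).unique tendsto_norm_logScale h, Polynomial.C_0]

theorem integralPoly_xWord (l : List (YLetter Γ)) :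
    integralPoly Γ (xWord Γ l) = rho (polylogPoly Γ (relativeRatios Γ 1 l)) :=
  (hasExpansion_integralPoly Γ _).unique tendsto_norm_logScale
    (hasExpansion_iteratedValue_xWord Γ l)

theorem integralPoly_of_head?_ne_of_getLast?_ne {w : List (XLetter Γ)}
    (h_first : w.head? ≠ some 1) (h_last : w.getLast? ≠ some 0) :
    integralPoly Γ w = Polynomial.C (simplexIntegral w 1) := by
  obtain ⟨v, rfl⟩ := exists_xWord_eq Γ h_last
  obtain ⟨l, hl, -⟩ := polylogPoly_of_head?_ne Γ (head?_relativeRatios_ne Γ h_first)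
  have hP : integralPoly Γ (xWord Γ v) = Polynomial.C l := by rw [integralPoly_xWord, hl, rho_C]
  have hlim : Tendsto (iteratedValue Γ (xWord Γ v)) atTop (𝓝 l) :=
    (hP ▸ hasExpansion_integralPoly Γ (xWord Γ v)).tendsto
  rw [hP, tendsto_nhds_unique hlim (tendsto_iteratedValue h_first h_last)]

end IntegralPoly

section IntegralSeries

variable (Γ : Subgroup ℂˣ)

theorem integralPoly_eq_expMulCoeff [Finite Γ] {I : NCSeries (XLetter Γ) ℂ}
    (hI : IsIntegralSeries Γ I) : integralPoly Γ = expMulCoeff 1 I := by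
  refine (isQuasiShuffleChar_integralPoly Γ).ext_of_head?_ne_of_getLast?_ne (a := 1) (b := 0)
    (isQuasiShuffleChar_expMulCoeff (by simp) hI.isQuasiShuffleChar) one_ne_zero ?_ ?_
    fun w h_first h_last => ?_
  · rw [integralPoly_singleton_one, expMulCoeff_singleton hI.diagonal.1 hI.coeff_x_one]
  · rw [integralPoly_singleton_zero, expMulCoeff_of_head?_ne (by simp)]
    exact (congrArg Polynomial.C hI.coeff_x_zero).trans Polynomial.C_0 |>.symm
  · rw [integralPoly_of_head?_ne_of_getLast?_ne Γ h_first h_last, expMulCoeff_of_head?_ne h_first]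
    exact congrArg Polynomial.C (hI.convergent (FreeMonoid.ofList w) h_first h_last).2

theorem isIntegralSeries_eval_zero_integralPoly [Finite Γ] :
    IsIntegralSeries Γ fun w => (integralPoly Γ w.toList).eval 0 where
  diagonal := ((isQuasiShuffleCoproduct_shuffleCoproduct Γ).isDiagonal_iff _).2
    ((isQuasiShuffleChar_integralPoly Γ).comp (Polynomial.evalRingHom 0))
  convergent w h_first h_last := by
    rw [integralPoly_of_head?_ne_of_getLast?_ne Γ h_first h_last, Polynomial.eval_C]
    exact hasIteratedIntegral_simplexIntegral h_first h_last
  coeff_x_zero := by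
    rw [FreeMonoid.toList_of, integralPoly_singleton_zero, Polynomial.eval_zero]
  coeff_x_one := by
    rw [FreeMonoid.toList_of, integralPoly_singleton_one, Polynomial.eval_X]

theorem existsUnique_isIntegralSeries [Finite Γ] :
    ∃! I : NCSeries (XLetter Γ) ℂ, IsIntegralSeries Γ I :=
  ⟨_, isIntegralSeries_eval_zero_integralPoly Γ, fun I hI => funext fun w => by
    rw [integralPoly_eq_expMulCoeff Γ hI, eval_zero_expMulCoeff]; rfl⟩

theorem rho_stuffleRegLi [Fintype Γ] {L : NCSeries (YLetter Γ) ℂ} {I : NCSeries (XLetter Γ) ℂ}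
    (hL : IsPolylogSeries Γ L) (hI : IsIntegralSeries Γ I) {r : ℕ} (s : Fin r → ℕ+)
    (σ : Fin r → Γ) :
    rho (stuffleRegLi L s (successiveRatios σ)) = shuffleRegI I (integralIndex s σ) := by
  let l := List.ofFn fun i => (s i, σ i)
  calc rho (stuffleRegLi L s (successiveRatios σ))
      = rho (expMulCoeff (1, 1) L (relativeRatios Γ 1 l)) := by
        rw [relativeRatios_one_ofFn]
        rfl
    _ = rho (polylogPoly Γ (relativeRatios Γ 1 l)) := by rw [polylogPoly_eq_expMulCoeff Γ hL]
    _ = integralPoly Γ (xWord Γ l) := (integralPoly_xWord Γ l).symm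
    _ = expMulCoeff 1 I (integralIndex s σ) := by
        rw [integralPoly_eq_expMulCoeff Γ hI, xWord_ofFn]
    _ = shuffleRegI I (integralIndex s σ) := rfl

end IntegralSeries

end

theorem mainTheorem10 (Γ : Subgroup ℂˣ) [Fintype Γ] :
    (∃! L : NCSeries (YLetter Γ) ℂ, IsPolylogSeries Γ L) ∧
    (∃! I : NCSeries (XLetter Γ) ℂ, IsIntegralSeries Γ I) ∧
    ∀ (L : NCSeries (YLetter Γ) ℂ) (I : NCSeries (XLetter Γ) ℂ),
      IsPolylogSeries Γ L → IsIntegralSeries Γ I →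
      ∀ (r : ℕ) (s : Fin r → ℕ+) (σ : Fin r → Γ),
        rho (stuffleRegLi L s (successiveRatios σ)) = shuffleRegI I (integralIndex s σ) :=
  ⟨existsUnique_isPolylogSeries Γ, existsUnique_isIntegralSeries Γ,
    fun _ _ hL hI _ s σ => rho_stuffleRegLi Γ hL hI s σ⟩
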